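/- Let $\mathcal F$ be the class of functions $f:\mathbb R\to\mathbb R\cup\{\infty\}$ such that: (1) $f(0)=0$ and $f$ is right continuous at $0$; (2) $f$ is finite and continuously differentiable on $(0,\infty)$ with $f'>0$ there, there are $a_1>0$ and $a_2\ge 0$ with $f'(x)\ge a_1$ for all $x>a_2$, and there are $1<q<2$ and $a_3>0$ with $\liminf_{x\downarrow 0} f'(x)^q/f(x)\ge a_3$; (3) either $f(x)=\infty$ for all $x<0$, or $f(-x)=f(x)$ for all $x$. Let $f\in\mathcal F$ and $F=\{f<\infty\}$. For $x\in\mathbb R^n$ put $R_n(x)=\sum_{i=1}^n f(x_i)$, and for $t>0$ let $\mathcal S_n(t)=\{x\in\mathbb R^n: R_n(x)=nt\}$. For $c>0$ let $Z_c=\int_{\mathbb R} e^{-cf(x)}\,dx$ and let $g_{n,c}(x)=e^{-cR_n(x)}/Z_c^n$ be the Gibbs density on $\mathbb R^n$ (with $e^{-\infty}=0$). For $x\in F^n\setminus\{0\}$ let $S_{n,t}(x)=\kappa x$, where $\kappa>0$ is the unique scalar with $R_n(\kappa x)=nt$, and let $\sigma_{n,t}$ be the Riemannian volume ($(n-1)$-dimensional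 surface measure) on $\mathcal S_n(t)$. Let $A_{n,t}$ be the Jacobian of the coordinates $x\mapsto (r,s)=(R_n(x),S_{n,t}(x))\in(0,\infty)\times\mathcal S_n(t)$, so that $dx=A_{n,t}(r,s)\,dr\,\sigma_{n,t}(ds)$; that is, $A_{n,t}=\det(D^{\mathsf T}D)^{-1/2}$, where $D$ is the derivative of $x\mapsto(R_n(x),S_{n,t}(x))\in\mathbb R\times\mathbb R^n$. Let $$h_{n,t}(v)=\frac{A_{n,t}(nt,v)}{\int_{\mathcal S_n(t)}A_{n,t}(nt,s)\,\sigma_{n,t}(ds)},\qquad v\in\mathcal S_n(t),$$ a density with respect to $\sigma_{n,t}$. Let $c>0$ and $t=\int_{\mathbb R} g_{1,c}(x)f(x)\,dx$. Then there is a constant $C=C(f,c)>0$ such that, for all integers $0\le k<n$ with $\sqrt n>C$, $h_{n,t}$ is a probability density on $\mathcal S_n(t)$, the first $k$ coordinates of a random point with density $h_{n,t}$ have a density $p_{n,k,t}$ on $\mathbb R^k$, and $$D(p_{n,k,t}\,\|\,g_{k,c})\le\log\frac{n}{n-k}+\frac{2}{\sqrt n/C-1},$$ where $D(p\|g)=\int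 p\log(p/g)$ is the Kullback--Leibler divergence. Moreover, for every fixed $k$, $$\int_{\mathbb R^k}|p_{n,k,t}(y)-g_{k,c}(y)|\,dy=O(1/\sqrt n)\qquad(n\to\infty).$$ -/

import Mathlib

open MeasureTheory Filter Topology
open scoped ENNReal

noncomputable section

namespace EnsembleProjection

/-- The real number underlying a value in `ℝ ∪ {∞}`, with `∞` sent to `0`. It is only ever used at
finite values or multiplied by a density that vanishes where the value is `∞`. -/
def fin (f : ℝ → WithTop ℝ) (x : ℝ) : ℝ := (f x).untopD 0

/-- The class of one-particle Hamiltonians `f : ℝ → ℝ ∪ {∞}`. -/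
structure MemF (f : ℝ → WithTop ℝ) : Prop where
  zero : f 0 = 0
  finite_of_pos : ∀ x, 0 < x → f x ≠ ⊤
  right_continuous : ContinuousWithinAt (fin f) (Set.Ici 0) 0
  differentiable : ∀ x, 0 < x → DifferentiableAt ℝ (fin f) x
  deriv_continuous : ContinuousOn (deriv (fin f)) (Set.Ioi 0)
  deriv_pos : ∀ x, 0 < x → 0 < deriv (fin f) x
  tail : ∃ a₁ a₂ : ℝ, 0 < a₁ ∧ 0 ≤ a₂ ∧ ∀ x, a₂ < x → a₁ ≤ deriv (fin f) x
  origin : ∃ q a₃ : ℝ, 1 < q ∧ q < 2 ∧ 0 < a₃ ∧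
    (a₃ : EReal) ≤ liminf (fun x : ℝ => ((deriv (fin f) x ^ q / fin f x : ℝ) : EReal)) (𝓝[>] 0)
  sides : (∀ x, x < 0 → f x = ⊤) ∨ (∀ x, f (-x) = f x)

/-- The additive Hamiltonian `R_n(x) = ∑ f(x_i)`, with values in `ℝ ∪ {∞}`. -/
def R (f : ℝ → WithTop ℝ) {n : ℕ} (x : EuclideanSpace ℝ (Fin n)) : WithTop ℝ := ∑ i, f (x i)

/-- The surface `S_n(t) = {x : R_n(x) = n t}`. -/
def surface (f : ℝ → WithTop ℝ) (n : ℕ) (t : ℝ) : Set (EuclideanSpace ℝ (Fin n)) :=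
  {x | R f x = ((n * t : ℝ) : WithTop ℝ)}

/-- `exp (-c y)` for `y ∈ ℝ ∪ {∞}`, with `exp (-c ∞) = 0`. -/
def expNeg (c : ℝ) : WithTop ℝ → ℝ
  | ⊤ => 0
  | (y : ℝ) => Real.exp (-c * y)

/-- The partition function `Z_c = ∫ exp (-c f(x)) dx`. -/
def Z (f : ℝ → WithTop ℝ) (c : ℝ) : ℝ := ∫ x, expNeg c (f x)

/-- The Gibbs density `g_{n,c}` on `ℝⁿ`. -/
def gibbs (f : ℝ → WithTop ℝ) (n : ℕ) (c : ℝ) (x : EuclideanSpace ℝ (Fin n)) : ℝ :=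
  expNeg c (R f x) / Z f c ^ n

/-- The probability measure on `ℝⁿ` with density `g_{n,c}`. -/
def gibbsLaw (f : ℝ → WithTop ℝ) (n : ℕ) (c : ℝ) : Measure (EuclideanSpace ℝ (Fin n)) :=
  volume.withDensity fun x => ENNReal.ofReal (gibbs f n c x)

/-- The energy `ε(q) = ∫ q(x) R_n(x) dx` of a density `q` on `ℝⁿ`. -/
def energy (f : ℝ → WithTop ℝ) {n : ℕ} (q : EuclideanSpace ℝ (Fin n) → ℝ) : ℝ :=
  ∫ x, q x * (R f x).untopD 0

open Classical in
/-- The central projection `S_{n,t}(x) = κ x` onto the surface `S_n(t)`: `κ > 0` is the scalar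
with `R_n(κ x) = n t`. -/
def centralProj (f : ℝ → WithTop ℝ) (n : ℕ) (t : ℝ) (x : EuclideanSpace ℝ (Fin n)) :
    EuclideanSpace ℝ (Fin n) :=
  if h : ∃ κ : ℝ, 0 < κ ∧ κ • x ∈ surface f n t then h.choose • x else 0

/-- The coordinates `x ↦ (R_n(x), S_{n,t}(x))`, with values in the Euclidean product `ℝ × ℝⁿ`. -/
def coords (f : ℝ → WithTop ℝ) (n : ℕ) (t : ℝ) (x : EuclideanSpace ℝ (Fin n)) :
    WithLp 2 (ℝ × EuclideanSpace ℝ (Fin n)) :=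
  WithLp.toLp 2 ((R f x).untopD 0, centralProj f n t x)

/-- The Jacobian `A_{n,t}` of these coordinates, that is the factor in `dx = A dr σ(ds)` for
`(r, s) = (R_n(x), S_{n,t}(x))` and `σ` the Riemannian volume of `S_n(t)`. It is the inverse of the
metric Jacobian `√det(Dᵀ D)`, `D` being the derivative of the coordinate map. It is written
as a function of the point `x`; a point `v` of `S_n(t)` has coordinates `(n t, v)`. -/
def jacobian (f : ℝ → WithTop ℝ) (n : ℕ) (t : ℝ) (x : EuclideanSpace ℝ (Fin n)) : ℝ :=
  (Real.sqrt (LinearMap.det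
    ((ContinuousLinearMap.adjoint (fderiv ℝ (coords f n t) x) ∘L
      fderiv ℝ (coords f n t) x : EuclideanSpace ℝ (Fin n) →L[ℝ] EuclideanSpace ℝ (Fin n)) :
      EuclideanSpace ℝ (Fin n) →ₗ[ℝ] EuclideanSpace ℝ (Fin n))))⁻¹

/-- The Riemannian volume `σ` on `S_n(t)` (for `n ≥ 1`), as the restriction of the
`(n-1)`-dimensional Euclidean Hausdorff measure. -/
def surfaceVolume (f : ℝ → WithTop ℝ) (n : ℕ) (t : ℝ) : Measure (EuclideanSpace ℝ (Fin n)) :=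
  (Measure.euclideanHausdorffMeasure (n - 1)).restrict (surface f n t)

/-- The density `h_{n,t}(v) = A_{n,t}(v) / ∫ A_{n,t} dσ` on `S_n(t)`. -/
def surfaceDensity (f : ℝ → WithTop ℝ) (n : ℕ) (t : ℝ) (v : EuclideanSpace ℝ (Fin n)) : ℝ :=
  jacobian f n t v / ∫ s, jacobian f n t s ∂(surfaceVolume f n t)

/-- The law on `S_n(t)` with density `h_{n,t}` with respect to the Riemannian volume. -/
def surfaceLaw (f : ℝ → WithTop ℝ) (n : ℕ) (t : ℝ) : Measure (EuclideanSpace ℝ (Fin n)) :=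
  (surfaceVolume f n t).withDensity fun v => ENNReal.ofReal (surfaceDensity f n t v)

/-- The projection `π_{n,k}` onto the first `k` coordinates (used for `k ≤ n`). -/
def proj (n k : ℕ) (x : EuclideanSpace ℝ (Fin n)) : EuclideanSpace ℝ (Fin k) :=
  WithLp.toLp 2 fun i => if h : (i : ℕ) < n then x ⟨i, h⟩ else 0

/-- The law of `π_{n,k} X` for `X` with density `h_{n,t}` on `S_n(t)`. -/
def projLaw (f : ℝ → WithTop ℝ) (n k : ℕ) (t : ℝ) : Measure (EuclideanSpace ℝ (Fin k)) :=
  (surfaceLaw f n t).map (proj n k)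

/-- The Lebesgue density `p_{n,k,t}` of `projLaw`. -/
def projDensity (f : ℝ → WithTop ℝ) (n k : ℕ) (t : ℝ) (y : EuclideanSpace ℝ (Fin k)) : ℝ :=
  ((projLaw f n k t).rnDeriv volume y).toReal

end EnsembleProjection

end

/-! On the energy surface the Jacobian equals `1 / ‖∇R_n‖` (`MemF.jacobian_eq`), so `h_{n,t}` is the
co-area weight of a level set of `R_n`. Since `e^{-cR_n}` is constant on that level set, the surface
law is also the Gibbs law conditioned on `R_n = nt`. Let `ρ` (`dens`) be the density of the energy
`f(X)` of one Gibbs particle. Then p_{n,k,t}(y) = g_{k,c}(y) ρ^{*(n-k)}(nt - R_k(y)) / ρ^{*n}(nt),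
which is `MemF.projLaw_eq_withDensity`. To reach it, the surface is cut into one or two graphs over
the first `n - 1` coordinates. By the area formula the graph factor times `1 / ‖∇R_n‖` is `1 / f'`
at the last coordinate, and `1 / f'` is `ρ` up to explicit factors. Each further coordinate that is
integrated out adds one convolution with `ρ`.

It remains to bound this ratio. The number `t` is the mean of `ρ`, so a local limit theorem with
error `O(1/m)` (`exists_convPow_local_limit`) bounds `ρ^{*m}` everywhere by `β/√m + E/m`, and bounds
`ρ^{*n}(nt)` below by `β/√n - E/n`. The ratio is then at most `Λ = n/(n-k) · (1+x)/(1-x)` with `x =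
C/√n`, and the divergence is at most `log Λ`. The `L¹` statement comes from `p ≤ Λ g` directly: the
distance is at most `2(Λ - 1)`, which is `O(1/√n)` for fixed `k`. Pinsker's inequality would lose a
square root here.

The density `ρ` may be unbounded at `0`, but the condition at the origin gives `ρ(u) ≤ K u^{a-1}
e^{-bu}` with `a > 0`. Hence some convolution power is bounded, so a power of the characteristic
function is integrable and Fourier inversion applies; moreover `ρ` lies in `L^{1+s}` for some `s >
0`.

If `n - k` is too small for the local limit theorem, the supremum of `ρ^{*(n-k)}` may be infinite.
The `L^{1+s}` bound then gives a divergence of at most `½ log n + O(1)`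
(`MemF.klDiv_projLaw_le_of_rpow`), and for large `n` this is below `log (n/(n-k))`. -/

open scoped NNReal

/-! ### The area formula for injective immersions -/

/-- The hypothesis makes `f` factor through `g` on `s` by a `K`-Lipschitz map. Comparing two maps in
this way lets a nonlinear map be measured against its derivative in both directions. -/
theorem euclideanHausdorffMeasure_image_le_of_edist_le {α Y Z : Type*}
    [EMetricSpace Y] [MeasurableSpace Y] [BorelSpace Y]
    [EMetricSpace Z] [MeasurableSpace Z] [BorelSpace Z]
    {f : α → Y} {g : α → Z} {s : Set α} {K : ℝ≥0} (d : ℕ)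
    (h : ∀ x ∈ s, ∀ y ∈ s, edist (f x) (f y) ≤ K * edist (g x) (g y)) :
    μHE[d] (f '' s) ≤ (K : ℝ≥0∞) ^ d * μHE[d] (g '' s) := by
  rcases s.eq_empty_or_nonempty with rfl | ⟨x₀, hx₀⟩
  · simp
  have : Nonempty α := ⟨x₀⟩
  have hinv : ∀ x ∈ s, Function.invFunOn g s (g x) ∈ s ∧ g (Function.invFunOn g s (g x)) = g x :=
    fun x hx => Function.invFunOn_pos ⟨x, hx, rfl⟩
  have hfx : ∀ x ∈ s, f (Function.invFunOn g s (g x)) = f x := by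
    intro x hx
    obtain ⟨h1, h2⟩ := hinv x hx
    have := h _ h1 x hx
    rw [h2, edist_self, mul_zero] at this
    exact edist_le_zero.1 this
  have himg : f '' s = (f ∘ Function.invFunOn g s) '' (g '' s) := by
    rw [Set.image_image]
    exact Set.image_congr fun x hx => (hfx x hx).symm
  have hlip : LipschitzOnWith K (f ∘ Function.invFunOn g s) (g '' s) := by
    rintro _ ⟨x, hx, rfl⟩ _ ⟨y, hy, rfl⟩
    simp only [Function.comp_apply, hfx x hx, hfx y hy]
    exact h x hx y hy
  have := hlip.hausdorffMeasure_image_le (d := d) (by positivity)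
  rw [himg]
  simp only [Measure.euclideanHausdorffMeasure_def, Measure.smul_apply]
  rw [ENNReal.rpow_natCast] at this
  simp only [ENNReal.smul_def, smul_eq_mul]
  rw [mul_left_comm]
  gcongr

section AreaFormula

variable {U V : Type*} [NormedAddCommGroup U] [InnerProductSpace ℝ U] [FiniteDimensional ℝ U]
  [MeasurableSpace U] [BorelSpace U] [NormedAddCommGroup V] [InnerProductSpace ℝ V]
  [MeasurableSpace V] [BorelSpace V]

/-- As the derivative `A` at `x` is injective, the linearisation error near `x` is a small fraction
of `‖A (a - b)‖`. So `g` and `A` are `K`-Lipschitz with respect to each other, which costs `K ^ d`,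
and the measure of `A '' s` is known exactly. The extra factor `K` pays for freezing the Jacobian at
`x`. -/
theorem exists_nhds_euclideanHausdorffMeasure_image_bounds {g : U → V} {g' : U → U →L[ℝ] V}
    {O : Set U} (hO : IsOpen O) {x : U} (hx : x ∈ O) (hg : HasStrictFDerivAt g (g' x) x)
    (hker : Function.Injective (g' x))
    (hc : ContinuousOn (fun y => (g' y : U →ₗ[ℝ] V).normDet) O) {K : ℝ≥0} (hK : 1 < K) :
    ∃ W ∈ 𝓝 x, ∀ s ⊆ W,  MeasurableSet s →
      μHE[Module.finrank ℝ U] (g '' s) ≤ (K : ℝ≥0∞) ^ (Module.finrank ℝ U + 1) *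
        ∫⁻ y in s, ENNReal.ofReal (g' y : U →ₗ[ℝ] V).normDet ∧
      ∫⁻ y in s, ENNReal.ofReal (g' y : U →ₗ[ℝ] V).normDet ≤
        (K : ℝ≥0∞) ^ (Module.finrank ℝ U + 1) * μHE[Module.finrank ℝ U] (g '' s) := by
  set A := g' x with hA
  set d := Module.finrank ℝ U
  have hK' : (1 : ℝ) < K := by exact_mod_cast hK
  have hJ : 0 < (A : U →ₗ[ℝ] V).normDet := by
    refine lt_of_le_of_ne (LinearMap.normDet_nonneg _) (Ne.symm ?_)
    exact ((LinearMap.normDet_ne_zero_tfae (A : U →ₗ[ℝ] V)).out 0 4).2 hker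
  obtain ⟨c, hc0, hanti⟩ := (A : U →ₗ[ℝ] V).exists_antilipschitzWith
    (LinearMap.ker_eq_bot.2 hker)
  have hAv : ∀ v, ‖v‖ ≤ c * ‖A v‖ := fun v => by
    simpa [edist_dist, dist_eq_norm] using hanti.le_mul_dist v 0
  -- the admissible relative error
  set ε : ℝ := 1 - (K : ℝ)⁻¹ with hε
  have hε0 : 0 < ε := by
    have : (K : ℝ)⁻¹ < 1 := inv_lt_one_of_one_lt₀ hK'
    linarith
  -- With this `ε` one has `1 - ε = 1 / K` and `1 + ε ≤ K`, so the same `K` serves both Lipschitz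
  -- bounds.
  have hεK : 1 + ε ≤ K := by
    have h1 : (K : ℝ) * (K : ℝ)⁻¹ = 1 := mul_inv_cancel₀ (by positivity)
    have h2 : (K : ℝ)⁻¹ > 0 := by positivity
    nlinarith [sq_nonneg ((K : ℝ) - 1)]
  have hc0' : (0 : ℝ) < c := by exact_mod_cast hc0
  obtain ⟨W₁, hW₁, happ⟩ := hg.approximates_deriv_on_nhds (c := (ε / c).toNNReal)
    (Or.inr (by simpa using div_pos hε0 hc0'))
  have hcont : ContinuousAt (fun y => (g' y : U →ₗ[ℝ] V).normDet) x := hc.continuousAt (hO.mem_nhds hx)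
  have hW₂ : ∀ᶠ y in 𝓝 x, (g' y : U →ₗ[ℝ] V).normDet < K * (A : U →ₗ[ℝ] V).normDet :=
    hcont.eventually_lt continuousAt_const (by show (A : U →ₗ[ℝ] V).normDet < _; nlinarith)
  have hW₃ : ∀ᶠ y in 𝓝 x, (A : U →ₗ[ℝ] V).normDet < K * (g' y : U →ₗ[ℝ] V).normDet :=
    continuousAt_const.eventually_lt (continuousAt_const.mul hcont)
      (by show _ < (K : ℝ) * (A : U →ₗ[ℝ] V).normDet; nlinarith)
  refine ⟨_, inter_mem hW₁ (inter_mem hW₂ hW₃), fun s hs hsm => ?_⟩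
  have hdist : ∀ a ∈ s, ∀ b ∈ s, ‖g a - g b - A (a - b)‖ ≤ ε * ‖A (a - b)‖ := by
    intro a ha b hb
    refine (happ a (hs ha).1 b (hs hb).1).trans ?_
    rw [Real.coe_toNNReal _ (by positivity)]
    calc ε / c * ‖a - b‖ ≤ ε / c * (c * ‖A (a - b)‖) := by gcongr; exact hAv _
      _ = ε * ‖A (a - b)‖ := by field_simp
  have hup : ∀ a ∈ s, ∀ b ∈ s, edist (g a) (g b) ≤ K * edist (A a) (A b) := by
    intro a ha b hb
    have h1 := hdist a ha b hb
    have h2 : ‖g a - g b‖ ≤ ‖g a - g b - A (a - b)‖ + ‖A (a - b)‖ := by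
      simpa using norm_add_le (g a - g b - A (a - b)) (A (a - b))
    have h3 : dist (g a) (g b) ≤ K * dist (A a) (A b) := by
      rw [dist_eq_norm, dist_eq_norm, ← map_sub]
      nlinarith [norm_nonneg (A (a - b))]
    rw [edist_dist, edist_dist, ← ENNReal.ofReal_coe_nnreal, ← ENNReal.ofReal_mul (by positivity)]
    exact ENNReal.ofReal_le_ofReal h3
  have hlow : ∀ a ∈ s, ∀ b ∈ s, edist (A a) (A b) ≤ K * edist (g a) (g b) := by
    intro a ha b hb
    have h1 := hdist a ha b hb
    have h2 : ‖A (a - b)‖ ≤ ‖g a - g b‖ + ‖g a - g b - A (a - b)‖ := by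
      have := norm_sub_le (g a - g b) (g a - g b - A (a - b))
      rwa [sub_sub_cancel] at this
    have h3 : dist (A a) (A b) ≤ K * dist (g a) (g b) := by
      rw [dist_eq_norm, dist_eq_norm, ← map_sub]
      have h4 : (K : ℝ)⁻¹ * ‖A (a - b)‖ ≤ ‖g a - g b‖ := by
        have : (K : ℝ)⁻¹ = 1 - ε := by rw [hε]; ring
        rw [this]; nlinarith
      have h5 : (K : ℝ) * ((K : ℝ)⁻¹ * ‖A (a - b)‖) = ‖A (a - b)‖ := by field_simp
      rw [← h5]; gcongr
    rw [edist_dist, edist_dist, ← ENNReal.ofReal_coe_nnreal, ← ENNReal.ofReal_mul (by positivity)]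
    exact ENNReal.ofReal_le_ofReal h3
  have hlin : μHE[d] (A '' s) = ENNReal.ofReal (A : U →ₗ[ℝ] V).normDet * volume s :=
    LinearMap.euclideanHausdorffMeasure_image_eq_normDet_mul_volume (A : U →ₗ[ℝ] V) s
  have hKof : ∀ r : ℝ, (K : ℝ≥0∞) * ENNReal.ofReal r = ENNReal.ofReal (K * r) := fun r => by
    rw [← ENNReal.ofReal_coe_nnreal, ← ENNReal.ofReal_mul (by positivity)]
  constructor
  · calc μHE[d] (g '' s) ≤ (K : ℝ≥0∞) ^ d * μHE[d] (A '' s) :=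
        euclideanHausdorffMeasure_image_le_of_edist_le d hup
      _ = (K : ℝ≥0∞) ^ d * ∫⁻ y in s, ENNReal.ofReal (A : U →ₗ[ℝ] V).normDet := by
        rw [hlin, lintegral_const, Measure.restrict_apply_univ]
      _ ≤ (K : ℝ≥0∞) ^ d * ∫⁻ y in s, K * ENNReal.ofReal (g' y : U →ₗ[ℝ] V).normDet := by
        gcongr 1
        refine setLIntegral_mono' hsm fun y hy => ?_
        rw [hKof]
        exact ENNReal.ofReal_le_ofReal (hs hy).2.2.le
      _ = _ := by rw [lintegral_const_mul' _ _ ENNReal.coe_ne_top, pow_succ, mul_assoc]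
  · calc ∫⁻ y in s, ENNReal.ofReal (g' y : U →ₗ[ℝ] V).normDet
        ≤ ∫⁻ y in s, K * ENNReal.ofReal (A : U →ₗ[ℝ] V).normDet := by
          refine setLIntegral_mono' hsm fun y hy => ?_
          rw [hKof]
          exact ENNReal.ofReal_le_ofReal (hs hy).2.1.le
      _ = K * μHE[d] (A '' s) := by
          rw [lintegral_const, Measure.restrict_apply_univ, hlin, mul_assoc]
      _ ≤ K * ((K : ℝ≥0∞) ^ d * μHE[d] (g '' s)) := by
          gcongr
          exact euclideanHausdorffMeasure_image_le_of_edist_le d hlow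
      _ = _ := by rw [pow_succ', mul_assoc]

/-- The local bounds add up over a countable disjoint cover, injectivity keeping the images
disjoint, so they hold globally with the same factor `K ^ (d + 1)`. Then `K` tends to `1`. -/
theorem euclideanHausdorffMeasure_image_eq_lintegral_normDet {g : U → V} {g' : U → U →L[ℝ] V}
    {O : Set U} (hO : IsOpen O) (hg : ∀ x ∈ O, HasStrictFDerivAt g (g' x) x)
    (hinj : Set.InjOn g O) (hker : ∀ x ∈ O, Function.Injective (g' x))
    (hc : ContinuousOn (fun y => (g' y : U →ₗ[ℝ] V).normDet) O)
    {s : Set U} (hs : MeasurableSet s) (hsO : s ⊆ O) :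
    μHE[Module.finrank ℝ U] (g '' s) = ∫⁻ y in s, ENNReal.ofReal (g' y : U →ₗ[ℝ] V).normDet := by
  set d := Module.finrank ℝ U
  have hgc : ContinuousOn g O := fun x hx => (hg x hx).continuousAt.continuousWithinAt
  have main : ∀ K : ℝ≥0, 1 < K →
      μHE[d] (g '' s) ≤ (K : ℝ≥0∞) ^ (d + 1) *
        ∫⁻ y in s, ENNReal.ofReal (g' y : U →ₗ[ℝ] V).normDet ∧
      ∫⁻ y in s, ENNReal.ofReal (g' y : U →ₗ[ℝ] V).normDet ≤
        (K : ℝ≥0∞) ^ (d + 1) * μHE[d] (g '' s) := by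
    intro K hK
    have hloc : ∀ x : U, ∃ W, x ∈ O → (W ∈ 𝓝 x ∧ ∀ s ⊆ W, MeasurableSet s →
      μHE[d] (g '' s) ≤ (K : ℝ≥0∞) ^ (d + 1) *
        ∫⁻ y in s, ENNReal.ofReal (g' y : U →ₗ[ℝ] V).normDet ∧
      ∫⁻ y in s, ENNReal.ofReal (g' y : U →ₗ[ℝ] V).normDet ≤
        (K : ℝ≥0∞) ^ (d + 1) * μHE[d] (g '' s)) := by
      intro x
      by_cases hx : x ∈ O
      · obtain ⟨W, hW, h⟩ := exists_nhds_euclideanHausdorffMeasure_image_bounds hO hx (hg x hx)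
          (hker x hx) hc hK
        exact ⟨W, fun _ => ⟨hW, h⟩⟩
      · exact ⟨∅, fun h => absurd h hx⟩
    choose W hW using hloc
    obtain ⟨T, hTO, hTc, hcov⟩ := TopologicalSpace.countable_cover_nhdsWithin
      (f := fun x => interior (W x)) (s := O)
      (fun x hx => mem_nhdsWithin_of_mem_nhds (interior_mem_nhds.2 (hW x hx).1))
    rcases T.eq_empty_or_nonempty with hTe | hTne
    · have : s = ∅ := by
        have : O ⊆ ∅ := by simpa [hTe] using hcov
        exact Set.subset_empty_iff.1 (hsO.trans this)
      simp [this]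
    obtain ⟨e, he⟩ := hTc.exists_eq_range hTne
    set D : ℕ → Set U := disjointed fun n => interior (W (e n)) with hD
    have hDm : ∀ n, MeasurableSet (D n) :=
      fun n => MeasurableSet.disjointed (fun n => isOpen_interior.measurableSet) n
    have hDdisj : Pairwise (Function.onFun Disjoint D) := disjoint_disjointed _
    have hDU : O ⊆ ⋃ n, D n := by
      rw [hD, iUnion_disjointed]
      intro x hx
      obtain ⟨y, hy, hxy⟩ := Set.mem_iUnion₂.1 (hcov hx)
      rw [he] at hy
      obtain ⟨n, rfl⟩ := hy
      exact Set.mem_iUnion.2 ⟨n, hxy⟩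
    have hsD : s = ⋃ n, s ∩ D n := by
      rw [← Set.inter_iUnion, Set.inter_eq_left.2 (hsO.trans hDU)]
    have hdisj : Pairwise (Function.onFun Disjoint fun n => s ∩ D n) := fun i j hij =>
      (hDdisj hij).mono Set.inter_subset_right Set.inter_subset_right
    have hm : ∀ n, MeasurableSet (s ∩ D n) := fun n => hs.inter (hDm n)
    have hI : ∫⁻ y in s, ENNReal.ofReal (g' y : U →ₗ[ℝ] V).normDet =
        ∑' n, ∫⁻ y in s ∩ D n, ENNReal.ofReal (g' y : U →ₗ[ℝ] V).normDet := by
      conv_lhs => rw [hsD]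
      exact lintegral_iUnion hm hdisj _
    have hM : μHE[d] (g '' s) = ∑' n, μHE[d] (g '' (s ∩ D n)) := by
      conv_lhs => rw [hsD, Set.image_iUnion]
      refine measure_iUnion (fun i j hij => ?_) fun n => ?_
      · refine Set.disjoint_left.2 ?_
        rintro _ ⟨a, ha, rfl⟩ ⟨b, hb, hab⟩
        have : b = a := hinj (hsO hb.1) (hsO ha.1) hab
        exact Set.disjoint_left.1 (hdisj hij) ha (this ▸ hb)
      · exact (hm n).image_of_continuousOn_injOn
          (hgc.mono (Set.inter_subset_left.trans hsO)) (hinj.mono (Set.inter_subset_left.trans hsO))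
    have hpiece := fun n => (hW (e n) (hTO (he ▸ Set.mem_range_self n))).2 (s ∩ D n)
      (Set.inter_subset_right.trans ((disjointed_subset _ n).trans interior_subset)) (hm n)
    rw [hI, hM, ← ENNReal.tsum_mul_left, ← ENNReal.tsum_mul_left]
    exact ⟨ENNReal.tsum_le_tsum fun n => (hpiece n).1, ENNReal.tsum_le_tsum fun n => (hpiece n).2⟩
  have hlim : ∀ a : ℝ≥0∞, Tendsto (fun K : ℝ≥0 => (K : ℝ≥0∞) ^ (d + 1) * a) (𝓝[>] 1) (𝓝 a) := by
    intro a
    have h1 : Tendsto (fun K : ℝ≥0 => (K : ℝ≥0∞) ^ (d + 1)) (𝓝[>] 1) (𝓝 1) := by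
      have : Tendsto (fun K : ℝ≥0 => ((K ^ (d + 1) : ℝ≥0) : ℝ≥0∞)) (𝓝 1) (𝓝 ((1 ^ (d+1) : ℝ≥0) : ℝ≥0∞)) :=
        ENNReal.tendsto_coe.2 ((continuous_pow (d + 1)).tendsto 1)
      simp only [one_pow, ENNReal.coe_one, ENNReal.coe_pow] at this
      exact this.mono_left nhdsWithin_le_nhds
    simpa using ENNReal.Tendsto.mul_const h1 (Or.inl one_ne_zero)
  apply le_antisymm
  · exact ge_of_tendsto (hlim _) (eventually_nhdsWithin_of_forall fun K hK => (main K hK).1)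
  · exact ge_of_tendsto (hlim _) (eventually_nhdsWithin_of_forall fun K hK => (main K hK).2)

theorem setLIntegral_image_eq_lintegral_normDet {g : U → V} {g' : U → U →L[ℝ] V}
    {O : Set U} (hO : IsOpen O) (hg : ∀ x ∈ O, HasStrictFDerivAt g (g' x) x)
    (hinj : Set.InjOn g O) (hker : ∀ x ∈ O, Function.Injective (g' x))
    (hc : ContinuousOn (fun y => (g' y : U →ₗ[ℝ] V).normDet) O)
    {φ : V → ℝ≥0∞} (hφ : Measurable φ) :
    ∫⁻ v in g '' O, φ v ∂μHE[Module.finrank ℝ U] =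
      ∫⁻ y in O, φ (g y) * ENNReal.ofReal (g' y : U →ₗ[ℝ] V).normDet := by
  have hgc : ContinuousOn g O := fun x hx => (hg x hx).continuousAt.continuousWithinAt
  set J : U → ℝ≥0∞ := fun y => ENNReal.ofReal (g' y : U →ₗ[ℝ] V).normDet with hJ
  have hJm : AEMeasurable J (volume.restrict O) :=
    (hc.aemeasurable hO.measurableSet).ennreal_ofReal
  have hgm : AEMeasurable g (volume.restrict O) := hgc.aemeasurable hO.measurableSet
  have hgm' : AEMeasurable g ((volume.restrict O).withDensity J) :=
    hgm.mono_ac (withDensity_absolutelyContinuous _ _)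
  have hmap : (μHE[Module.finrank ℝ U]).restrict (g '' O) =
      ((volume.restrict O).withDensity J).map g := by
    ext T hT
    have hB : MeasurableSet (O ∩ g ⁻¹' T) := by
      have h := MeasurableSet.subtype_image hO.measurableSet (hgc.domRestrict.measurable hT)
      convert! h using 1
      ext x; simp [Set.domRestrict, and_comm]
    have himg : T ∩ g '' O = g '' (O ∩ g ⁻¹' T) := by
      rw [Set.image_inter_preimage, Set.inter_comm]
    rw [Measure.restrict_apply hT, himg,
      euclideanHausdorffMeasure_image_eq_lintegral_normDet hO hg hinj hker hc hB
        Set.inter_subset_left,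
      Measure.map_apply_of_aemeasurable hgm' hT,
      withDensity_apply₀ _ (hgm.nullMeasurable hT),
      Measure.restrict_restrict₀ (hgm.nullMeasurable hT), Set.inter_comm]
  rw [hmap, lintegral_map' hφ.aemeasurable hgm',
    lintegral_withDensity_eq_lintegral_mul₀ hJm (g := fun a => φ (g a))
      (hφ.comp_aemeasurable hgm)]
  simp only [Pi.mul_apply, mul_comm, hJ]

end AreaFormula

/-! ### Jacobian determinants and integration over graphs -/

section Graph

variable {U V : Type*} [NormedAddCommGroup U] [InnerProductSpace ℝ U] [FiniteDimensional ℝ U]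
  [NormedAddCommGroup V] [InnerProductSpace ℝ V] [CompleteSpace V]

/-- The metric Jacobian depends only on the Gram form, so a map into a larger space may be traded
for an endomorphism whose determinant is easy. -/
theorem normDet_eq_abs_det_of_inner_eq (D : U →L[ℝ] V) (B : U →L[ℝ] U)
    (h : ∀ u v, inner ℝ (D u) (D v) = inner ℝ (B u) (B v)) :
    (D : U →ₗ[ℝ] V).normDet = |LinearMap.det (B : U →ₗ[ℝ] U)| := by
  have := FiniteDimensional.complete ℝ U
  have hDB : ContinuousLinearMap.adjoint D ∘L D = ContinuousLinearMap.adjoint B ∘L B := by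
    ext u
    refine ext_inner_right ℝ fun v => ?_
    simp [ContinuousLinearMap.adjoint_inner_left, h]
  have h1 := D.normDet_sq
  have h2 := B.normDet_sq
  rw [hDB, ← h2] at h1
  rw [← LinearMap.normDet_eq_abs_det]
  exact (sq_eq_sq₀ (LinearMap.normDet_nonneg _) (LinearMap.normDet_nonneg _)).1 (by simpa using h1)

/-- Since `e` is a unit vector orthogonal to the range of `ι`, `Dᵀ D` is the identity plus a
rank-one map, a transvection with determinant `1 + a b = 1 + ‖a‖²`, where `b` represents `a`. -/
theorem normDet_add_smulRight (ι : U →ₗᵢ[ℝ] V) {e : V} (he : ‖e‖ = 1)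
    (hιe : ∀ u, inner ℝ (ι u) e = 0) (a : U →L[ℝ] ℝ) :
    ((ι.toContinuousLinearMap + a.smulRight e : U →L[ℝ] V) : U →ₗ[ℝ] V).normDet =
      Real.sqrt (1 + ‖a‖ ^ 2) := by
  have := FiniteDimensional.complete ℝ U
  set D : U →L[ℝ] V := ι.toContinuousLinearMap + a.smulRight e with hD
  set b : U := (InnerProductSpace.toDual ℝ U).symm a with hb
  have hab : ∀ u, a u = inner ℝ b u := fun u => by simp [hb]
  have hcomp : ((ContinuousLinearMap.adjoint D ∘L D : U →L[ℝ] U) : U →ₗ[ℝ] U) =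
      LinearMap.transvection (a : U →ₗ[ℝ] ℝ) b := by
    ext u
    refine ext_inner_right ℝ fun v => ?_
    have hιe' : ∀ u, inner ℝ e (ι u) = 0 := fun u => by rw [real_inner_comm, hιe]
    have hee : inner ℝ e e = (1 : ℝ) := by rw [real_inner_self_eq_norm_sq, he]; norm_num
    simp [ContinuousLinearMap.adjoint_inner_left, LinearMap.transvection.apply, hD, inner_add_left,
      inner_smul_left, inner_smul_right, hιe, hιe', hab v, real_inner_comm, he]
  have h1 := D.normDet_sq
  have h2 : (D : U →ₗ[ℝ] V).normDet ^ 2 = 1 + ‖a‖ ^ 2 := by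
    have h3 : a b = ‖a‖ ^ 2 := by
      rw [hab, real_inner_self_eq_norm_sq, hb, LinearIsometryEquiv.norm_map]
    rw [ContinuousLinearMap.det, hcomp, LinearMap.transvection.det] at h1
    simpa [h3] using h1
  rw [← h2, Real.sqrt_sq (LinearMap.normDet_nonneg _)]

variable [MeasurableSpace U] [BorelSpace U] [MeasurableSpace V] [BorelSpace V]

theorem setLIntegral_graph_eq (ι : U →ₗᵢ[ℝ] V) {e : V} (he : ‖e‖ = 1)
    (hιe : ∀ u, inner ℝ (ι u) e = 0) {O : Set U} (hO : IsOpen O) {w : U → ℝ} {w' : U → U →L[ℝ] ℝ}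
    (hw : ∀ x ∈ O, HasStrictFDerivAt w (w' x) x) (hc : ContinuousOn w' O)
    {φ : V → ℝ≥0∞} (hφ : Measurable φ) :
    ∫⁻ v in (fun y => ι y + w y • e) '' O, φ v ∂μHE[Module.finrank ℝ U] =
      ∫⁻ y in O, φ (ι y + w y • e) * ENNReal.ofReal (Real.sqrt (1 + ‖w' y‖ ^ 2)) := by
  have hι : ∀ u v : U, ∀ r s : ℝ, ι u + r • e = ι v + s • e → u = v := by
    intro u v r s h
    have h0 : ι (u - v) = (s - r) • e := by
      rw [map_sub, sub_smul, sub_eq_sub_iff_add_eq_add, h, add_comm]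
    have h1 : inner ℝ (ι (u - v)) (ι (u - v)) = (0 : ℝ) := by
      nth_rw 2 [h0]
      rw [inner_smul_right, hιe, mul_zero]
    rw [inner_self_eq_zero] at h1
    exact sub_eq_zero.1 ((map_eq_zero_iff ι ι.injective).1 h1)
  have h := setLIntegral_image_eq_lintegral_normDet (g := fun y => ι y + w y • e)
    (g' := fun y => ι.toContinuousLinearMap + (w' y).smulRight e) hO
    (fun x hx => ι.toContinuousLinearMap.hasStrictFDerivAt.add ((hw x hx).smul_const e))
    (fun u _ v _ h => hι u v _ _ h)
    (fun x _ u v h => hι u v _ _ (by simpa using h))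
    (by simp only [normDet_add_smulRight ι he hιe]; fun_prop) hφ
  simpa only [normDet_add_smulRight ι he hιe] using h

end Graph

noncomputable section

theorem integrable_exp_neg_mul_abs {b : ℝ} (hb : 0 < b) :
    Integrable fun x : ℝ => Real.exp (-b * |x|) := by
  rw [← integrableOn_univ, ← Set.Iic_union_Ioi (a := (0 : ℝ))]
  refine IntegrableOn.union ?_ ?_
  · refine (integrableOn_exp_mul_Iic hb 0).congr_fun (fun x hx => ?_) measurableSet_Iic
    simp only [abs_of_nonpos (Set.mem_Iic.1 hx)]
    ring_nf
  · refine (exp_neg_integrableOn_Ioi 0 hb).congr_fun (fun x hx => ?_) measurableSet_Ioi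
    simp only [abs_of_pos (Set.mem_Ioi.1 hx)]

namespace EnsembleProjection

variable {f : ℝ → WithTop ℝ}

/-! ### One-particle Hamiltonians -/

theorem coe_fin {x : ℝ} (h : f x ≠ ⊤) : ((fin f x : ℝ) : WithTop ℝ) = f x := by
  unfold fin
  lift f x to ℝ using h with y
  rfl

theorem expNeg_of_ne_top (c : ℝ) {x : ℝ} (h : f x ≠ ⊤) :
    expNeg c (f x) = Real.exp (-c * fin f x) := by
  rw [← coe_fin h]; rfl

@[simp] theorem expNeg_top (c : ℝ) : expNeg c ⊤ = 0 := rfl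

@[simp] theorem expNeg_coe (c y : ℝ) : expNeg c (y : WithTop ℝ) = Real.exp (-c * y) := rfl

theorem expNeg_nonneg (c : ℝ) (y : WithTop ℝ) : 0 ≤ expNeg c y := by
  induction y using WithTop.recTopCoe with
  | top => simp
  | coe y => simpa using (Real.exp_pos _).le

theorem expNeg_add (c : ℝ) (y z : WithTop ℝ) : expNeg c (y + z) = expNeg c y * expNeg c z := by
  induction y using WithTop.recTopCoe with
  | top => simp
  | coe y =>
    induction z using WithTop.recTopCoe with
    | top => simp
    | coe z => rw [← WithTop.coe_add, expNeg_coe, expNeg_coe, expNeg_coe, mul_add, Real.exp_add]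

/-- The inverse of the Hamiltonian on the positive half-line. -/
def finv (f : ℝ → WithTop ℝ) : ℝ → ℝ := Function.invFunOn (fin f) (Set.Ioi 0)

open Classical in
/-- The number of points at which the Hamiltonian takes a given positive value. -/
def mult (f : ℝ → WithTop ℝ) : ℝ := if ∀ x, x < 0 → f x = ⊤ then 1 else 2

/-- The density of `f(X)` for `X` distributed according to the one-particle Gibbs density. -/
def dens (f : ℝ → WithTop ℝ) (c u : ℝ) : ℝ :=
  if 0 < u then mult f * Real.exp (-c * u) / (Z f c * deriv (fin f) (finv f u)) else 0

namespace MemF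

variable (hf : MemF f)
include hf

theorem fin_zero : fin f 0 = 0 := by simp [fin, hf.zero]

theorem continuousOn_fin : ContinuousOn (fin f) (Set.Ici 0) := by
  intro x hx
  rcases eq_or_lt_of_le (Set.mem_Ici.1 hx) with rfl | h
  · exact hf.right_continuous
  · exact (hf.differentiable x h).continuousAt.continuousWithinAt

theorem strictMonoOn_fin : StrictMonoOn (fin f) (Set.Ici 0) :=
  strictMonoOn_of_deriv_pos (convex_Ici 0) hf.continuousOn_fin
    (by simpa using hf.deriv_pos)

theorem fin_pos {x : ℝ} (hx : 0 < x) : 0 < fin f x := by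
  have := hf.strictMonoOn_fin Set.self_mem_Ici hx.le hx
  rwa [hf.fin_zero] at this

theorem exists_linear_le : ∃ a b : ℝ, 0 < a ∧ ∀ x, 0 ≤ x → a * x - b ≤ fin f x := by
  obtain ⟨a₁, a₂, ha₁, ha₂, h⟩ := hf.tail
  refine ⟨a₁, a₁ * (a₂ + 1), ha₁, fun x hx => ?_⟩
  rcases le_or_gt x (a₂ + 1) with hx' | hx'
  · have : 0 ≤ fin f x := by
      rcases eq_or_lt_of_le hx with rfl | h'
      · exact hf.fin_zero.ge
      · exact (hf.fin_pos h').le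
    nlinarith
  · have hmv := (convex_Ici (a₂ + 1)).mul_sub_le_image_sub_of_le_deriv (f := fin f) (C := a₁)
      (hf.continuousOn_fin.mono fun y hy => by
        simp only [Set.mem_Ici] at hy ⊢; linarith)
      (fun y hy => by
        simp only [interior_Ici, Set.mem_Ioi] at hy
        exact (hf.differentiable y (by linarith)).differentiableWithinAt)
      (fun y hy => by
        simp only [interior_Ici, Set.mem_Ioi] at hy
        exact h y (by linarith)) (a₂ + 1) Set.self_mem_Ici x hx'.le hx'.le
    have : 0 < fin f (a₂ + 1) := hf.fin_pos (by linarith)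
    nlinarith

theorem tendsto_fin : Tendsto (fin f) atTop atTop := by
  obtain ⟨a, b, ha, h⟩ := hf.exists_linear_le
  refine tendsto_atTop_mono' _ (f₁ := fun x => a * x - b) ?_ ?_
  · filter_upwards [eventually_ge_atTop 0] with x hx using h x hx
  · exact tendsto_atTop_add_const_right _ _ (tendsto_id.const_mul_atTop ha)

theorem exists_fin_eq {u : ℝ} (hu : 0 < u) : ∃ x ∈ Set.Ioi (0 : ℝ), fin f x = u := by
  obtain ⟨M, hM, hM0⟩ := ((hf.tendsto_fin.eventually_ge_atTop u).and
    (eventually_gt_atTop 0)).exists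
  obtain ⟨x, hx, hxu⟩ := intermediate_value_Icc hM0.le
    (hf.continuousOn_fin.mono Set.Icc_subset_Ici_self)
    (show u ∈ Set.Icc (fin f 0) (fin f M) from ⟨by rw [hf.fin_zero]; exact hu.le, hM⟩)
  refine ⟨x, lt_of_le_of_ne hx.1 ?_, hxu⟩
  rintro rfl
  rw [hf.fin_zero] at hxu
  exact hu.ne hxu

theorem finv_pos {u : ℝ} (hu : 0 < u) : 0 < finv f u :=
  (Function.invFunOn_pos (hf.exists_fin_eq hu)).1

theorem fin_finv {u : ℝ} (hu : 0 < u) : fin f (finv f u) = u :=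
  (Function.invFunOn_pos (hf.exists_fin_eq hu)).2

theorem finv_fin {x : ℝ} (hx : 0 < x) : finv f (fin f x) = x :=
  hf.strictMonoOn_fin.injOn (hf.finv_pos (hf.fin_pos hx)).le hx.le
    (hf.fin_finv (hf.fin_pos hx))

theorem hasStrictDerivAt_fin {x : ℝ} (hx : 0 < x) :
    HasStrictDerivAt (fin f) (deriv (fin f) x) x := by
  refine hasStrictDerivAt_of_hasDerivAt_of_continuousAt ?_
    (hf.deriv_continuous.continuousAt (Ioi_mem_nhds hx))
  filter_upwards [Ioi_mem_nhds hx] with y hy using (hf.differentiable y hy).hasDerivAt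

theorem hasStrictDerivAt_finv {u : ℝ} (hu : 0 < u) :
    HasStrictDerivAt (finv f) (deriv (fin f) (finv f u))⁻¹ u := by
  have h := (hf.hasStrictDerivAt_fin (hf.finv_pos hu)).to_local_left_inverse (g := finv f)
    (hf.deriv_pos _ (hf.finv_pos hu)).ne' (by
      filter_upwards [Ioi_mem_nhds (hf.finv_pos hu)] with y hy using hf.finv_fin hy)
  rwa [hf.fin_finv hu] at h

theorem continuousOn_finv : ContinuousOn (finv f) (Set.Ioi 0) := fun _ hu =>
  (hf.hasStrictDerivAt_finv hu).hasDerivAt.continuousAt.continuousWithinAt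

theorem continuousOn_deriv_finv : ContinuousOn (fun u => deriv (fin f) (finv f u)) (Set.Ioi 0) :=
  hf.deriv_continuous.comp hf.continuousOn_finv fun _ hu => hf.finv_pos hu

theorem image_finv : finv f '' Set.Ioi 0 = Set.Ioi 0 := by
  ext x
  constructor
  · rintro ⟨u, hu, rfl⟩; exact hf.finv_pos hu
  · intro hx; exact ⟨fin f x, hf.fin_pos hx, hf.finv_fin hx⟩

theorem injOn_finv : Set.InjOn (finv f) (Set.Ioi 0) := fun u hu v hv h => by
  rw [← hf.fin_finv hu, h, hf.fin_finv hv]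

/-- Either the Hamiltonian is infinite on the negative half-line, and `mult f = 1`, or it is even
and everywhere finite, and `mult f = 2`. -/
theorem sides' : ((∀ x, x < 0 → f x = ⊤) ∧ mult f = 1) ∨
    ((∀ x, f (-x) = f x) ∧ (∀ x, f x ≠ ⊤) ∧ mult f = 2) := by
  by_cases h : ∀ x, x < 0 → f x = ⊤
  · exact Or.inl ⟨h, by unfold mult; rw [if_pos h]⟩
  · have he := hf.sides.resolve_left h
    refine Or.inr ⟨he, fun x => ?_, by unfold mult; rw [if_neg h]⟩
    rcases lt_trichotomy x 0 with hx | rfl | hx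
    · rw [← he]; exact hf.finite_of_pos _ (by linarith)
    · rw [hf.zero]; exact WithTop.coe_ne_top
    · exact hf.finite_of_pos _ hx

theorem mult_pos : 0 < mult f := by
  rcases hf.sides' with ⟨_, h⟩ | ⟨_, _, h⟩ <;> rw [h] <;> norm_num

theorem fin_nonneg (x : ℝ) : 0 ≤ fin f x := by
  have hpos : ∀ x, 0 ≤ x → 0 ≤ fin f x := fun x hx => by
    have := hf.strictMonoOn_fin.monotoneOn Set.self_mem_Ici hx hx
    rwa [hf.fin_zero] at this
  rcases le_or_gt 0 x with hx | hx
  · exact hpos x hx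
  rcases hf.sides' with ⟨h, _⟩ | ⟨h, _, _⟩
  · simp [fin, h x hx]
  · have := hpos (-x) (by linarith)
    rwa [fin, h] at this

theorem measurable_fin : Measurable (fin f) := by
  have h1 : Measurable ((Set.Ici (0 : ℝ)).indicator (fin f)) := by
    classical
    rw [← Set.piecewise_eq_indicator]
    exact hf.continuousOn_fin.measurable_piecewise continuousOn_const measurableSet_Ici
  rcases hf.sides' with ⟨h, _⟩ | ⟨h, _, _⟩
  · convert! h1 using 1
    ext x
    by_cases hx : 0 ≤ x
    · rw [Set.indicator_of_mem (by exact hx)]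
    · rw [Set.indicator_of_notMem (by exact hx)]
      simp [fin, h x (not_le.1 hx)]
  · have : fin f = fun x => (Set.Ici (0 : ℝ)).indicator (fin f) |x| := by
      ext x
      rw [Set.indicator_of_mem (by exact abs_nonneg x)]
      rcases abs_choice x with hx | hx <;> rw [hx]
      simp [fin, h]
    rw [this]
    exact h1.comp measurable_id.abs

theorem measurableSet_ne_top : MeasurableSet {x | f x ≠ ⊤} := by
  rcases hf.sides' with ⟨h, _⟩ | ⟨_, h, _⟩
  · have : {x | f x ≠ ⊤} = Set.Ici 0 := by
      ext x
      simp only [Set.mem_ofPred_eq, Set.mem_Ici]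
      constructor
      · intro hx; by_contra hx'; exact hx (h x (not_le.1 hx'))
      · intro hx
        rcases eq_or_lt_of_le hx with rfl | hx
        · rw [hf.zero]; exact WithTop.coe_ne_top
        · exact hf.finite_of_pos x hx
    rw [this]; exact measurableSet_Ici
  · simp [h]

omit hf in
theorem expNeg_eq_indicator (c : ℝ) : (fun x => expNeg c (f x)) =
    {x | f x ≠ ⊤}.indicator fun x => Real.exp (-c * fin f x) := by
  ext x
  by_cases h : f x = ⊤
  · rw [Set.indicator_of_notMem (by simpa using h), h, expNeg_top]
  · rw [Set.indicator_of_mem (by exact h), expNeg_of_ne_top c h]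

theorem measurable_expNeg (c : ℝ) : Measurable fun x => expNeg c (f x) := by
  rw [expNeg_eq_indicator c]
  exact ((hf.measurable_fin.const_mul (-c)).exp).indicator hf.measurableSet_ne_top

theorem integrable_expNeg {c : ℝ} (hc : 0 < c) : Integrable fun x => expNeg c (f x) := by
  obtain ⟨a, b, ha, hab⟩ := hf.exists_linear_le
  have hg : Integrable fun x : ℝ => Real.exp (c * b) * Real.exp (-(c * a) * |x|) := by
    refine Integrable.const_mul ?_ _
    exact integrable_exp_neg_mul_abs (b := c * a) (by positivity)
  refine hg.mono' (hf.measurable_expNeg c).aestronglyMeasurable (ae_of_all _ fun x => ?_)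
  rw [Real.norm_of_nonneg (expNeg_nonneg _ _)]
  by_cases hx : f x = ⊤
  · rw [hx, expNeg_top]; positivity
  have key : a * |x| - b ≤ fin f x := by
    rcases abs_cases x with ⟨h, h0⟩ | ⟨h, h0⟩
    · rw [h]; exact hab x h0
    · rcases hf.sides' with ⟨h', _⟩ | ⟨h', _, _⟩
      · exact absurd (h' x h0) hx
      · rw [h]
        have := hab (-x) (by linarith)
        rwa [fin, h'] at this
  rw [expNeg_of_ne_top c hx, ← Real.exp_add]
  apply Real.exp_le_exp.2
  nlinarith

theorem Z_pos {c : ℝ} (hc : 0 < c) : 0 < Z f c := by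
  unfold Z
  rw [integral_pos_iff_support_of_nonneg (fun x => expNeg_nonneg _ _) (hf.integrable_expNeg hc)]
  refine lt_of_lt_of_le ?_ (measure_mono (s := Set.Ioi 0) fun x hx => ?_)
  · simp
  · rw [Function.mem_support, expNeg_of_ne_top c (hf.finite_of_pos x hx)]
    exact (Real.exp_pos _).ne'

theorem continuousOn_dens {c : ℝ} (hc : 0 < c) : ContinuousOn (dens f c) (Set.Ioi 0) := by
  have : ContinuousOn (fun u => mult f * Real.exp (-c * u) / (Z f c * deriv (fin f) (finv f u)))
      (Set.Ioi 0) := by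
    refine ContinuousOn.div (by fun_prop) (continuousOn_const.mul hf.continuousOn_deriv_finv) ?_
    intro u hu
    have := hf.Z_pos hc
    have := hf.deriv_pos _ (hf.finv_pos hu)
    positivity
  refine this.congr fun u hu => ?_
  unfold dens
  rw [if_pos (by exact hu)]

omit hf in
theorem dens_of_nonpos {c u : ℝ} (hu : u ≤ 0) : dens f c u = 0 := by
  unfold dens; rw [if_neg hu.not_gt]

theorem measurable_dens {c : ℝ} (hc : 0 < c) : Measurable (dens f c) := by
  classical
  have := (hf.continuousOn_dens hc).measurable_piecewise (g := fun _ => (0 : ℝ))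
    continuousOn_const measurableSet_Ioi
  convert! this using 1
  ext u
  by_cases hu : 0 < u
  · rw [Set.piecewise_eq_of_mem _ _ _ (by exact hu)]
  · rw [Set.piecewise_eq_of_notMem _ _ _ (by exact hu), dens_of_nonpos (not_lt.1 hu)]

/-- This is what identifies `dens` as an energy density. Substitute `z = finv f u` on the positive
half-line; the negative half-line contributes either nothing or, by evenness, the same amount again,
that is `mult f - 1` copies. -/
theorem lintegral_comp_fin {c : ℝ} (hc : 0 < c) (ψ : ℝ → ℝ≥0∞) :
    ∫⁻ z, ψ (fin f z) * ENNReal.ofReal (expNeg c (f z) / Z f c) =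
      ∫⁻ u, ψ u * ENNReal.ofReal (dens f c u) := by
  have hZ := hf.Z_pos hc
  set Φ : ℝ → ℝ≥0∞ := fun z => ψ (fin f z) * ENNReal.ofReal (expNeg c (f z) / Z f c) with hΦ
  have hpos : ∫⁻ z in Set.Ioi 0, Φ z = ∫⁻ u in Set.Ioi 0,
      ENNReal.ofReal (deriv (fin f) (finv f u))⁻¹ *
        (ψ u * ENNReal.ofReal (Real.exp (-c * u) / Z f c)) := by
    conv_lhs => rw [← hf.image_finv]
    rw [lintegral_image_eq_lintegral_abs_deriv_mul measurableSet_Ioi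
      (fun u hu => (hf.hasStrictDerivAt_finv hu).hasDerivAt.hasDerivWithinAt) hf.injOn_finv]
    refine setLIntegral_congr_fun measurableSet_Ioi fun u hu => ?_
    simp only [hΦ]
    rw [abs_of_pos (inv_pos.2 (hf.deriv_pos _ (hf.finv_pos hu))), hf.fin_finv hu,
      expNeg_of_ne_top c (hf.finite_of_pos _ (hf.finv_pos hu)), hf.fin_finv hu]
  have hneg : ∫⁻ z in Set.Iio 0, Φ z = ENNReal.ofReal (mult f - 1) * ∫⁻ z in Set.Ioi 0, Φ z := by
    rcases hf.sides' with ⟨h, hm⟩ | ⟨h, _, hm⟩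
    · rw [hm, sub_self, ENNReal.ofReal_zero, zero_mul]
      rw [setLIntegral_congr_fun (g := fun _ => 0) measurableSet_Iio, lintegral_zero]
      intro z hz
      simp [hΦ, h z hz]
    · rw [hm]
      norm_num
      have h2 := (Measure.measurePreserving_neg (volume : Measure ℝ)).setLIntegral_comp_preimage_emb
        (MeasurableEquiv.neg ℝ).measurableEmbedding Φ (Set.Ioi 0)
      rw [← h2]
      have : (Neg.neg ⁻¹' Set.Ioi (0 : ℝ)) = Set.Iio 0 := by ext; simp
      rw [this]
      refine setLIntegral_congr_fun measurableSet_Iio fun z _ => ?_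
      simp [hΦ, h, fin]
  have hsplit : ∫⁻ z, Φ z = (∫⁻ z in Set.Iio 0, Φ z) + ∫⁻ z in Set.Ioi 0, Φ z := by
    rw [← lintegral_add_compl Φ (measurableSet_Iio (a := (0 : ℝ))), Set.compl_Iio,
      setLIntegral_congr Ioi_ae_eq_Ici]
  have hR : ∫⁻ u, ψ u * ENNReal.ofReal (dens f c u) =
      ∫⁻ u in Set.Ioi 0, ψ u * ENNReal.ofReal (dens f c u) := by
    rw [← lintegral_indicator measurableSet_Ioi]
    congr with u
    by_cases hu : 0 < u
    · rw [Set.indicator_of_mem (by exact hu)]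
    · rw [Set.indicator_of_notMem (by exact hu), dens_of_nonpos (not_lt.1 hu)]; simp
  have hm1 : 0 ≤ mult f - 1 := by
    rcases hf.sides' with ⟨_, hm⟩ | ⟨_, _, hm⟩ <;> rw [hm] <;> norm_num
  have hmm : ENNReal.ofReal (mult f - 1) + 1 = ENNReal.ofReal (mult f) := by
    rw [← ENNReal.ofReal_one, ← ENNReal.ofReal_add hm1 zero_le_one]; simp
  rw [hsplit, hneg, ← add_one_mul, hmm, hpos, hR, ← lintegral_const_mul' _ _ ENNReal.ofReal_ne_top]
  refine setLIntegral_congr_fun measurableSet_Ioi fun u hu => ?_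
  have hd := hf.deriv_pos _ (hf.finv_pos hu)
  rw [dens, if_pos (by exact hu)]
  have : mult f * Real.exp (-c * u) / (Z f c * deriv (fin f) (finv f u)) =
    mult f * ((deriv (fin f) (finv f u))⁻¹ * (Real.exp (-c * u) / Z f c)) := by
    field_simp
  rw [this, ENNReal.ofReal_mul hf.mult_pos.le, ENNReal.ofReal_mul (by positivity)]
  ring

theorem lintegral_gibbs_one {c : ℝ} (hc : 0 < c) :
    ∫⁻ z, ENNReal.ofReal (expNeg c (f z) / Z f c) = 1 := by
  have hZ := hf.Z_pos hc
  rw [← ofReal_integral_eq_lintegral_ofReal ((hf.integrable_expNeg hc).div_const _)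
    (ae_of_all _ fun x => div_nonneg (expNeg_nonneg _ _) hZ.le), integral_div]
  change ENNReal.ofReal (Z f c / Z f c) = 1
  rw [div_self hZ.ne', ENNReal.ofReal_one]

theorem lintegral_dens {c : ℝ} (hc : 0 < c) : ∫⁻ u, ENNReal.ofReal (dens f c u) = 1 := by
  have := hf.lintegral_comp_fin hc fun _ => 1
  simp only [one_mul] at this
  rw [← this, hf.lintegral_gibbs_one hc]

/-- Near the origin the liminf condition reads `f'(x)^q ≥ (a₃/2) f(x)`, which gives the power of `u
= f(x)`. Away from the origin `1 / f'` is bounded, by compactness on an interval reaching past `a₂`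
and by the tail condition beyond it. -/
theorem exists_inv_deriv_le : ∃ q K M : ℝ, 1 < q ∧ 0 < K ∧ 0 < M ∧
    ∀ u, 0 < u → (deriv (fin f) (finv f u))⁻¹ ≤ K * u ^ (-q⁻¹) + M := by
  obtain ⟨q, a₃, hq1, hq2, ha₃, hlim⟩ := hf.origin
  have hev : ∀ᶠ x in 𝓝[>] (0 : ℝ), a₃ / 2 < deriv (fin f) x ^ q / fin f x := by
    have h1 : ((a₃ / 2 : ℝ) : EReal) <
        liminf (fun x : ℝ => ((deriv (fin f) x ^ q / fin f x : ℝ) : EReal)) (𝓝[>] 0) :=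
      lt_of_lt_of_le (by exact_mod_cast half_lt_self ha₃) hlim
    filter_upwards [eventually_lt_of_lt_liminf h1] with x hx using by exact_mod_cast hx
  obtain ⟨δ, hδ, hδ'⟩ := mem_nhdsGT_iff_exists_Ioo_subset.1 hev
  obtain ⟨a₁, a₂, ha₁, ha₂, htail⟩ := hf.tail
  have hδ0 : (0 : ℝ) < δ := hδ
  obtain ⟨x₀, hx₀, hmin⟩ := (isCompact_Icc (a := δ) (b := δ + a₂ + 1)).exists_isMinOn
    ⟨δ, le_rfl, by linarith⟩
    (hf.deriv_continuous.mono fun y hy => lt_of_lt_of_le hδ0 hy.1)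
  have hm0 : 0 < deriv (fin f) x₀ := hf.deriv_pos _ (hδ0.trans_le hx₀.1)
  have hqpos : 0 < q := by linarith
  refine ⟨q, (a₃ / 2) ^ (-q⁻¹), (deriv (fin f) x₀)⁻¹ + a₁⁻¹, hq1, by positivity, by positivity,
    fun u hu => ?_⟩
  have hx := hf.finv_pos hu
  set x := finv f u with hxdef
  have hfx : fin f x = u := hf.fin_finv hu
  have hd := hf.deriv_pos x hx
  have hK : 0 ≤ (a₃ / 2) ^ (-q⁻¹) * u ^ (-q⁻¹) := by positivity
  rcases lt_or_ge x δ with h | h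
  · have h1 : a₃ / 2 < deriv (fin f) x ^ q / fin f x := hδ' ⟨hx, h⟩
    rw [hfx, lt_div_iff₀ hu] at h1
    have h2 : (a₃ / 2 * u) ^ q⁻¹ ≤ deriv (fin f) x := by
      rw [Real.rpow_inv_le_iff_of_pos (by positivity) hd.le hqpos]
      exact h1.le
    have h3 : (deriv (fin f) x)⁻¹ ≤ (a₃ / 2) ^ (-q⁻¹) * u ^ (-q⁻¹) := by
      rw [← Real.mul_rpow (by positivity) hu.le, Real.rpow_neg (by positivity)]
      exact inv_anti₀ (by positivity) h2
    have : 0 < (deriv (fin f) x₀)⁻¹ + a₁⁻¹ := by positivity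
    linarith
  · rcases le_or_gt x (δ + a₂ + 1) with h' | h'
    · have : deriv (fin f) x₀ ≤ deriv (fin f) x := hmin ⟨h, h'⟩
      have := inv_anti₀ hm0 this
      have : 0 < a₁⁻¹ := by positivity
      linarith
    · have := inv_anti₀ ha₁ (htail x (by linarith))
      have : 0 < (deriv (fin f) x₀)⁻¹ := by positivity
      linarith

/-- Here `a = 1 - 1/q`, which is positive because `q > 1`. Half of the exponential decay is spent on
turning the bounded part `M` of the previous estimate into a multiple of `u ^ (a - 1)`. -/
theorem exists_dens_le {c : ℝ} (hc : 0 < c) : ∃ a b K : ℝ, 0 < a ∧ a < 1 ∧ 0 < b ∧ 0 < K ∧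
    ∀ u, 0 < u → dens f c u ≤ K * u ^ (a - 1) * Real.exp (-b * u) := by
  obtain ⟨q, K, M, hq, hK, hM, h⟩ := hf.exists_inv_deriv_le
  have hZ := hf.Z_pos hc
  have hm := hf.mult_pos
  have hq0 : 0 < q := by linarith
  have hqi : q⁻¹ < 1 := inv_lt_one_of_one_lt₀ hq
  have hqi0 : 0 < q⁻¹ := by positivity
  refine ⟨1 - q⁻¹, c / 2, mult f / Z f c * (K + M * (1 + 2 / c)), by linarith, by linarith,
    by positivity, by positivity, fun u hu => ?_⟩
  have hd := hf.deriv_pos _ (hf.finv_pos hu)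
  have hrw : dens f c u =
      mult f / Z f c * ((deriv (fin f) (finv f u))⁻¹ * Real.exp (-c * u)) := by
    unfold dens; rw [if_pos hu]; field_simp
  have he : Real.exp (-c * u) = Real.exp (-(c / 2) * u) * Real.exp (-(c / 2) * u) := by
    rw [← Real.exp_add]; ring_nf
  have h1 : Real.exp (-(c / 2) * u) ≤ 1 := Real.exp_le_one_iff.2 (by nlinarith)
  have hup : (0 : ℝ) < u ^ (-q⁻¹) := by positivity
  have h2 : Real.exp (-(c / 2) * u) ≤ (1 + 2 / c) * u ^ (-q⁻¹) := by
    have h3 : u ^ q⁻¹ ≤ 1 + u := by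
      rcases le_or_gt u 1 with h | h
      · have := Real.rpow_le_one hu.le h hqi0.le; linarith
      · have := Real.rpow_le_rpow_of_exponent_le h.le hqi.le
        rw [Real.rpow_one] at this; linarith
    have h4 : 1 + u ≤ (1 + 2 / c) * Real.exp (c / 2 * u) := by
      have := Real.add_one_le_exp (c / 2 * u)
      have h5 : (1 + 2 / c) * (c / 2 * u + 1) ≤ (1 + 2 / c) * Real.exp (c / 2 * u) := by gcongr
      have h6 : (1 + 2 / c) * (c / 2 * u + 1) = 1 + u + (c / 2 * u + 2 / c) := by
        field_simp; ring
      have : 0 < c / 2 * u + 2 / c := by positivity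
      linarith
    have h7 : u ^ q⁻¹ ≤ (1 + 2 / c) * Real.exp (c / 2 * u) := h3.trans h4
    have h8 : Real.exp (-(c / 2) * u) = (Real.exp (c / 2 * u))⁻¹ := by
      rw [← Real.exp_neg]; ring_nf
    rw [h8, Real.rpow_neg hu.le, inv_le_iff_one_le_mul₀ (Real.exp_pos _)]
    have : (0 : ℝ) < u ^ q⁻¹ := by positivity
    rw [mul_right_comm, ← div_eq_mul_inv, one_le_div this]
    exact h7
  have hexp : (1 - q⁻¹ - 1) = -q⁻¹ := by ring
  have hgoal : mult f / Z f c * (K + M * (1 + 2 / c)) * u ^ (-q⁻¹) * Real.exp (-(c / 2) * u) =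
      mult f / Z f c * ((K + M * (1 + 2 / c)) * u ^ (-q⁻¹) * Real.exp (-(c / 2) * u)) := by ring
  rw [hrw, hexp, hgoal]
  refine mul_le_mul_of_nonneg_left ?_ (by positivity)
  calc (deriv (fin f) (finv f u))⁻¹ * Real.exp (-c * u)
      ≤ (K * u ^ (-q⁻¹) + M) * Real.exp (-c * u) := by gcongr; exact h u hu
    _ = (K * u ^ (-q⁻¹) * Real.exp (-(c / 2) * u) + M * Real.exp (-(c / 2) * u)) *
        Real.exp (-(c / 2) * u) := by rw [he]; ring
    _ ≤ (K * u ^ (-q⁻¹) * 1 + M * ((1 + 2 / c) * u ^ (-q⁻¹))) * Real.exp (-(c / 2) * u) := by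
        gcongr
    _ = _ := by ring

end MemF

end EnsembleProjection

namespace EnsembleProjection

variable {f : ℝ → WithTop ℝ}

/-! ### The Jacobian on the energy surface -/

/-- The real-valued additive Hamiltonian. -/
def Rr (f : ℝ → WithTop ℝ) {n : ℕ} (x : EuclideanSpace ℝ (Fin n)) : ℝ := ∑ i, fin f (x i)

/-- The vector of derivatives of the additive Hamiltonian. -/
def grad (f : ℝ → WithTop ℝ) {n : ℕ} (x : EuclideanSpace ℝ (Fin n)) : EuclideanSpace ℝ (Fin n) :=
  WithLp.toLp 2 fun i => deriv (fin f) (x i)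

/-- Points at which the Hamiltonian is finite and differentiable. -/
def regular (f : ℝ → WithTop ℝ) (n : ℕ) : Set (EuclideanSpace ℝ (Fin n)) :=
  {x | ∀ i, x i ≠ 0 ∧ f (x i) ≠ ⊤}

theorem R_eq_coe {n : ℕ} {x : EuclideanSpace ℝ (Fin n)} (h : ∀ i, f (x i) ≠ ⊤) :
    R f x = ((Rr f x : ℝ) : WithTop ℝ) := by
  unfold R Rr
  rw [WithTop.coe_sum]
  exact Finset.sum_congr rfl fun i _ => (coe_fin (h i)).symm

theorem R_ne_top_iff {n : ℕ} {x : EuclideanSpace ℝ (Fin n)} :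
    R f x ≠ ⊤ ↔ ∀ i, f (x i) ≠ ⊤ := by
  unfold R
  rw [Ne, WithTop.sum_eq_top]
  simp

theorem mem_surface_iff {n : ℕ} {t : ℝ} {x : EuclideanSpace ℝ (Fin n)} :
    x ∈ surface f n t ↔ (∀ i, f (x i) ≠ ⊤) ∧ Rr f x = n * t := by
  unfold surface
  constructor
  · intro h
    have hx : R f x = ((n * t : ℝ) : WithTop ℝ) := h
    have h1 : ∀ i, f (x i) ≠ ⊤ := R_ne_top_iff.1 (by rw [hx]; exact WithTop.coe_ne_top)
    rw [R_eq_coe h1] at hx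
    exact ⟨h1, WithTop.coe_injective hx⟩
  · rintro ⟨h1, h2⟩
    show R f x = _
    rw [R_eq_coe h1, h2]

theorem grad_inner {n : ℕ} (x v : EuclideanSpace ℝ (Fin n)) :
    inner ℝ (grad f x) v = ∑ i, deriv (fin f) (x i) * v i := by
  simp [grad, PiLp.inner_apply, mul_comm]

namespace MemF

variable (hf : MemF f)
include hf

theorem isOpen_regular_one : IsOpen {x : ℝ | x ≠ 0 ∧ f x ≠ ⊤} := by
  rcases hf.sides' with ⟨h, _⟩ | ⟨_, h, _⟩
  · have : {x : ℝ | x ≠ 0 ∧ f x ≠ ⊤} = Set.Ioi 0 := by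
      ext x
      constructor
      · rintro ⟨h0, h1⟩
        by_contra hx
        exact h1 (h x (lt_of_le_of_ne (not_lt.1 hx) h0))
      · intro hx
        exact ⟨(Set.mem_Ioi.1 hx).ne', hf.finite_of_pos x hx⟩
    rw [this]; exact isOpen_Ioi
  · have : {x : ℝ | x ≠ 0 ∧ f x ≠ ⊤} = {0}ᶜ := by ext x; simp [h]
    rw [this]; exact isOpen_compl_singleton

theorem isOpen_regular (n : ℕ) : IsOpen (regular f n) := by
  have : regular f n = ⋂ i, (fun x : EuclideanSpace ℝ (Fin n) => x i) ⁻¹'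
      {y : ℝ | y ≠ 0 ∧ f y ≠ ⊤} := by
    ext x; simp [regular]
  rw [this]
  exact isOpen_iInter_of_finite fun i => hf.isOpen_regular_one.preimage (by fun_prop)

theorem even_of_neg {x : ℝ} (hx : x < 0) (h : f x ≠ ⊤) : fin f = fun y => fin f (-y) := by
  rcases hf.sides' with ⟨h', _⟩ | ⟨h', _, _⟩
  · exact absurd (h' x hx) h
  · ext y; simp [fin, h']

theorem hasStrictDerivAt_fin_of_ne {x : ℝ} (hx : x ≠ 0) (h : f x ≠ ⊤) :
    HasStrictDerivAt (fin f) (deriv (fin f) x) x := by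
  rcases lt_or_gt_of_ne hx with hx | hx
  · have he := hf.even_of_neg hx h
    have h1 : HasStrictDerivAt (fun y => fin f (-y)) (deriv (fin f) (-x) * -1) x :=
      (hf.hasStrictDerivAt_fin (x := -x) (by linarith)).comp x (hasStrictDerivAt_neg x)
    rw [← he] at h1
    rwa [h1.hasDerivAt.deriv]
  · exact hf.hasStrictDerivAt_fin hx

theorem deriv_fin_neg {x : ℝ} (hx : x < 0) (h : f x ≠ ⊤) :
    deriv (fin f) x = -deriv (fin f) (-x) := by
  have he := hf.even_of_neg hx h
  conv_lhs => rw [he]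
  rw [deriv_comp_neg]

theorem continuousOn_deriv_fin : ContinuousOn (deriv (fin f)) {x : ℝ | x ≠ 0 ∧ f x ≠ ⊤} := by
  rintro x ⟨hx, h⟩
  refine ContinuousAt.continuousWithinAt ?_
  rcases lt_or_gt_of_ne hx with hx | hx
  · have h1 : ContinuousAt (fun y => -deriv (fin f) (-y)) x := by
      have : ContinuousAt (deriv (fin f)) (-x) :=
        hf.deriv_continuous.continuousAt (Ioi_mem_nhds (by linarith))
      exact (ContinuousAt.comp' (f := fun y : ℝ => -y) this continuousAt_neg).neg
    have he := hf.even_of_neg hx h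
    have : deriv (fin f) = fun y => -deriv (fin f) (-y) := by
      ext y
      conv_lhs => rw [he]
      rw [deriv_comp_neg]
    rwa [← this] at h1
  · exact hf.deriv_continuous.continuousAt (Ioi_mem_nhds hx)

theorem deriv_mul_self_pos {x : ℝ} (hx : x ≠ 0) (h : f x ≠ ⊤) : 0 < deriv (fin f) x * x := by
  rcases lt_or_gt_of_ne hx with hx | hx
  · rw [hf.deriv_fin_neg hx h]
    have := hf.deriv_pos (-x) (by linarith)
    nlinarith
  · exact mul_pos (hf.deriv_pos x hx) hx

theorem fin_abs {x : ℝ} (h : f x ≠ ⊤) : fin f |x| = fin f x := by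
  rcases lt_or_ge x 0 with hx | hx
  · rw [abs_of_neg hx]; exact (congrFun (hf.even_of_neg hx h) x).symm
  · rw [abs_of_nonneg hx]

theorem ne_top_mul {x κ : ℝ} (h : f x ≠ ⊤) (hκ : 0 < κ) : f (κ * x) ≠ ⊤ := by
  rcases hf.sides' with ⟨h', _⟩ | ⟨_, h', _⟩
  · have hx : 0 ≤ x := by
      by_contra hx; exact h (h' x (not_le.1 hx))
    rcases eq_or_lt_of_le hx with rfl | hx
    · rw [mul_zero, hf.zero]; exact WithTop.coe_ne_top
    · exact hf.finite_of_pos _ (by positivity)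
  · exact h' _

theorem smul_mem_regular {n : ℕ} {x : EuclideanSpace ℝ (Fin n)} (hx : x ∈ regular f n) {κ : ℝ}
    (hκ : 0 < κ) : κ • x ∈ regular f n := fun i =>
  ⟨by simpa using ⟨hκ.ne', (hx i).1⟩, by simpa using hf.ne_top_mul (hx i).2 hκ⟩

theorem hasStrictFDerivAt_Rr {n : ℕ} {x : EuclideanSpace ℝ (Fin n)} (hx : x ∈ regular f n) :
    HasStrictFDerivAt (Rr f) (innerSL ℝ (grad f x)) x := by
  have h1 : HasStrictFDerivAt (fun y : EuclideanSpace ℝ (Fin n) => ∑ i, fin f (y i))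
      (∑ i, deriv (fin f) (x i) • (EuclideanSpace.proj i : EuclideanSpace ℝ (Fin n) →L[ℝ] ℝ)) x :=
    HasStrictFDerivAt.fun_sum fun i _ =>
      HasStrictDerivAt.comp_hasStrictFDerivAt (h₂ := fin f)
        (f := fun y : EuclideanSpace ℝ (Fin n) => y i) x
        (hf.hasStrictDerivAt_fin_of_ne (hx i).1 (hx i).2)
        (EuclideanSpace.proj i : EuclideanSpace ℝ (Fin n) →L[ℝ] ℝ).hasStrictFDerivAt
  convert! h1 using 1
  ext v
  simp [grad_inner]

theorem grad_inner_self_pos {n : ℕ} (hn : 0 < n) {x : EuclideanSpace ℝ (Fin n)}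
    (hx : x ∈ regular f n) : 0 < inner ℝ (grad f x) x := by
  rw [grad_inner]
  have : Nonempty (Fin n) := ⟨⟨0, hn⟩⟩
  exact Finset.sum_pos (fun i _ => hf.deriv_mul_self_pos (hx i).1 (hx i).2) Finset.univ_nonempty

theorem strictMonoOn_Rr_smul {n : ℕ} (hn : 0 < n) {x : EuclideanSpace ℝ (Fin n)}
    (hx : x ∈ regular f n) : StrictMonoOn (fun κ : ℝ => Rr f (κ • x)) (Set.Ioi 0) := by
  have : Nonempty (Fin n) := ⟨⟨0, hn⟩⟩
  intro κ hκ μ hμ hlt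
  refine Finset.sum_lt_sum_of_nonempty Finset.univ_nonempty fun i _ => ?_
  have hκ0 : 0 < κ := hκ
  have hμ0 : 0 < μ := hμ
  have hxi : 0 < |x i| := abs_pos.2 (hx i).1
  have e1 : fin f ((κ • x) i) = fin f (κ * |x i|) := by
    rw [← hf.fin_abs (x := (κ • x) i) (hf.smul_mem_regular hx hκ i).2]
    simp [abs_mul, abs_of_pos hκ0]
  have e2 : fin f ((μ • x) i) = fin f (μ * |x i|) := by
    rw [← hf.fin_abs (x := (μ • x) i) (hf.smul_mem_regular hx hμ i).2]
    simp [abs_mul, abs_of_pos hμ0]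
  rw [e1, e2]
  apply hf.strictMonoOn_fin
  · exact (mul_pos hκ0 hxi).le
  · exact (mul_pos hμ0 hxi).le
  · gcongr

theorem centralProj_eq {n : ℕ} (hn : 0 < n) {t : ℝ} {x : EuclideanSpace ℝ (Fin n)}
    (hx : x ∈ regular f n) {κ : ℝ} (hκ : 0 < κ) (h : Rr f (κ • x) = n * t) :
    centralProj f n t x = κ • x := by
  have hmem : κ • x ∈ surface f n t :=
    mem_surface_iff.2 ⟨fun i => (hf.smul_mem_regular hx hκ i).2, h⟩
  have hex : ∃ κ : ℝ, 0 < κ ∧ κ • x ∈ surface f n t := ⟨κ, hκ, hmem⟩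
  rw [centralProj, dif_pos hex]
  congr 1
  obtain ⟨h1, h2⟩ := hex.choose_spec
  exact (hf.strictMonoOn_Rr_smul hn hx).injOn h1 hκ ((mem_surface_iff.1 h2).2.trans h.symm)

/-- The implicit function theorem for `(z, κ) ↦ R(κ z)` at `(x, 1)`. The derivative in `κ` is
`⟨∇R(x), x⟩`, which is positive because each `f'(x_i) x_i` is. -/
theorem exists_hasStrictFDerivAt_scale {n : ℕ} (hn : 0 < n) {t : ℝ}
    {x : EuclideanSpace ℝ (Fin n)} (hx : x ∈ regular f n) (hxt : Rr f x = n * t) :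
    ∃ κ : EuclideanSpace ℝ (Fin n) → ℝ, κ x = 1 ∧
      HasStrictFDerivAt κ (-(inner ℝ (grad f x) x)⁻¹ • innerSL ℝ (grad f x)) x ∧
      ∀ᶠ z in 𝓝 x, Rr f (κ z • z) = n * t := by
  set a := innerSL ℝ (grad f x) with ha
  have hax : 0 < a x := hf.grad_inner_self_pos hn hx
  set Θ : EuclideanSpace ℝ (Fin n) × ℝ → ℝ := fun p => Rr f (p.2 • p.1) with hΘ
  set Θ' : EuclideanSpace ℝ (Fin n) × ℝ →L[ℝ] ℝ :=
    a ∘L ((1 : ℝ) • ContinuousLinearMap.fst ℝ _ _ +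
      (ContinuousLinearMap.snd ℝ _ _).smulRight x) with hΘ'
  have hd : HasStrictFDerivAt Θ Θ' (x, 1) := by
    have h0 : HasStrictFDerivAt (fun p : EuclideanSpace ℝ (Fin n) × ℝ => p.2 • p.1)
        ((1 : ℝ) • ContinuousLinearMap.fst ℝ _ _ + (ContinuousLinearMap.snd ℝ _ _).smulRight x)
        (x, 1) :=
      HasStrictFDerivAt.fun_smul (c := fun p : EuclideanSpace ℝ (Fin n) × ℝ => p.2)
        (f := fun p : EuclideanSpace ℝ (Fin n) × ℝ => p.1) (x := (x, (1 : ℝ)))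
        hasStrictFDerivAt_snd hasStrictFDerivAt_fst
    have h1 : HasStrictFDerivAt (Rr f) a ((fun p : EuclideanSpace ℝ (Fin n) × ℝ => p.2 • p.1)
        (x, 1)) := by
      simpa using hf.hasStrictFDerivAt_Rr hx
    exact h1.comp (x, (1 : ℝ)) h0
  have hinr : Θ' ∘L ContinuousLinearMap.inr ℝ _ ℝ = a x • ContinuousLinearMap.id ℝ ℝ := by
    ext; simp [hΘ']
  have hinl : Θ' ∘L ContinuousLinearMap.inl ℝ _ ℝ = a := by
    ext v; simp [hΘ']
  have hinv : (Θ' ∘L ContinuousLinearMap.inr ℝ _ ℝ).inverse =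
      (a x)⁻¹ • ContinuousLinearMap.id ℝ ℝ := by
    apply ContinuousLinearMap.inverse_eq <;>
    · rw [hinr]; ext; simp [hax.ne']
  have hI : (Θ' ∘L ContinuousLinearMap.inr ℝ _ ℝ).IsInvertible := by
    refine ContinuousLinearMap.IsInvertible.of_inverse
      (g := (a x)⁻¹ • ContinuousLinearMap.id ℝ ℝ) ?_ ?_ <;>
    · rw [hinr]; ext; simp [hax.ne']
  refine ⟨hd.implicitFunctionOfProdDomain hI, ?_, ?_, ?_⟩
  · exact (hd.eventually_apply_eq_iff_implicitFunctionOfProdDomain hI).self_of_nhds.1 rfl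
  · convert! hd.hasStrictFDerivAt_implicitFunctionOfProdDomain hI using 1
    rw [hinv, hinl]
    ext v; simp [ha]
  · filter_upwards [hd.eventually_apply_implicitFunctionOfProdDomain hI] with z hz
    simpa [hΘ, hxt] using hz

/-- The derivative of the coordinate map at a regular point of the energy surface. -/
theorem hasFDerivAt_coords {n : ℕ} (hn : 0 < n) {t : ℝ} {x : EuclideanSpace ℝ (Fin n)}
    (hx : x ∈ regular f n) (hxt : Rr f x = n * t) :
    HasFDerivAt (coords f n t)
      ((WithLp.prodContinuousLinearEquiv 2 ℝ ℝ (EuclideanSpace ℝ (Fin n))).symm.toContinuousLinearMap ∘L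
        (innerSL ℝ (grad f x)).prod (ContinuousLinearMap.id ℝ _ +
          (-(inner ℝ (grad f x) x)⁻¹ • innerSL ℝ (grad f x)).smulRight x)) x := by
  obtain ⟨κ, hκ1, hκ, hev⟩ := hf.exists_hasStrictFDerivAt_scale hn hx hxt
  have h1 : HasFDerivAt (fun z => (Rr f z, κ z • z)) ((innerSL ℝ (grad f x)).prod
      (κ x • ContinuousLinearMap.id ℝ _ +
        (-(inner ℝ (grad f x) x)⁻¹ • innerSL ℝ (grad f x)).smulRight x)) x :=
    (hf.hasStrictFDerivAt_Rr hx).hasFDerivAt.prodMk (hκ.hasFDerivAt.smul (hasFDerivAt_id x))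
  rw [hκ1, one_smul] at h1
  have h2 := ((WithLp.prodContinuousLinearEquiv 2 ℝ ℝ
    (EuclideanSpace ℝ (Fin n))).symm.toContinuousLinearMap.hasFDerivAt (x := (Rr f x, κ x • x))).comp x h1
  refine h2.congr_of_eventuallyEq ?_
  have hκpos : ∀ᶠ z in 𝓝 x, 0 < κ z :=
    hκ.hasFDerivAt.continuousAt.eventually (lt_mem_nhds (by rw [hκ1]; exact one_pos))
  filter_upwards [hev, hκpos, (hf.isOpen_regular n).mem_nhds hx] with z hz hz0 hzr
  simp only [coords, R_eq_coe fun i => (hzr i).2, hf.centralProj_eq hn hzr hz0 hz]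
  rfl

/-- With `a = ∇R(x)`, the derivative sends `u` to the pair of `⟨a, u⟩` and `u - (⟨a, u⟩ / ⟨a, x⟩)
x`, whose second entry is orthogonal to `a`. Placing the first entry along the unit vector `a / ‖a‖`
keeps the Gram form and gives the endomorphism `B`, a transvection of determinant `1 + ⟨a, v₀⟩ =
‖a‖`. -/
theorem jacobian_eq {n : ℕ} (hn : 0 < n) {t : ℝ} {x : EuclideanSpace ℝ (Fin n)}
    (hx : x ∈ regular f n) (hxt : Rr f x = n * t) : jacobian f n t x = ‖grad f x‖⁻¹ := by
  have hD := (hf.hasFDerivAt_coords hn hx hxt).fderiv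
  have hgx := hf.grad_inner_self_pos hn hx
  set a := grad f x with ha
  have ha0 : 0 < ‖a‖ := norm_pos_iff.2 fun h => by rw [h] at hgx; simp at hgx
  set D := fderiv ℝ (coords f n t) x with hDdef
  set v₀ : EuclideanSpace ℝ (Fin n) := ‖a‖⁻¹ • a - (inner ℝ a x)⁻¹ • x with hv₀
  set B : EuclideanSpace ℝ (Fin n) →L[ℝ] EuclideanSpace ℝ (Fin n) :=
    ContinuousLinearMap.id ℝ _ + (innerSL ℝ a).smulRight v₀ with hB
  have hdet : (D : EuclideanSpace ℝ (Fin n) →ₗ[ℝ]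
      WithLp 2 (ℝ × EuclideanSpace ℝ (Fin n))).normDet = ‖a‖ := by
    rw [normDet_eq_abs_det_of_inner_eq D B]
    · have : (B : EuclideanSpace ℝ (Fin n) →ₗ[ℝ] EuclideanSpace ℝ (Fin n)) =
          LinearMap.transvection (innerSL ℝ a : EuclideanSpace ℝ (Fin n) →ₗ[ℝ] ℝ) v₀ := by
        ext v; simp [hB, LinearMap.transvection.apply]
      rw [this, LinearMap.transvection.det]
      have : (innerSL ℝ a : EuclideanSpace ℝ (Fin n) →ₗ[ℝ] ℝ) v₀ = ‖a‖ - 1 := by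
        simp only [hv₀, ContinuousLinearMap.coe_coe, innerSL_apply_apply, inner_sub_right,
          inner_smul_right, real_inner_self_eq_norm_sq]
        field_simp
      rw [this]
      simp
    · intro u v
      have hDu : ∀ u, D u = WithLp.toLp 2 (inner ℝ a u, u - ((inner ℝ a x)⁻¹ * inner ℝ a u) • x) := by
        intro u
        rw [hD]
        simp [sub_eq_add_neg]
      have hBu : ∀ u, B u = (inner ℝ a u * ‖a‖⁻¹) • a +
          (u - ((inner ℝ a x)⁻¹ * inner ℝ a u) • x) := by
        intro u
        simp only [hB, hv₀, FunLike.coe_add, Pi.add_apply, ContinuousLinearMap.coe_id', id,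
          ContinuousLinearMap.smulRight_apply, innerSL_apply_apply]
        module
      have horth : ∀ u, inner ℝ a (u - ((inner ℝ a x)⁻¹ * inner ℝ a u) • x) = (0 : ℝ) := by
        intro u
        rw [inner_sub_right, inner_smul_right]
        field_simp
        ring
      have horth' : ∀ u, inner ℝ (u - ((inner ℝ a x)⁻¹ * inner ℝ a u) • x) a = (0 : ℝ) :=
        fun u => by rw [real_inner_comm, horth]
      rw [hDu, hDu, hBu, hBu, WithLp.prod_inner_apply, inner_add_left, inner_add_right,
        inner_add_right, inner_smul_left, inner_smul_left, inner_smul_right, inner_smul_right,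
        horth, horth', real_inner_self_eq_norm_sq]
      simp only [conj_trivial, RCLike.inner_apply]
      field_simp
      ring
  unfold jacobian
  have h1 := D.normDet_sq
  rw [ContinuousLinearMap.det, hdet] at h1
  rw [← hDdef]
  have h2 : LinearMap.det ((ContinuousLinearMap.adjoint D ∘L D :
      EuclideanSpace ℝ (Fin n) →L[ℝ] EuclideanSpace ℝ (Fin n)) :
      EuclideanSpace ℝ (Fin n) →ₗ[ℝ] EuclideanSpace ℝ (Fin n)) = ‖a‖ ^ 2 := by
    rw [← h1]; simp
  rw [h2, Real.sqrt_sq ha0.le]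

end MemF

end EnsembleProjection

namespace EnsembleProjection

variable {f : ℝ → WithTop ℝ}

/-! ### Splitting off one coordinate -/

/-- The isometric embedding inserting a zero coordinate. -/
def insertZero {d : ℕ} (i : Fin (d + 1)) :
    EuclideanSpace ℝ (Fin d) →ₗᵢ[ℝ] EuclideanSpace ℝ (Fin (d + 1)) where
  toFun y := WithLp.toLp 2 (i.insertNth (α := fun _ => ℝ) 0 y)
  map_add' y z := by
    ext j
    refine Fin.succAboveCases i ?_ (fun j => ?_) j <;> simp
  map_smul' r y := by
    ext j
    refine Fin.succAboveCases i ?_ (fun j => ?_) j <;> simp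
  norm_map' y := by
    rw [← sq_eq_sq₀ (norm_nonneg _) (norm_nonneg _), EuclideanSpace.norm_sq_eq,
      EuclideanSpace.norm_sq_eq, Fin.sum_univ_succAbove _ i]
    simp

@[simp] theorem insertZero_same {d : ℕ} (i : Fin (d + 1)) (y : EuclideanSpace ℝ (Fin d)) :
    insertZero i y i = 0 := by simp [insertZero]

@[simp] theorem insertZero_succAbove {d : ℕ} (i : Fin (d + 1)) (y : EuclideanSpace ℝ (Fin d))
    (j : Fin d) : insertZero i y (i.succAbove j) = y j := by simp [insertZero]

/-- Appending a last coordinate. -/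
def append {d : ℕ} (y : EuclideanSpace ℝ (Fin d)) (z : ℝ) : EuclideanSpace ℝ (Fin (d + 1)) :=
  insertZero (Fin.last d) y + z • EuclideanSpace.single (Fin.last d) (1 : ℝ)

@[simp] theorem append_castSucc {d : ℕ} (y : EuclideanSpace ℝ (Fin d)) (z : ℝ) (j : Fin d) :
    append y z j.castSucc = y j := by
  have h := insertZero_succAbove (Fin.last d) y j
  rw [Fin.succAbove_last] at h
  simp [append, h]

@[simp] theorem append_last {d : ℕ} (y : EuclideanSpace ℝ (Fin d)) (z : ℝ) :
    append y z (Fin.last d) = z := by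
  simp [append]

theorem proj_apply {n k : ℕ} (h : k ≤ n) (x : EuclideanSpace ℝ (Fin n)) (i : Fin k) :
    proj n k x i = x (Fin.castLE h i) := by
  have : (i : ℕ) < n := i.2.trans_le h
  simp only [proj, this, dite_true]
  rfl

@[simp] theorem proj_append {d : ℕ} (y : EuclideanSpace ℝ (Fin d)) (z : ℝ) :
    proj (d + 1) d (append y z) = y := by
  ext i
  rw [proj_apply (Nat.le_succ d)]
  exact append_castSucc y z i

theorem append_proj {d : ℕ} (x : EuclideanSpace ℝ (Fin (d + 1))) :
    append (proj (d + 1) d x) (x (Fin.last d)) = x := by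
  ext i
  refine Fin.lastCases ?_ (fun j => ?_) i
  · simp
  · rw [append_castSucc, proj_apply (Nat.le_succ d)]
    rfl

theorem proj_proj {n m k : ℕ} (h : k ≤ m) (h' : m ≤ n) (x : EuclideanSpace ℝ (Fin n)) :
    proj m k (proj n m x) = proj n k x := by
  ext i
  rw [proj_apply h, proj_apply h', proj_apply (h.trans h')]
  rfl

theorem measurable_proj (n k : ℕ) : Measurable (proj n k) := by
  unfold proj
  refine (WithLp.measurable_toLp 2 (Fin k → ℝ)).comp (measurable_pi_iff.2 fun i => ?_)
  by_cases h : (i : ℕ) < n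
  · simp only [h, dite_true]; fun_prop
  · simp only [h, dite_false]; fun_prop

theorem lintegral_append {d : ℕ} {F : EuclideanSpace ℝ (Fin (d + 1)) → ℝ≥0∞} (hF : Measurable F) :
    ∫⁻ x, F x = ∫⁻ y, ∫⁻ z, F (append y z) := by
  have h1 := (PiLp.volume_preserving_toLp (Fin (d + 1))).lintegral_comp_emb
    (MeasurableEquiv.toLp 2 (Fin (d + 1) → ℝ)).measurableEmbedding F
  have h2 := ((volume_preserving_piFinSuccAbove (fun _ : Fin (d + 1) => ℝ)
    (Fin.last d)).symm).lintegral_comp_emb (MeasurableEquiv.measurableEmbedding _)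
    (fun x : Fin (d + 1) → ℝ => F (WithLp.toLp 2 x))
  have h3 := fun G : EuclideanSpace ℝ (Fin d) → ℝ≥0∞ =>
    (PiLp.volume_preserving_toLp (Fin d)).lintegral_comp_emb
      (MeasurableEquiv.toLp 2 (Fin d → ℝ)).measurableEmbedding G
  rw [← h1, ← h2, ← h3, Measure.volume_eq_prod, lintegral_prod_symm']
  · refine lintegral_congr fun y => lintegral_congr fun z => congrArg F ?_
    ext j
    refine Fin.lastCases ?_ (fun j => ?_) j
    · rw [append_last]
      simp [MeasurableEquiv.piFinSuccAbove_symm_apply]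
    · rw [append_castSucc]
      simp [MeasurableEquiv.piFinSuccAbove_symm_apply]
  · exact hF.comp ((WithLp.measurable_toLp 2 _).comp (MeasurableEquiv.measurable _))

theorem Rr_append {d : ℕ} (y : EuclideanSpace ℝ (Fin d)) (z : ℝ) :
    Rr f (append y z) = Rr f y + fin f z := by
  simp [Rr, Fin.sum_univ_castSucc]

theorem forall_append {d : ℕ} {y : EuclideanSpace ℝ (Fin d)} {z : ℝ} {P : ℝ → Prop} :
    (∀ i, P (append y z i)) ↔ (∀ i, P (y i)) ∧ P z := by
  rw [Fin.forall_fin_succ']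
  simp

theorem norm_grad_append_sq {d : ℕ} (y : EuclideanSpace ℝ (Fin d)) (z : ℝ) :
    ‖grad f (append y z)‖ ^ 2 = ‖grad f y‖ ^ 2 + deriv (fin f) z ^ 2 := by
  simp [grad, EuclideanSpace.norm_sq_eq, Fin.sum_univ_castSucc]

theorem measurable_grad {n : ℕ} : Measurable (grad f (n := n)) := by
  unfold grad
  refine (WithLp.measurable_toLp 2 (Fin n → ℝ)).comp (measurable_pi_iff.2 fun i => ?_)
  exact (measurable_deriv _).comp (by fun_prop)

namespace MemF

variable (hf : MemF f)
include hf

theorem measurable_Rr {n : ℕ} : Measurable (Rr f (n := n)) := by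
  unfold Rr
  exact Finset.measurable_sum _ fun i _ => hf.measurable_fin.comp (by fun_prop)

theorem measurableSet_surface (n : ℕ) (t : ℝ) : MeasurableSet (surface f n t) := by
  have : surface f n t = (⋂ i, (fun x : EuclideanSpace ℝ (Fin n) => x i) ⁻¹' {y | f y ≠ ⊤}) ∩
      Rr f ⁻¹' {n * t} := by
    ext x; simp [mem_surface_iff]
  rw [this]
  exact (MeasurableSet.iInter fun i => hf.measurableSet_ne_top.preimage (by fun_prop)).inter
    (hf.measurable_Rr (measurableSet_singleton _))

/-! ### The energy surface -/

theorem countable_level (s : ℝ) : {z | f z ≠ ⊤ ∧ fin f z = s}.Countable := by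
  rcases Set.eq_empty_or_nonempty {z | f z ≠ ⊤ ∧ fin f z = s} with h | ⟨z₀, h₀, h₀'⟩
  · rw [h]; exact Set.countable_empty
  refine (Set.toFinite {|z₀|, -|z₀|}).countable.mono ?_
  rintro z ⟨h, h'⟩
  have : |z| = |z₀| := hf.strictMonoOn_fin.injOn (abs_nonneg z) (abs_nonneg z₀) (by
    rw [hf.fin_abs h, hf.fin_abs h₀, h', h₀'])
  rcases abs_choice z with hz | hz <;> simp [← this, hz]

/-- By Fubini in the last coordinate, since a one-dimensional level set has at most two points. The
condition `r ≠ 0` matters in dimension `0`, where the only point has energy `0`. -/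
theorem volume_level {d : ℕ} {r : ℝ} (hr : r ≠ 0) :
    volume {y : EuclideanSpace ℝ (Fin d) | (∀ i, f (y i) ≠ ⊤) ∧ Rr f y = r} = 0 := by
  have hm : MeasurableSet {y : EuclideanSpace ℝ (Fin d) | (∀ i, f (y i) ≠ ⊤) ∧ Rr f y = r} := by
    have : {y : EuclideanSpace ℝ (Fin d) | (∀ i, f (y i) ≠ ⊤) ∧ Rr f y = r} =
        (⋂ i, (fun x : EuclideanSpace ℝ (Fin d) => x i) ⁻¹' {y | f y ≠ ⊤}) ∩ Rr f ⁻¹' {r} := by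
      ext x; simp
    rw [this]
    exact (MeasurableSet.iInter fun i => hf.measurableSet_ne_top.preimage (by fun_prop)).inter
      (hf.measurable_Rr (measurableSet_singleton _))
  cases d with
  | zero =>
    have : {y : EuclideanSpace ℝ (Fin 0) | (∀ i, f (y i) ≠ ⊤) ∧ Rr f y = r} = ∅ := by
      ext y; simp [Rr, hr.symm]
    rw [this, measure_empty]
  | succ d =>
    rw [← lintegral_indicator_one hm, lintegral_append (measurable_one.indicator hm)]
    rw [← lintegral_zero (μ := (volume : Measure (EuclideanSpace ℝ (Fin d))))]
    refine lintegral_congr fun y => ?_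
    have hae : ∀ᵐ z : ℝ, z ∉ {z | f z ≠ ⊤ ∧ fin f z = r - Rr f y} :=
      (hf.countable_level _).ae_notMem _
    rw [← lintegral_zero (μ := (volume : Measure ℝ))]
    refine lintegral_congr_ae ?_
    filter_upwards [hae] with z hz
    rw [Set.indicator_of_notMem]
    rintro ⟨h1, h2⟩
    rw [Rr_append] at h2
    exact hz ⟨(forall_append (P := fun z => f z ≠ ⊤).1 h1).2, by linarith⟩

/-- An irregular point of the surface has a zero coordinate. Dropping it leaves a point of a level
set in `ℝ^d`, and there the `d`-dimensional measure is Lebesgue measure. -/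
theorem surface_diff_regular_null {d : ℕ} {t : ℝ} (ht : 0 < t) :
    μHE[d] (surface f (d + 1) t \ regular f (d + 1)) = 0 := by
  have hsub : surface f (d + 1) t \ regular f (d + 1) ⊆ ⋃ i, insertZero i ''
      {y : EuclideanSpace ℝ (Fin d) | (∀ j, f (y j) ≠ ⊤) ∧ Rr f y = (d + 1 : ℕ) * t} := by
    rintro x ⟨hx, hxr⟩
    obtain ⟨h1, h2⟩ := mem_surface_iff.1 hx
    have : ∃ i, x i = 0 := by
      by_contra hne
      push Not at hne
      exact hxr fun i => ⟨hne i, h1 i⟩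
    obtain ⟨i, hi⟩ := this
    refine Set.mem_iUnion.2 ⟨i, WithLp.toLp 2 fun j => x (i.succAbove j), ⟨fun j => h1 _, ?_⟩, ?_⟩
    · rw [← h2, Rr, Rr, Fin.sum_univ_succAbove _ i, hi, hf.fin_zero, zero_add]
    · ext j
      refine Fin.succAboveCases i ?_ (fun j => ?_) j
      · rw [insertZero_same, hi]
      · rw [insertZero_succAbove]
  refine measure_mono_null hsub (measure_iUnion_null fun i => ?_)
  rw [(insertZero i).isometry.euclideanHausdorffMeasure_image,
    EuclideanSpace.euclideanHausdorffMeasure_eq_volume]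
  exact hf.volume_level (by positivity)

/-- The regular points below a given energy. -/
theorem isOpen_sublevel (d : ℕ) (r : ℝ) : IsOpen {y ∈ regular f d | Rr f y < r} := by
  have hc : ContinuousOn (Rr f) (regular f d) := fun y hy =>
    (hf.hasStrictFDerivAt_Rr hy).continuousAt.continuousWithinAt
  exact hc.isOpen_inter_preimage (hf.isOpen_regular d) isOpen_Iio

theorem continuousOn_grad (d : ℕ) : ContinuousOn (grad f) (regular f d) := by
  unfold grad
  refine (PiLp.continuous_toLp 2 _).comp_continuousOn (continuousOn_pi.2 fun i => ?_)
  exact hf.continuousOn_deriv_fin.comp (by fun_prop) fun x hx => hx i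

/-- The sheet is the graph of `w = σ finv(r - R)`, whose gradient is `-σ ∇R / δ` with `δ = f'(finv(r
- R))`. So the graph factor is `√(‖∇R‖² + δ²) / δ`. Its numerator is the norm of the full gradient
and cancels the weight, leaving `1 / δ`. -/
theorem setLIntegral_sheet {d : ℕ} {r : ℝ} {σ : ℝ} (hσ : σ = 1 ∨ σ = -1)
    (hσf : ∀ u, 0 < u → f (σ * finv f u) ≠ ⊤)
    {φ : EuclideanSpace ℝ (Fin d) → ℝ≥0∞} (hφ : Measurable φ) :
    ∫⁻ v in (fun y => append y (σ * finv f (r - Rr f y))) '' {y ∈ regular f d | Rr f y < r},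
        φ (proj (d + 1) d v) * ENNReal.ofReal ‖grad f v‖⁻¹ ∂μHE[d] =
      ∫⁻ y in {y ∈ regular f d | Rr f y < r},
        φ y * ENNReal.ofReal (deriv (fin f) (finv f (r - Rr f y)))⁻¹ := by
  set O := {y ∈ regular f d | Rr f y < r} with hO
  have hOopen : IsOpen O := hf.isOpen_sublevel d r
  set w : EuclideanSpace ℝ (Fin d) → ℝ := fun y => σ * finv f (r - Rr f y) with hw
  set w' : EuclideanSpace ℝ (Fin d) → EuclideanSpace ℝ (Fin d) →L[ℝ] ℝ := fun y =>
    (-(σ * (deriv (fin f) (finv f (r - Rr f y)))⁻¹)) • innerSL ℝ (grad f y) with hw'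
  have hRc : ContinuousOn (Rr f) O := fun y hy =>
    (hf.hasStrictFDerivAt_Rr hy.1).continuousAt.continuousWithinAt
  have hpos : ∀ y ∈ O, 0 < r - Rr f y := fun y hy => sub_pos.2 hy.2
  have hder : ∀ y ∈ O, HasStrictFDerivAt w (w' y) y := by
    intro y hy
    have h1 : HasStrictFDerivAt (fun y => r - Rr f y) (-innerSL ℝ (grad f y)) y :=
      (hf.hasStrictFDerivAt_Rr hy.1).const_sub r
    have h2 := (hf.hasStrictDerivAt_finv (hpos y hy)).comp_hasStrictFDerivAt y h1
    convert! h2.const_mul σ using 1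
    ext v
    simp [hw']
    ring
  have hcont : ContinuousOn w' O := by
    have h1 : ContinuousOn (fun y => deriv (fin f) (finv f (r - Rr f y))) O :=
      hf.continuousOn_deriv_finv.comp (continuousOn_const.sub hRc) hpos
    have h2 : ContinuousOn (fun y => (deriv (fin f) (finv f (r - Rr f y)))⁻¹) O :=
      h1.inv₀ fun y hy => (hf.deriv_pos _ (hf.finv_pos (hpos y hy))).ne'
    have h3 : ContinuousOn (grad f) O := (hf.continuousOn_grad d).mono fun y hy => hy.1
    exact ((continuousOn_const.mul h2).neg).smul ((innerSL ℝ).continuous.comp_continuousOn h3)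
  have hfr : Module.finrank ℝ (EuclideanSpace ℝ (Fin d)) = d := by simp
  have key := setLIntegral_graph_eq (insertZero (Fin.last d))
    (e := EuclideanSpace.single (Fin.last d) (1 : ℝ)) (by simp)
    (fun u => by simp [EuclideanSpace.inner_single_right]) hOopen hder hcont
    (φ := fun v => φ (proj (d + 1) d v) * ENNReal.ofReal ‖grad f v‖⁻¹)
    ((hφ.comp (measurable_proj _ _)).mul
      (measurable_grad.norm.inv.ennreal_ofReal))
  rw [hfr] at key
  refine key.trans (setLIntegral_congr_fun hOopen.measurableSet fun y hy => ?_)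
  change φ (proj (d + 1) d (append y (w y))) * ENNReal.ofReal ‖grad f (append y (w y))‖⁻¹ *
    ENNReal.ofReal (Real.sqrt (1 + ‖w' y‖ ^ 2)) = _
  rw [proj_append, mul_assoc, ← ENNReal.ofReal_mul (by positivity)]
  have hd := hf.deriv_pos _ (hf.finv_pos (hpos y hy))
  -- On the lower sheet the derivative of the even function changes sign, which the square does not
  -- see.
  have hdσ : deriv (fin f) (w y) ^ 2 = deriv (fin f) (finv f (r - Rr f y)) ^ 2 := by
    rcases hσ with rfl | rfl
    · simp [hw]
    · have := hf.deriv_fin_neg (x := -finv f (r - Rr f y))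
        (by have := hf.finv_pos (hpos y hy); linarith) (by simpa using hσf _ (hpos y hy))
      simp [hw, this]
  have hσ2 : σ ^ 2 = 1 := by rcases hσ with rfl | rfl <;> norm_num
  congr 2
  set δ := deriv (fin f) (finv f (r - Rr f y)) with hδ
  have hn : ‖w' y‖ ^ 2 = (δ⁻¹) ^ 2 * ‖grad f y‖ ^ 2 := by
    rw [hw', norm_smul, mul_pow, innerSL_apply_norm, Real.norm_eq_abs, sq_abs, neg_sq, mul_pow, hσ2,
      one_mul]
  have hg : ‖grad f (append y (w y))‖ = Real.sqrt (‖grad f y‖ ^ 2 + δ ^ 2) := by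
    rw [← hdσ, ← norm_grad_append_sq, Real.sqrt_sq (norm_nonneg _)]
  have h1 : 1 + ‖w' y‖ ^ 2 = (δ⁻¹) ^ 2 * (‖grad f y‖ ^ 2 + δ ^ 2) := by
    rw [hn]; field_simp; ring
  rw [h1, Real.sqrt_mul (by positivity), Real.sqrt_sq (by positivity), hg]
  have : 0 < Real.sqrt (‖grad f y‖ ^ 2 + δ ^ 2) := Real.sqrt_pos.2 (by positivity)
  field_simp

theorem surface_inter_pos {d : ℕ} {t : ℝ} :
    surface f (d + 1) t ∩ regular f (d + 1) ∩ {x | 0 < x (Fin.last d)} =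
      (fun y => append y (1 * finv f ((d + 1 : ℕ) * t - Rr f y))) ''
        {y ∈ regular f d | Rr f y < (d + 1 : ℕ) * t} := by
  ext x
  constructor
  · rintro ⟨⟨hx, hr⟩, hl⟩
    have hl' : 0 < x (Fin.last d) := hl
    obtain ⟨h1, h2⟩ := mem_surface_iff.1 hx
    rw [← append_proj x, Rr_append] at h2
    have hfl := hf.fin_pos hl'
    refine ⟨proj (d + 1) d x, ⟨fun i => ?_, by linarith⟩, ?_⟩
    · rw [proj_apply (Nat.le_succ d)]; exact hr _
    · simp only
      rw [one_mul, ← h2, add_sub_cancel_left, hf.finv_fin hl', append_proj]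
  · rintro ⟨y, ⟨hy, hyr⟩, rfl⟩
    have hu : 0 < ((d + 1 : ℕ) * t - Rr f y) := sub_pos.2 hyr
    have hp := hf.finv_pos hu
    refine ⟨⟨mem_surface_iff.2 ⟨?_, ?_⟩, ?_⟩, ?_⟩
    · exact forall_append (P := fun z => f z ≠ ⊤).2
        ⟨fun i => (hy i).2, by rw [one_mul]; exact hf.finite_of_pos _ hp⟩
    · rw [Rr_append, one_mul, hf.fin_finv hu]; ring
    · exact forall_append (P := fun z => z ≠ 0 ∧ f z ≠ ⊤).2
        ⟨hy, by rw [one_mul]; exact ⟨hp.ne', hf.finite_of_pos _ hp⟩⟩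
    · show 0 < append y _ (Fin.last d)
      rw [append_last, one_mul]; exact hp

theorem surface_inter_neg {d : ℕ} {t : ℝ} (htop : ∀ x, f x ≠ ⊤) (heven : ∀ x, f (-x) = f x) :
    surface f (d + 1) t ∩ regular f (d + 1) ∩ {x | x (Fin.last d) < 0} =
      (fun y => append y (-1 * finv f ((d + 1 : ℕ) * t - Rr f y))) ''
        {y ∈ regular f d | Rr f y < (d + 1 : ℕ) * t} := by
  have hev : ∀ z, fin f (-z) = fin f z := fun z => by simp [fin, heven]
  ext x
  constructor
  · rintro ⟨⟨hx, hr⟩, hl⟩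
    have hl' : 0 < -x (Fin.last d) := by have : x (Fin.last d) < 0 := hl; linarith
    obtain ⟨h1, h2⟩ := mem_surface_iff.1 hx
    rw [← append_proj x, Rr_append, ← hev] at h2
    have hfl := hf.fin_pos hl'
    refine ⟨proj (d + 1) d x, ⟨fun i => ?_, by linarith⟩, ?_⟩
    · rw [proj_apply (Nat.le_succ d)]; exact hr _
    · simp only
      rw [neg_one_mul, ← h2, add_sub_cancel_left, hf.finv_fin hl', neg_neg, append_proj]
  · rintro ⟨y, ⟨hy, hyr⟩, rfl⟩
    have hu : 0 < ((d + 1 : ℕ) * t - Rr f y) := sub_pos.2 hyr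
    have hp := hf.finv_pos hu
    refine ⟨⟨mem_surface_iff.2 ⟨fun _ => htop _, ?_⟩, ?_⟩, ?_⟩
    · rw [Rr_append, neg_one_mul, hev, hf.fin_finv hu]; ring
    · exact forall_append (P := fun z => z ≠ 0 ∧ f z ≠ ⊤).2
        ⟨hy, by rw [neg_one_mul]; exact ⟨neg_ne_zero.2 hp.ne', htop _⟩⟩
    · show append y _ (Fin.last d) < 0
      rw [append_last, neg_one_mul]; linarith

theorem jacobian_ae_eq {d : ℕ} {t : ℝ} (ht : 0 < t) :
    jacobian f (d + 1) t =ᵐ[surfaceVolume f (d + 1) t] fun v => ‖grad f v‖⁻¹ := by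
  unfold surfaceVolume
  have h1 : ∀ᵐ v ∂(μHE[d]).restrict (surface f (d + 1) t), v ∈ surface f (d + 1) t :=
    ae_restrict_mem (hf.measurableSet_surface _ _)
  have h2 : ∀ᵐ v ∂(μHE[d]).restrict (surface f (d + 1) t),
      v ∉ surface f (d + 1) t \ regular f (d + 1) :=
    ae_restrict_of_ae (measure_eq_zero_iff_ae_notMem.1 (hf.surface_diff_regular_null ht))
  filter_upwards [h1, h2] with v hv hv'
  have hr : v ∈ regular f (d + 1) := by
    by_contra hr; exact hv' ⟨hv, hr⟩
  exact hf.jacobian_eq (Nat.succ_pos d) hr (mem_surface_iff.1 hv).2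

theorem lintegral_surface {d : ℕ} {t : ℝ} (ht : 0 < t)
    {φ : EuclideanSpace ℝ (Fin d) → ℝ≥0∞} (hφ : Measurable φ) :
    ∫⁻ v, φ (proj (d + 1) d v) * ENNReal.ofReal (jacobian f (d + 1) t v)
        ∂surfaceVolume f (d + 1) t =
      ENNReal.ofReal (mult f) * ∫⁻ y in {y ∈ regular f d | Rr f y < (d + 1 : ℕ) * t},
        φ y * ENNReal.ofReal (deriv (fin f) (finv f ((d + 1 : ℕ) * t - Rr f y)))⁻¹ := by
  have h1 : ∫⁻ v, φ (proj (d + 1) d v) * ENNReal.ofReal (jacobian f (d + 1) t v)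
        ∂surfaceVolume f (d + 1) t =
      ∫⁻ v, φ (proj (d + 1) d v) * ENNReal.ofReal ‖grad f v‖⁻¹ ∂surfaceVolume f (d + 1) t := by
    refine lintegral_congr_ae ?_
    filter_upwards [hf.jacobian_ae_eq ht] with v hv
    rw [hv]
  set Φ : EuclideanSpace ℝ (Fin (d + 1)) → ℝ≥0∞ :=
    fun v => φ (proj (d + 1) d v) * ENNReal.ofReal ‖grad f v‖⁻¹ with hΦ
  rw [h1]
  unfold surfaceVolume
  simp only [Nat.add_sub_cancel]
  set P := surface f (d + 1) t ∩ regular f (d + 1) ∩ {x | 0 < x (Fin.last d)} with hP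
  set N := surface f (d + 1) t ∩ regular f (d + 1) ∩ {x | x (Fin.last d) < 0} with hN
  -- Regular points have a nonzero last coordinate, so up to a null set the surface is the union of
  -- the sheets `N` and `P`.
  have hae : (surface f (d + 1) t : Set _) =ᵐ[μHE[d]] (N ∪ P : Set _) := by
    have hU : N ∪ P = surface f (d + 1) t ∩ regular f (d + 1) := by
      rw [hN, hP, ← Set.inter_union_distrib_left]
      refine Set.inter_eq_left.2 fun x hx => ?_
      exact lt_or_gt_of_ne (hx.2 (Fin.last d)).1
    rw [hU]
    have := ae_eq_set (μ := μHE[d]) (s := surface f (d + 1) t)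
      (t := surface f (d + 1) t ∩ regular f (d + 1))
    rw [this]
    exact ⟨by rw [Set.sdiff_self_inter]; exact hf.surface_diff_regular_null ht,
      by rw [Set.sdiff_eq_empty.2 Set.inter_subset_left, measure_empty]⟩
  have hPm : MeasurableSet P := ((hf.measurableSet_surface _ _).inter
    (hf.isOpen_regular _).measurableSet).inter
      (measurableSet_lt measurable_const (by fun_prop))
  have hdisj : Disjoint N P := Set.disjoint_left.2 fun x hx hx' =>
    lt_asymm (show x (Fin.last d) < 0 from hx.2) (show 0 < x (Fin.last d) from hx'.2)
  rw [setLIntegral_congr hae, lintegral_union hPm hdisj]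
  have hPI : ∫⁻ v in P, Φ v ∂μHE[d] = ∫⁻ y in {y ∈ regular f d | Rr f y < (d + 1 : ℕ) * t},
      φ y * ENNReal.ofReal (deriv (fin f) (finv f ((d + 1 : ℕ) * t - Rr f y)))⁻¹ := by
    rw [hP, hf.surface_inter_pos]
    exact hf.setLIntegral_sheet (Or.inl rfl)
      (fun u hu => by rw [one_mul]; exact hf.finite_of_pos _ (hf.finv_pos hu)) hφ
  rcases hf.sides' with ⟨h, hm⟩ | ⟨h, h', hm⟩
  · have hNe : N = ∅ := by
      ext x
      refine ⟨fun hx => ?_, fun hx => hx.elim⟩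
      exact (hx.1.2 (Fin.last d)).2 (h _ hx.2)
    rw [hNe, hm, hPI]; simp
  · have hNI : ∫⁻ v in N, Φ v ∂μHE[d] = ∫⁻ y in {y ∈ regular f d | Rr f y < (d + 1 : ℕ) * t},
        φ y * ENNReal.ofReal (deriv (fin f) (finv f ((d + 1 : ℕ) * t - Rr f y)))⁻¹ := by
      rw [hN, hf.surface_inter_neg h' h]
      exact hf.setLIntegral_sheet (Or.inr rfl) (fun u _ => h' _) hφ
    rw [hNI, hm, hPI, ← two_mul]
    norm_num

end MemF

end EnsembleProjection

/-! ### Convolution powers of a density -/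

/-- The `(m + 1)`-fold convolution power of a density on the real line, defined pointwise. -/
def convPow (ρ : ℝ → ℝ≥0∞) : ℕ → ℝ → ℝ≥0∞
  | 0 => ρ
  | m + 1 => fun u => ∫⁻ v, convPow ρ m (u - v) * ρ v

theorem measurable_convPow {ρ : ℝ → ℝ≥0∞} (hρ : Measurable ρ) (m : ℕ) :
    Measurable (convPow ρ m) := by
  induction m with
  | zero => exact hρ
  | succ m ih =>
    unfold convPow
    exact Measurable.lintegral_prod_right'
      (f := fun p : ℝ × ℝ => convPow ρ m (p.1 - p.2) * ρ p.2) (by fun_prop)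

theorem lintegral_mul_convPow_succ {ρ : ℝ → ℝ≥0∞} (hρ : Measurable ρ) (m : ℕ) {ψ : ℝ → ℝ≥0∞}
    (hψ : Measurable ψ) : ∫⁻ u, ψ u * convPow ρ (m + 1) u =
      ∫⁻ v, (∫⁻ u, ψ (v + u) * ρ u) * convPow ρ m v := by
  have hm := measurable_convPow hρ m
  calc ∫⁻ u, ψ u * convPow ρ (m + 1) u
      = ∫⁻ u, ∫⁻ v, ψ u * (convPow ρ m (u - v) * ρ v) := by
        refine lintegral_congr fun u => ?_
        rw [convPow, lintegral_const_mul _ (by fun_prop)]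
    _ = ∫⁻ v, ∫⁻ u, ψ u * (convPow ρ m (u - v) * ρ v) :=
        lintegral_lintegral_swap (Measurable.aemeasurable (by fun_prop))
    _ = ∫⁻ v, ∫⁻ u, ψ (u + v) * (convPow ρ m u * ρ v) := by
        refine lintegral_congr fun v => ?_
        have := lintegral_add_right_eq_self (μ := (volume : Measure ℝ))
          (fun u => ψ u * (convPow ρ m (u - v) * ρ v)) v
        rw [← this]
        simp
    _ = ∫⁻ u, ∫⁻ v, ψ (u + v) * (convPow ρ m u * ρ v) :=
        lintegral_lintegral_swap (Measurable.aemeasurable (by fun_prop))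
    _ = _ := by
        refine lintegral_congr fun u => ?_
        rw [← lintegral_mul_const _ (by fun_prop)]
        exact lintegral_congr fun v => by ring

theorem lintegral_convPow {ρ : ℝ → ℝ≥0∞} (hρ : Measurable ρ) (h1 : ∫⁻ u, ρ u = 1) (m : ℕ) :
    ∫⁻ u, convPow ρ m u = 1 := by
  induction m with
  | zero => exact h1
  | succ m ih =>
    have := lintegral_mul_convPow_succ hρ m (ψ := fun _ => 1) measurable_const
    simpa [h1, ih] using this

namespace EnsembleProjection

variable {f : ℝ → WithTop ℝ}

/-! ### Marginals of the Gibbs measure and of the surface measure -/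

theorem gibbs_append {d : ℕ} (c : ℝ) (y : EuclideanSpace ℝ (Fin d)) (z : ℝ) :
    gibbs f (d + 1) c (append y z) = gibbs f d c y * (expNeg c (f z) / Z f c) := by
  have : R f (append y z) = R f y + f z := by simp [R, Fin.sum_univ_castSucc]
  rw [gibbs, this, expNeg_add, gibbs, pow_succ]
  ring

theorem volume_euclideanSpace_zero :
    (volume : Measure (EuclideanSpace ℝ (Fin 0))) Set.univ = 1 := by
  rw [← (PiLp.volume_preserving_toLp (Fin 0)).measure_preimage MeasurableSet.univ.nullMeasurableSet]
  simp [volume_pi]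

theorem gibbs_zero (c : ℝ) (y : EuclideanSpace ℝ (Fin 0)) : gibbs f 0 c y = 1 := by
  simp only [gibbs, R, Finset.univ_eq_empty, Finset.sum_empty, pow_zero, div_one]
  exact (expNeg_coe c 0).trans (by simp)

theorem lintegral_gibbsLaw_zero (c : ℝ) (Φ : EuclideanSpace ℝ (Fin 0) → ℝ≥0∞) :
    ∫⁻ y, Φ y ∂gibbsLaw f 0 c = Φ 0 := by
  have h1 : gibbsLaw f 0 c = volume := by
    simp only [gibbsLaw, gibbs_zero, ENNReal.ofReal_one]
    exact withDensity_one
  have h2 : Φ = fun _ => Φ 0 := by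
    ext y; rw [Subsingleton.elim y 0]
  rw [h1, h2, lintegral_const, volume_euclideanSpace_zero, mul_one]

theorem volume_exists_eq_zero (d : ℕ) :
    volume {y : EuclideanSpace ℝ (Fin d) | ∃ i, y i = 0} = 0 := by
  have : {y : EuclideanSpace ℝ (Fin d) | ∃ i, y i = 0} =
      ⋃ i, WithLp.ofLp ⁻¹' ((fun y : Fin d → ℝ => y i) ⁻¹' {0}) := by
    ext y; simp
  rw [this]
  refine measure_iUnion_null fun i => ?_
  have h := (PiLp.volume_preserving_ofLp (Fin d)).quasiMeasurePreserving
  refine h.preimage_null ?_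
  exact (Measure.quasiMeasurePreserving_eval (μ := fun _ : Fin d => (volume : Measure ℝ))
    i).preimage_null (by simp)

namespace MemF

variable (hf : MemF f)
include hf

theorem gibbs_nonneg {c : ℝ} (hc : 0 < c) {n : ℕ} (x : EuclideanSpace ℝ (Fin n)) :
    0 ≤ gibbs f n c x :=
  div_nonneg (expNeg_nonneg _ _) (pow_nonneg (hf.Z_pos hc).le _)

omit hf in
theorem gibbs_eq_prod {c : ℝ} {n : ℕ} (x : EuclideanSpace ℝ (Fin n)) :
    gibbs f n c x = ∏ i, (expNeg c (f (x i)) / Z f c) := by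
  induction n with
  | zero => simp [gibbs_zero]
  | succ n ih =>
    rw [← append_proj x, gibbs_append, ih, Fin.prod_univ_castSucc]
    simp

theorem measurable_gibbs {c : ℝ} {n : ℕ} : Measurable (gibbs f n c) := by
  have : gibbs f n c = fun x => ∏ i, (expNeg c (f (x i)) / Z f c) := by
    ext x; exact gibbs_eq_prod x
  rw [this]
  exact Finset.measurable_prod _ fun i _ =>
    ((hf.measurable_expNeg c).comp (by fun_prop)).div_const _

theorem lintegral_gibbsLaw {c : ℝ} {n : ℕ} (F : EuclideanSpace ℝ (Fin n) → ℝ≥0∞)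
    (hF : Measurable F) :
    ∫⁻ x, F x ∂gibbsLaw f n c = ∫⁻ x, F x * ENNReal.ofReal (gibbs f n c x) := by
  rw [gibbsLaw, lintegral_withDensity_eq_lintegral_mul _ hf.measurable_gibbs.ennreal_ofReal hF]
  simp only [Pi.mul_apply, mul_comm]

/-- The last particle is independent of the others and enters the integrand only through its energy,
so integrating it out leaves an integral against `dens`. Iterating this produces the convolution
powers. -/
theorem lintegral_gibbsLaw_succ {c : ℝ} (hc : 0 < c) {k : ℕ}
    {Φ : EuclideanSpace ℝ (Fin k) → ℝ≥0∞} (hΦ : Measurable Φ) {ψ : ℝ → ℝ≥0∞} (hψ : Measurable ψ) :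
    ∫⁻ x, Φ (proj (k + 1) k x) * ψ (Rr f x) ∂gibbsLaw f (k + 1) c =
      ∫⁻ y, Φ y * (∫⁻ u, ψ (Rr f y + u) * ENNReal.ofReal (dens f c u)) ∂gibbsLaw f k c := by
  have hR := hf.measurable_Rr (n := k)
  have hR' := hf.measurable_Rr (n := k + 1)
  have hd := hf.measurable_dens hc
  have hp := measurable_proj (k + 1) k
  have hg := hf.measurable_gibbs (c := c) (n := k + 1)
  rw [hf.lintegral_gibbsLaw _ (by fun_prop), hf.lintegral_gibbsLaw, lintegral_append (by fun_prop)]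
  · refine lintegral_congr fun y => ?_
    simp only [proj_append, Rr_append, gibbs_append]
    rw [← hf.lintegral_comp_fin hc fun u => ψ (Rr f y + u), mul_right_comm,
      ← lintegral_const_mul]
    · refine lintegral_congr fun z => ?_
      rw [ENNReal.ofReal_mul (hf.gibbs_nonneg hc y)]
      ring
    · have := hf.measurable_fin
      have := hf.measurable_expNeg c
      fun_prop
  · refine hΦ.mul (Measurable.lintegral_prod_right'
      (f := fun p : EuclideanSpace ℝ (Fin k) × ℝ =>
        ψ (Rr f p.1 + p.2) * ENNReal.ofReal (dens f c p.2)) (by fun_prop))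

theorem isProbabilityMeasure_gibbsLaw {c : ℝ} (hc : 0 < c) (k : ℕ) :
    IsProbabilityMeasure (gibbsLaw f k c) := by
  constructor
  induction k with
  | zero =>
    have := lintegral_gibbsLaw_zero (f := f) c fun _ => 1
    simpa using this
  | succ k ih =>
    have := hf.lintegral_gibbsLaw_succ hc (k := k) (Φ := fun _ => 1) (ψ := fun _ => 1)
      measurable_const measurable_const
    simp only [mul_one, one_mul, hf.lintegral_dens hc, lintegral_const] at this
    rw [this, ih]

theorem lintegral_gibbsLaw_comp_Rr {c : ℝ} (hc : 0 < c) (k : ℕ) {ψ : ℝ → ℝ≥0∞}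
    (hψ : Measurable ψ) : ∫⁻ x, ψ (Rr f x) ∂gibbsLaw f (k + 1) c =
      ∫⁻ u, ψ u * convPow (fun u => ENNReal.ofReal (dens f c u)) k u := by
  have hd : Measurable fun u => ENNReal.ofReal (dens f c u) :=
    (hf.measurable_dens hc).ennreal_ofReal
  induction k generalizing ψ with
  | zero =>
    have := hf.lintegral_gibbsLaw_succ hc (k := 0) (Φ := fun _ => 1) measurable_const hψ
    simp only [one_mul] at this
    rw [this, lintegral_gibbsLaw_zero]
    simp [Rr, convPow]
  | succ k ih =>
    have := hf.lintegral_gibbsLaw_succ hc (k := k + 1) (Φ := fun _ => 1) measurable_const hψ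
    simp only [one_mul] at this
    rw [this, ih (ψ := fun v => ∫⁻ u, ψ (v + u) * ENNReal.ofReal (dens f c u)),
      lintegral_mul_convPow_succ hd k hψ]
    have hd' := hf.measurable_dens hc
    exact Measurable.lintegral_prod_right'
      (f := fun p : ℝ × ℝ => ψ (p.1 + p.2) * ENNReal.ofReal (dens f c p.2)) (by fun_prop)

/-- Because `e^{-cR}` is constant on the surface, Gibbs weights can be inserted at the price of the
factor `e^{c(d+1)t}`. The weight `1 / f'` of the last coordinate then becomes `dens` at the
remaining energy. -/
theorem lintegral_surface_gibbs {c : ℝ} (hc : 0 < c) {d : ℕ} {t : ℝ} (ht : 0 < t)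
    {φ : EuclideanSpace ℝ (Fin d) → ℝ≥0∞} (hφ : Measurable φ) :
    ∫⁻ v, φ (proj (d + 1) d v) * ENNReal.ofReal (jacobian f (d + 1) t v)
        ∂surfaceVolume f (d + 1) t =
      ENNReal.ofReal (Z f c ^ (d + 1) * Real.exp (c * ((d + 1 : ℕ) * t))) *
        ∫⁻ y, φ y * ENNReal.ofReal (dens f c ((d + 1 : ℕ) * t - Rr f y)) ∂gibbsLaw f d c := by
  have hZ := hf.Z_pos hc
  have hm := hf.mult_pos
  have hR := hf.measurable_Rr (n := d)
  have hd := hf.measurable_dens hc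
  have hg := hf.measurable_gibbs (c := c) (n := d)
  rw [hf.lintegral_surface ht hφ, hf.lintegral_gibbsLaw _ (by fun_prop),
    ← lintegral_const_mul' _ _ ENNReal.ofReal_ne_top,
    ← lintegral_const_mul' _ _ ENNReal.ofReal_ne_top,
    ← lintegral_indicator (hf.isOpen_sublevel d _).measurableSet]
  refine lintegral_congr_ae ?_
  have hnull := measure_eq_zero_iff_ae_notMem.1 (volume_exists_eq_zero d)
  filter_upwards [hnull] with y hy
  have hy0 : ∀ i, y i ≠ 0 := fun i h => hy ⟨i, h⟩
  by_cases hyO : y ∈ {y ∈ regular f d | Rr f y < (d + 1 : ℕ) * t}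
  · rw [Set.indicator_of_mem hyO]
    have hu : 0 < (d + 1 : ℕ) * t - Rr f y := sub_pos.2 hyO.2
    have hδ := hf.deriv_pos _ (hf.finv_pos hu)
    rw [dens, if_pos hu, gibbs, R_eq_coe fun i => (hyO.1 i).2, expNeg_coe]
    have hr : mult f * (deriv (fin f) (finv f ((d + 1 : ℕ) * t - Rr f y)))⁻¹ =
        Z f c ^ (d + 1) * Real.exp (c * ((d + 1 : ℕ) * t)) *
        (mult f * Real.exp (-c * ((d + 1 : ℕ) * t - Rr f y)) /
          (Z f c * deriv (fin f) (finv f ((d + 1 : ℕ) * t - Rr f y))) *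
          (Real.exp (-c * Rr f y) / Z f c ^ d)) := by
      have he : Real.exp (c * ((d + 1 : ℕ) * t)) * Real.exp (-c * ((d + 1 : ℕ) * t - Rr f y)) *
          Real.exp (-c * Rr f y) = 1 := by
        rw [← Real.exp_add, ← Real.exp_add, ← Real.exp_zero]; congr 1; ring
      have : Z f c ^ (d + 1) * Real.exp (c * ((d + 1 : ℕ) * t)) *
        (mult f * Real.exp (-c * ((d + 1 : ℕ) * t - Rr f y)) /
          (Z f c * deriv (fin f) (finv f ((d + 1 : ℕ) * t - Rr f y))) *
          (Real.exp (-c * Rr f y) / Z f c ^ d)) =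
          (Real.exp (c * ((d + 1 : ℕ) * t)) * Real.exp (-c * ((d + 1 : ℕ) * t - Rr f y)) *
          Real.exp (-c * Rr f y)) *
            (mult f * (deriv (fin f) (finv f ((d + 1 : ℕ) * t - Rr f y)))⁻¹) := by
        rw [pow_succ]
        field_simp
      rw [this, he, one_mul]
    have h1 := congrArg ENNReal.ofReal hr
    rw [ENNReal.ofReal_mul hm.le, ENNReal.ofReal_mul (p := Z f c ^ (d + 1) * _) (by positivity),
      ENNReal.ofReal_mul (q := Real.exp (-c * Rr f y) / Z f c ^ d) (by positivity)] at h1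
    rw [mul_left_comm, h1, mul_left_comm, mul_assoc (φ y)]
  · rw [Set.indicator_of_notMem hyO]
    symm
    by_cases hfin : ∀ i, f (y i) ≠ ⊤
    · have hle : (d + 1 : ℕ) * t - Rr f y ≤ 0 := by
        by_contra hlt
        exact hyO ⟨fun i => ⟨hy0 i, hfin i⟩, by linarith⟩
      rw [dens_of_nonpos hle]; simp
    · have : R f y = ⊤ := by
        by_contra h; exact hfin (R_ne_top_iff.1 h)
      rw [gibbs, this]; simp

/-- The marginals of the unnormalised surface measure, relative to the Gibbs measure. -/
theorem lintegral_surface_proj {c : ℝ} (hc : 0 < c) {t : ℝ} (ht : 0 < t) (k m : ℕ)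
    {φ : EuclideanSpace ℝ (Fin k) → ℝ≥0∞} (hφ : Measurable φ) :
    ∫⁻ v, φ (proj (k + m + 1) k v) * ENNReal.ofReal (jacobian f (k + m + 1) t v)
        ∂surfaceVolume f (k + m + 1) t =
      ENNReal.ofReal (Z f c ^ (k + m + 1) * Real.exp (c * ((k + m + 1 : ℕ) * t))) *
        ∫⁻ y, φ y * convPow (fun u => ENNReal.ofReal (dens f c u)) m
          ((k + m + 1 : ℕ) * t - Rr f y) ∂gibbsLaw f k c := by
  have hd : Measurable fun u => ENNReal.ofReal (dens f c u) :=
    (hf.measurable_dens hc).ennreal_ofReal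
  induction m generalizing k with
  | zero => exact hf.lintegral_surface_gibbs hc ht hφ
  | succ m ih =>
    -- The surface stays fixed: the induction hypothesis is used for the first `k + 1` coordinates,
    -- and the last of these is then integrated out under the Gibbs law, which adds one convolution
    -- factor.
    have e : k + (m + 1) + 1 = k + 1 + m + 1 := by ring
    rw [e]
    have h1 := ih (k + 1) (φ := fun x => φ (proj (k + 1) k x)) (hφ.comp (measurable_proj _ _))
    have h2 : ∀ v, proj (k + 1) k (proj (k + 1 + m + 1) (k + 1) v) = proj (k + 1 + m + 1) k v :=
      fun v => proj_proj (Nat.le_succ k) (by omega) v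
    simp only [h2] at h1
    rw [h1]
    congr 1
    have hm := measurable_convPow hd m
    rw [hf.lintegral_gibbsLaw_succ hc hφ
      (ψ := fun r => convPow (fun u => ENNReal.ofReal (dens f c u)) m
        ((k + 1 + m + 1 : ℕ) * t - r)) (by fun_prop)]
    simp only [convPow, sub_sub]

theorem lintegral_jacobian {c : ℝ} (hc : 0 < c) {t : ℝ} (ht : 0 < t) (d : ℕ) :
    ∫⁻ v, ENNReal.ofReal (jacobian f (d + 1) t v) ∂surfaceVolume f (d + 1) t =
      ENNReal.ofReal (Z f c ^ (d + 1) * Real.exp (c * ((d + 1 : ℕ) * t))) *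
        convPow (fun u => ENNReal.ofReal (dens f c u)) d ((d + 1 : ℕ) * t) := by
  have h := hf.lintegral_surface_proj hc ht 0 d (φ := fun _ => 1) measurable_const
  rw [lintegral_gibbsLaw_zero] at h
  simp only [one_mul, Rr, Finset.univ_eq_empty, Finset.sum_empty, sub_zero] at h
  rwa [zero_add] at h

end MemF

end EnsembleProjection

/-! ### Powers of characteristic functions -/

theorem norm_pow_sub_pow_le_mul {a b : ℂ} {r : ℝ} (ha : ‖a‖ ≤ r) (hb : ‖b‖ ≤ r) (m : ℕ) :
    ‖a ^ m - b ^ m‖ ≤ m * r ^ (m - 1) * ‖a - b‖ := by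
  have hr : 0 ≤ r := (norm_nonneg a).trans ha
  rw [← geom_sum₂_mul, norm_mul]
  gcongr
  refine (norm_sum_le _ _).trans ?_
  calc ∑ i ∈ Finset.range m, ‖a ^ i * b ^ (m - 1 - i)‖
      ≤ ∑ i ∈ Finset.range m, r ^ (m - 1) := by
        refine Finset.sum_le_sum fun i hi => ?_
        rw [norm_mul, norm_pow, norm_pow]
        have : i + (m - 1 - i) = m - 1 := by
          have := Finset.mem_range.1 hi; omega
        rw [← this, pow_add]
        have e : i + (m - 1 - i) - i = m - 1 - i := by omega
        rw [e]
        gcongr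
    _ = m * r ^ (m - 1) := by simp

theorem integrable_abs_pow_three_mul_gaussian {b : ℝ} (hb : 0 < b) :
    Integrable fun x : ℝ => |x| ^ 3 * Real.exp (-b * x ^ 2) := by
  have h := (integrable_rpow_mul_exp_neg_mul_sq hb (s := 3) (by norm_num)).norm
  refine h.congr (ae_of_all _ fun x => ?_)
  simp only [norm_mul, Real.norm_eq_abs, Real.abs_exp]
  congr 1
  have : x ^ (3 : ℝ) = x ^ 3 := by exact_mod_cast Real.rpow_natCast x 3
  rw [this, abs_pow]

/-- Scaling by `√m`. The factor `m⁻²`, against the `m` from differentiating an `m`-th power, yields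
the rate `1/m` of the local limit theorem. -/
theorem integral_abs_pow_three_mul_gaussian (b : ℝ) {m : ℕ} (hm : 0 < m) :
    ∫ x : ℝ, |x| ^ 3 * Real.exp (-(m * b) * x ^ 2) =
      ((m : ℝ) ^ 2)⁻¹ * ∫ x : ℝ, |x| ^ 3 * Real.exp (-b * x ^ 2) := by
  have hm' : (0 : ℝ) < m := by exact_mod_cast hm
  set s := Real.sqrt m with hs
  have hs0 : 0 < s := Real.sqrt_pos.2 hm'
  have hs2 : s ^ 2 = m := Real.sq_sqrt hm'.le
  have h := Measure.integral_comp_mul_left (fun x : ℝ => |x| ^ 3 * Real.exp (-b * x ^ 2)) s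
  rw [abs_of_pos (inv_pos.2 hs0), smul_eq_mul] at h
  have h2 : ∀ x : ℝ, |s * x| ^ 3 * Real.exp (-b * (s * x) ^ 2) =
      s ^ 3 * (|x| ^ 3 * Real.exp (-(m * b) * x ^ 2)) := by
    intro x
    rw [abs_mul, abs_of_pos hs0, mul_pow, mul_pow, hs2]
    ring_nf
  simp only [h2] at h
  rw [integral_const_mul] at h
  have : ((m : ℝ) ^ 2)⁻¹ = (s ^ 3)⁻¹ * s⁻¹ := by
    rw [← hs2]; field_simp
  rw [this, mul_assoc, ← h]
  field_simp

theorem exists_mul_pow_le {q : ℝ} (hq0 : 0 ≤ q) (hq : q < 1) :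
    ∃ B, 0 < B ∧ ∀ m : ℕ, (m : ℝ) * q ^ m ≤ B := by
  obtain ⟨B, hB⟩ := (tendsto_self_mul_const_pow_of_lt_one hq0 hq).bddAbove_range
  refine ⟨max B 1, by positivity, fun m => ?_⟩
  exact (hB ⟨m, rfl⟩).trans (le_max_left _ _)

/-- If `θ` is a bounded continuous function with a third order expansion `1 - α w² + O(|w|³)` at
the origin, bounded away from `1` in modulus elsewhere, and some power of which is integrable, then
the powers of `θ` are close in `L¹` to Gaussians. -/
theorem exists_integral_norm_pow_sub_gaussian_le {θ : ℝ → ℂ} (hcont : Continuous θ)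
    (h1 : ∀ w, ‖θ w‖ ≤ 1) {α K : ℝ} (hα : 0 < α) (hK : 0 < K)
    (h3 : ∀ w, ‖θ w - ((1 - α * w ^ 2 : ℝ) : ℂ)‖ ≤ K * |w| ^ 3)
    (hη : ∀ δ, 0 < δ → ∃ η < 1, ∀ w, δ ≤ |w| → ‖θ w‖ ≤ η) {N : ℕ}
    (hN : Integrable fun w => ‖θ w‖ ^ N) :
    ∃ E, 0 < E ∧ ∀ m : ℕ, N + 2 ≤ m → Integrable (fun w => θ w ^ m) ∧
      ∫ w, ‖θ w ^ m - (Real.exp (-(m * α) * w ^ 2) : ℂ)‖ ≤ E / m := by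
  -- Below `δ` three things hold: `|w| ≤ 1`, so that `|w|⁴ ≤ |w|³`; the cubic error is at most half
  -- of `α w²`; and `α w² ≤ 1`, so that the quadratic expansion of the exponential applies.
  set δ : ℝ := min 1 (min (α / (2 * K)) (1 / α)) with hδ
  have hδ0 : 0 < δ := by positivity
  have hδ1 : δ ≤ 1 := min_le_left _ _
  have hδK : δ ≤ α / (2 * K) := (min_le_right _ _).trans (min_le_left _ _)
  have hδα : δ ≤ 1 / α := (min_le_right _ _).trans (min_le_right _ _)
  obtain ⟨η₀, hη₀1, hη₀⟩ := hη δ hδ0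
  -- The maximum keeps `η` positive, since `η ^ N` is divided by later.
  set η := max η₀ (1 / 2) with hηdef
  have hη1 : η < 1 := max_lt hη₀1 (by norm_num)
  have hη0 : 0 < η := lt_of_lt_of_le (by norm_num) (le_max_right _ _)
  have hηw : ∀ w, δ ≤ |w| → ‖θ w‖ ≤ η := fun w hw => (hη₀ w hw).trans (le_max_left _ _)
  set q := Real.exp (-(α * δ ^ 2)) with hq
  have hq0 : 0 < q := Real.exp_pos _
  have hq1 : q < 1 := by rw [hq, Real.exp_lt_one_iff]; simp; positivity
  obtain ⟨B₁, hB₁, hB₁'⟩ := exists_mul_pow_le hη0.le hη1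
  obtain ⟨B₂, hB₂, hB₂'⟩ := exists_mul_pow_le hq0.le hq1
  set I₃ := ∫ x : ℝ, |x| ^ 3 * Real.exp (-(α / 4) * x ^ 2) with hI₃
  set IN := ∫ w, ‖θ w‖ ^ N with hIN
  set IG := ∫ w : ℝ, Real.exp (-α * w ^ 2) with hIG
  have hI₃0 : 0 ≤ I₃ := integral_nonneg fun x => by positivity
  have hIN0 : 0 ≤ IN := integral_nonneg fun x => by positivity
  have hIG0 : 0 ≤ IG := integral_nonneg fun x => by positivity
  refine ⟨(K + α ^ 2) * I₃ + B₁ / η ^ N * IN + B₂ / q * IG + 1, by positivity, fun m hm => ?_⟩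
  have hm0 : 0 < m := by omega
  have hm' : (0 : ℝ) < m := by exact_mod_cast hm0
  have hm2 : (2 : ℝ) ≤ m := by exact_mod_cast (by omega : 2 ≤ m)
  have hint : Integrable fun w => θ w ^ m := by
    refine hN.mono (hcont.pow m).aestronglyMeasurable (ae_of_all _ fun w => ?_)
    rw [norm_pow, norm_pow, norm_norm]
    exact pow_le_pow_of_le_one (norm_nonneg _) (h1 w) (by omega)
  refine ⟨hint, ?_⟩
  have hgint : Integrable fun w : ℝ => Real.exp (-α * w ^ 2) := integrable_exp_neg_mul_sq hα
  have h3int := integrable_abs_pow_three_mul_gaussian (b := m * (α / 4)) (by positivity)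
  -- The first summand dominates for `|w| < δ`, the other two for `|w| ≥ δ`. There `N` factors of
  -- `θ`, or one factor of the Gaussian, are kept for integrability and the rest decay geometrically
  -- in `m`.
  set bound : ℝ → ℝ := fun w => m * (K + α ^ 2) * (|w| ^ 3 * Real.exp (-(m * (α / 4)) * w ^ 2)) +
    (η ^ (m - N) * ‖θ w‖ ^ N + q ^ (m - 1) * Real.exp (-α * w ^ 2)) with hbound
  have hbint : Integrable bound :=
    (h3int.const_mul _).add ((hN.const_mul _).add (hgint.const_mul _))
  have hpt : ∀ w, ‖θ w ^ m - (Real.exp (-(m * α) * w ^ 2) : ℂ)‖ ≤ bound w := by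
    intro w
    have hexp : (Real.exp (-(m * α) * w ^ 2) : ℂ) = (Real.exp (-α * w ^ 2) : ℂ) ^ m := by
      rw [← Complex.ofReal_pow, ← Real.exp_nat_mul]
      congr 2; ring
    rcases lt_or_ge |w| δ with hw | hw
    · have hx0 : 0 ≤ α * w ^ 2 := by positivity
      have hw1 : |w| ≤ 1 := hw.le.trans hδ1
      have hw2 : w ^ 2 ≤ |w| := by
        rw [← sq_abs]; nlinarith [abs_nonneg w]
      have hx1 : α * w ^ 2 ≤ 1 := by
        have : |w| ≤ 1 / α := hw.le.trans hδα
        rw [le_div_iff₀ hα] at this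
        nlinarith
      have hKw : K * |w| ^ 3 ≤ α / 2 * w ^ 2 := by
        have : |w| ≤ α / (2 * K) := hw.le.trans hδK
        rw [le_div_iff₀ (by positivity)] at this
        have h' : |w| ^ 3 = |w| * w ^ 2 := by rw [← sq_abs w]; ring
        rw [h']
        nlinarith [sq_nonneg w]
      have hθ : ‖θ w‖ ≤ Real.exp (-(α / 2) * w ^ 2) := by
        have h4 : ‖θ w‖ ≤ ‖θ w - ((1 - α * w ^ 2 : ℝ) : ℂ)‖ + ‖((1 - α * w ^ 2 : ℝ) : ℂ)‖ := by
          have := norm_add_le (θ w - ((1 - α * w ^ 2 : ℝ) : ℂ)) ((1 - α * w ^ 2 : ℝ) : ℂ)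
          rwa [sub_add_cancel] at this
        rw [Complex.norm_real, Real.norm_of_nonneg (by linarith)] at h4
        have h5 := Real.add_one_le_exp (-(α / 2) * w ^ 2)
        have h6 := h3 w
        linarith
      have hg : ‖(Real.exp (-α * w ^ 2) : ℂ)‖ ≤ Real.exp (-(α / 2) * w ^ 2) := by
        rw [Complex.norm_real, Real.norm_of_nonneg (Real.exp_pos _).le, Real.exp_le_exp]
        nlinarith
      have hdiff : ‖θ w - (Real.exp (-α * w ^ 2) : ℂ)‖ ≤ (K + α ^ 2) * |w| ^ 3 := by
        have h4 : θ w - (Real.exp (-α * w ^ 2) : ℂ) = (θ w - ((1 - α * w ^ 2 : ℝ) : ℂ)) -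
            ((Real.exp (-α * w ^ 2) - 1 - (-α * w ^ 2) : ℝ) : ℂ) := by
          push_cast; ring
        have h5 : |Real.exp (-α * w ^ 2) - 1 - (-α * w ^ 2)| ≤ (-α * w ^ 2) ^ 2 :=
          Real.abs_exp_sub_one_sub_id_le (by
            rw [neg_mul, abs_neg, abs_of_nonneg hx0]; exact hx1)
        have h6 : (-α * w ^ 2) ^ 2 ≤ α ^ 2 * |w| ^ 3 := by
          have : (-α * w ^ 2) ^ 2 = α ^ 2 * (|w| ^ 3 * |w|) := by
            rw [← sq_abs w]; ring
          rw [this]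
          gcongr
          exact mul_le_of_le_one_right (by positivity) hw1
        rw [h4]
        refine (norm_sub_le _ _).trans ?_
        rw [Complex.norm_real, Real.norm_eq_abs]
        have := h3 w
        linarith
      have h7 := norm_pow_sub_pow_le_mul hθ hg m
      -- This uses `(m - 1) / 2 ≥ m / 4`, that is, `m ≥ 2`.
      have h8 : Real.exp (-(α / 2) * w ^ 2) ^ (m - 1) ≤ Real.exp (-(m * (α / 4)) * w ^ 2) := by
        rw [← Real.exp_nat_mul, Real.exp_le_exp, Nat.cast_sub (by omega)]
        push_cast
        nlinarith
      rw [hexp]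
      calc ‖θ w ^ m - (Real.exp (-α * w ^ 2) : ℂ) ^ m‖
          ≤ m * Real.exp (-(α / 2) * w ^ 2) ^ (m - 1) * ‖θ w - (Real.exp (-α * w ^ 2) : ℂ)‖ := h7
        _ ≤ m * Real.exp (-(m * (α / 4)) * w ^ 2) * ((K + α ^ 2) * |w| ^ 3) := by gcongr
        _ = m * (K + α ^ 2) * (|w| ^ 3 * Real.exp (-(m * (α / 4)) * w ^ 2)) + 0 := by ring
        _ ≤ bound w := add_le_add le_rfl (by positivity)
    · have h4 : ‖θ w ^ m‖ ≤ η ^ (m - N) * ‖θ w‖ ^ N := by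
        rw [norm_pow]
        have : m = (m - N) + N := by omega
        conv_lhs => rw [this, pow_add]
        gcongr
        exact hηw w hw
      have h5 : ‖(Real.exp (-(m * α) * w ^ 2) : ℂ)‖ ≤ q ^ (m - 1) * Real.exp (-α * w ^ 2) := by
        rw [Complex.norm_real, Real.norm_of_nonneg (Real.exp_pos _).le, hq, ← Real.exp_nat_mul,
          ← Real.exp_add, Real.exp_le_exp, Nat.cast_sub (by omega)]
        push_cast
        have h6 : δ ^ 2 ≤ w ^ 2 := by rw [← sq_abs w]; gcongr
        have h7 : 0 ≤ ((m : ℝ) - 1) * α := mul_nonneg (by linarith) hα.le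
        nlinarith
      calc ‖θ w ^ m - (Real.exp (-(m * α) * w ^ 2) : ℂ)‖
          ≤ 0 + (η ^ (m - N) * ‖θ w‖ ^ N + q ^ (m - 1) * Real.exp (-α * w ^ 2)) := by
            rw [zero_add]
            exact (norm_sub_le _ _).trans (add_le_add h4 h5)
        _ ≤ bound w := add_le_add (by positivity) le_rfl
  have hb1 : ∫ w, bound w = m * (K + α ^ 2) * (((m : ℝ) ^ 2)⁻¹ * I₃) +
      (η ^ (m - N) * IN + q ^ (m - 1) * IG) := by
    have hsum : Integrable fun w => η ^ (m - N) * ‖θ w‖ ^ N + q ^ (m - 1) * Real.exp (-α * w ^ 2) :=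
      (hN.const_mul _).add (hgint.const_mul _)
    simp only [hbound]
    rw [integral_add (h3int.const_mul _) hsum,
      integral_add (hN.const_mul _) (hgint.const_mul _), integral_const_mul, integral_const_mul,
      integral_const_mul, integral_abs_pow_three_mul_gaussian _ hm0]
  have hb2 : η ^ (m - N) ≤ B₁ / η ^ N / m := by
    rw [le_div_iff₀ hm', le_div_iff₀ (by positivity)]
    have : η ^ (m - N) * m * η ^ N = m * η ^ m := by
      conv_rhs => rw [show m = (m - N) + N by omega, pow_add]
      have : ((m - N + N : ℕ) : ℝ) = m := by congr 1; omega
      rw [this]; ring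
    rw [this]; exact hB₁' m
  have hb3 : q ^ (m - 1) ≤ B₂ / q / m := by
    rw [le_div_iff₀ hm', le_div_iff₀ (by positivity)]
    have : q ^ (m - 1) * m * q = m * q ^ m := by
      conv_rhs => rw [show m = (m - 1) + 1 by omega, pow_add]
      have : ((m - 1 + 1 : ℕ) : ℝ) = m := by congr 1; omega
      rw [this]; ring
    rw [this]; exact hB₂' m
  calc ∫ w, ‖θ w ^ m - (Real.exp (-(m * α) * w ^ 2) : ℂ)‖ ≤ ∫ w, bound w :=
        integral_mono_of_nonneg (ae_of_all _ fun w => norm_nonneg _) hbint (ae_of_all _ hpt)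
    _ ≤ m * (K + α ^ 2) * (((m : ℝ) ^ 2)⁻¹ * I₃) + (B₁ / η ^ N / m * IN + B₂ / q / m * IG) := by
        rw [hb1]; gcongr
    _ = ((K + α ^ 2) * I₃ + B₁ / η ^ N * IN + B₂ / q * IG) / m := by field_simp; ring
    _ ≤ _ := div_le_div_of_nonneg_right (by linarith) hm'.le

/-! ### Fourier integrals and regularity of convolutions -/

section Fourier

open scoped FourierTransform SchwartzMap ContDiff

/-- The Fourier integral of a function in `L¹ ∩ L²` is square integrable. -/
theorem MeasureTheory.Integrable.memLp_two_fourier {r : ℝ → ℂ} (h1 : Integrable r)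
    (h2 : MemLp r 2) : MemLp (𝓕 r) 2 := by
  have hcont : Continuous (𝓕 r) :=
    VectorFourier.fourierIntegral_continuous Real.continuous_fourierChar
      (by exact continuous_inner) h1
  set F : Lp ℂ 2 (volume : Measure ℝ) := 𝓕 (h2.toLp r) with hF
  -- The Plancherel transform `F` and the Fourier integral agree almost everywhere, because both are
  -- paired with test functions by moving the transform onto the test function.
  have key : ∀ᵐ x, F x = 𝓕 r x := by
    refine ae_eq_of_integral_contDiff_smul_eq ((Lp.memLp F).locallyIntegrable (by norm_num))
      hcont.locallyIntegrable fun g hg hgs => ?_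
    have hg' : ContDiff ℝ ∞ fun x => (g x : ℂ) := Complex.ofRealCLM.contDiff.comp hg
    have hgs' : HasCompactSupport fun x => (g x : ℂ) :=
      hgs.comp_left (g := fun x : ℝ => (x : ℂ)) (by simp)
    set G : 𝓢(ℝ, ℂ) := hgs'.toSchwartzMap hg' with hG
    have hGx : ∀ x, G x = (g x : ℂ) := fun x => rfl
    have h3 : ∫ x, G x • F x = ∫ x, (𝓕 G) x • r x := by
      rw [← Lp.toTemperedDistribution_apply, hF, ← Lp.fourier_toTemperedDistribution_eq,
        TemperedDistribution.fourier_apply, Lp.toTemperedDistribution_apply]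
      refine integral_congr_ae ?_
      filter_upwards [h2.coeFn_toLp] with x hx
      rw [hx]
    have h4 : ∫ x, (𝓕 G) x • r x = ∫ x, G x • 𝓕 r x := by
      simpa using! VectorFourier.integral_fourierIntegral_smul_eq_flip (L := innerₗ ℝ)
        Real.continuous_fourierChar continuous_inner G.integrable h1
    simpa [hGx] using h3.trans h4
  exact (memLp_congr_ae key).1 (Lp.memLp F)

end Fourier

/-- The convolution of a bounded function with an integrable one is continuous. -/
theorem continuous_integral_sub_mul {r p : ℝ → ℝ} (hr : Measurable r) {B : ℝ}
    (hB : ∀ u, |r u| ≤ B) (hp : Integrable p) : Continuous fun u => ∫ v, r (u - v) * p v := by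
  have hB0 : 0 ≤ B := (abs_nonneg _).trans (hB 0)
  have hint : ∀ {h : ℝ → ℝ}, Integrable h → ∀ u, Integrable fun v => r (u - v) * h v := by
    intro h hh u
    refine hh.bdd_mul (c := B) (by exact (hr.comp (measurable_const.sub measurable_id)).aestronglyMeasurable)
      (ae_of_all _ fun v => hB _)
  refine continuous_of_uniform_approx_of_continuous fun s hs => ?_
  obtain ⟨ε, hε, hεs⟩ := Metric.mem_uniformity_dist.1 hs
  -- Replacing `p` by a continuous compactly supported `g` changes the convolution uniformly by at
  -- most `B ‖p - g‖₁`. The `B + 1` in the tolerance avoids division by zero.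
  obtain ⟨g, hgs, hgε, hgc, hgi⟩ := hp.exists_hasCompactSupport_integral_sub_le
    (ε := ε / (2 * (B + 1))) (by positivity)
  refine ⟨fun u => ∫ v, r (u - v) * g v, ?_, fun u => hεs ?_⟩
  · have hloc : LocallyIntegrable r := by
      intro x
      refine ⟨Metric.ball x 1, Metric.ball_mem_nhds _ one_pos, ?_⟩
      exact Measure.integrableOn_of_bounded (M := B) measure_ball_lt_top.ne
        hr.aestronglyMeasurable (ae_of_all _ hB)
    have := hgs.continuous_convolution_right (ContinuousLinearMap.mul ℝ ℝ) hloc hgc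
    convert this using 2 with u
    rw [convolution_def, ← integral_sub_left_eq_self _ _ u]
    simp
  · rw [Real.dist_eq, ← integral_sub (hint hp u) (hint hgi u)]
    calc |∫ v, (r (u - v) * p v - r (u - v) * g v)|
        ≤ ∫ v, B * ‖p v - g v‖ := by
          rw [← Real.norm_eq_abs]
          refine norm_integral_le_of_norm_le (g := fun v => B * ‖p v - g v‖)
            ((hp.sub hgi).norm.const_mul B) (ae_of_all _ fun v => ?_)
          rw [← mul_sub, norm_mul]
          gcongr
          exact hB _
      _ = B * ∫ v, ‖p v - g v‖ := integral_const_mul _ _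
      _ ≤ B * (ε / (2 * (B + 1))) := by gcongr
      _ < ε := by
          rw [← mul_div_assoc, div_lt_iff₀ (by positivity)]
          nlinarith

/-! ### Characteristic functions of convolution powers -/

variable {ρ : ℝ → ℝ≥0∞}

/-- Averaging against a probability density cannot raise a supremum, so once one power is bounded
all later ones are. -/
theorem convPow_le_add (h1 : ∫⁻ u, ρ u = 1) {m : ℕ} {B : ℝ≥0∞} (hB : ∀ u, convPow ρ m u ≤ B)
    (hρ : Measurable ρ) (j : ℕ) (u : ℝ) : convPow ρ (m + j) u ≤ B := by
  induction j generalizing u with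
  | zero => exact hB u
  | succ j ih =>
    calc convPow ρ (m + j + 1) u ≤ ∫⁻ v, B * ρ v := by
          rw [convPow]; exact lintegral_mono fun v => mul_le_mul_left (ih _) _
      _ = B := by rw [lintegral_const_mul _ hρ, h1, mul_one]

/-- Continuity makes Fourier inversion valid at every point, as is needed to evaluate the density at
the single value `nt`. -/
theorem continuous_toReal_convPow_succ (hρ : Measurable ρ) (h1 : ∫⁻ u, ρ u = 1) {m : ℕ} {B : ℝ≥0}
    (hB : ∀ u, convPow ρ m u ≤ B) : Continuous fun u => (convPow ρ (m + 1) u).toReal := by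
  have hp : Integrable fun v => (ρ v).toReal :=
    integrable_toReal_of_lintegral_ne_top hρ.aemeasurable (by simp [h1])
  have hfin : ∀ᵐ v, ρ v < ∞ := ae_lt_top hρ (by simp [h1])
  have hm := measurable_convPow hρ m
  have := continuous_integral_sub_mul (r := fun u => (convPow ρ m u).toReal) (B := B)
    hm.ennreal_toReal (fun u => by
      rw [abs_of_nonneg ENNReal.toReal_nonneg]
      exact ENNReal.toReal_le_coe_of_le_coe (hB u)) hp
  convert this using 2 with u
  simp_rw [← ENNReal.toReal_mul]
  rw [convPow, integral_toReal (by fun_prop)]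
  filter_upwards [hfin] with v hv
  exact ENNReal.mul_lt_top ((hB _).trans_lt ENNReal.coe_lt_top) hv

theorem withDensity_convPow_succ (hρ : Measurable ρ) (m : ℕ) [IsFiniteMeasure (volume.withDensity ρ)] :
    volume.withDensity (convPow ρ (m + 1)) =
      (volume.withDensity (convPow ρ m)) ∗ (volume.withDensity ρ) := by
  have hm := measurable_convPow hρ m
  have hm1 := measurable_convPow hρ (m + 1)
  refine Measure.ext_of_lintegral _ fun ψ hψ => ?_
  rw [Measure.lintegral_conv hψ, lintegral_withDensity_eq_lintegral_mul _ hm1 hψ,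
    lintegral_withDensity_eq_lintegral_mul _ hm (by fun_prop)]
  have := lintegral_mul_convPow_succ hρ m hψ
  simp only [Pi.mul_apply, mul_comm (convPow ρ _ _)]
  rw [this]
  refine lintegral_congr fun v => ?_
  rw [lintegral_withDensity_eq_lintegral_mul _ hρ (by fun_prop)]
  simp [mul_comm]

theorem isProbabilityMeasure_withDensity_convPow (hρ : Measurable ρ) (h1 : ∫⁻ u, ρ u = 1) (m : ℕ) :
    IsProbabilityMeasure (volume.withDensity (convPow ρ m)) :=
  ⟨by rw [withDensity_apply _ .univ, setLIntegral_univ, lintegral_convPow hρ h1 m]⟩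

theorem charFun_withDensity_convPow (hρ : Measurable ρ) (h1 : ∫⁻ u, ρ u = 1) (m : ℕ) (s : ℝ) :
    charFun (volume.withDensity (convPow ρ m)) s =
      charFun (volume.withDensity ρ) s ^ (m + 1) := by
  have : IsProbabilityMeasure (volume.withDensity ρ) := isProbabilityMeasure_withDensity_convPow hρ h1 0
  induction m with
  | zero => simp [convPow]
  | succ m ih =>
    have := isProbabilityMeasure_withDensity_convPow hρ h1 m
    rw [withDensity_convPow_succ hρ, charFun_conv, ih]; ring

open scoped FourierTransform in
theorem fourier_toReal_eq_charFun (hρ : Measurable ρ) (hfin : ∀ᵐ u, ρ u < ∞) (w : ℝ) :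
    𝓕 (fun u => ((ρ u).toReal : ℂ)) w = charFun (volume.withDensity ρ) (-2 * Real.pi * w) := by
  rw [charFun_apply_real, integral_withDensity_eq_integral_toReal_smul hρ hfin,
    Real.fourier_real_eq_integral_exp_smul]
  refine integral_congr_ae (ae_of_all _ fun u => ?_)
  simp only [smul_eq_mul, Complex.real_smul]
  rw [mul_comm]
  congr 2
  push_cast; ring

theorem Complex.norm_exp_mul_I_sub_two_terms_le (x : ℝ) :
    ‖Complex.exp (x * Complex.I) - (1 + x * Complex.I - x ^ 2 / 2)‖ ≤ 4 * |x| ^ 3 := by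
  rcases le_or_gt |x| 1 with hx | hx
  · have h := Complex.exp_bound (x := x * Complex.I) (by simpa using hx) (n := 3) (by norm_num)
    have h2 : ∑ m ∈ Finset.range 3, ((x : ℂ) * Complex.I) ^ m / (m.factorial : ℂ) =
        1 + x * Complex.I - x ^ 2 / 2 := by
      simp [Finset.sum_range_succ, mul_pow, Nat.factorial]; ring
    rw [h2] at h
    refine h.trans ?_
    simp only [norm_mul, Complex.norm_real, Real.norm_eq_abs, Complex.norm_I, mul_one]
    rw [mul_comm]
    gcongr
    norm_num [Nat.factorial]
  · have h1 : ‖Complex.exp (x * Complex.I)‖ = 1 := Complex.norm_exp_ofReal_mul_I x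
    have h2 : ‖(1 + x * Complex.I - x ^ 2 / 2 : ℂ)‖ ≤ 1 + |x| + |x| ^ 2 / 2 := by
      refine (norm_sub_le _ _).trans (add_le_add ((norm_add_le _ _).trans ?_) ?_) <;> simp
    refine (norm_sub_le _ _).trans ?_
    have h3 : |x| ≤ |x| ^ 3 := by nlinarith [sq_nonneg (|x| - 1)]
    have h4 : |x| ^ 2 ≤ |x| ^ 3 := by nlinarith [sq_nonneg |x|]
    linarith

/-- The third order expansion of the characteristic function of a centred law. -/
theorem norm_charFun_sub_le {ν : Measure ℝ} [IsProbabilityMeasure ν] (h3 : MemLp id 3 ν)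
    (h0 : ∫ x, x ∂ν = 0) (s : ℝ) :
    ‖charFun ν s - ((1 - (∫ x, x ^ 2 ∂ν) / 2 * s ^ 2 : ℝ) : ℂ)‖ ≤
      4 * (∫ x, |x| ^ 3 ∂ν) * |s| ^ 3 := by
  have i1 : Integrable (fun x : ℝ => x) ν := h3.integrable (by norm_num)
  have i2 : Integrable (fun x : ℝ => x ^ 2) ν := (h3.mono_exponent (by norm_num)).integrable_sq
  have i3 : Integrable (fun x : ℝ => |x| ^ 3) ν := by
    simpa using h3.integrable_norm_pow (by norm_num)
  have ie : Integrable (fun x : ℝ => Complex.exp (s * x * Complex.I)) ν := by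
    refine Integrable.of_bound (C := 1) (by fun_prop) (ae_of_all _ fun x => ?_)
    rw [← Complex.ofReal_mul, Complex.norm_exp_ofReal_mul_I]
  have j1 : Integrable (fun x : ℝ => ((s * x : ℝ) : ℂ) * Complex.I) ν :=
    ((i1.const_mul s).ofReal).mul_const _
  have j2 : Integrable (fun x : ℝ => ((s * x : ℝ) : ℂ) ^ 2 / 2) ν := by
    have : Integrable (fun x : ℝ => ((s ^ 2 / 2 * x ^ 2 : ℝ) : ℂ)) ν := (i2.const_mul _).ofReal
    refine this.congr (ae_of_all _ fun x => ?_)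
    push_cast; ring
  have j0 : Integrable (fun x : ℝ => (1 : ℂ) + ((s * x : ℝ) : ℂ) * Complex.I) ν :=
    (integrable_const _).add j1
  have hexp : ((1 - (∫ x, x ^ 2 ∂ν) / 2 * s ^ 2 : ℝ) : ℂ) =
      ∫ x : ℝ, ((1 : ℂ) + ((s * x : ℝ) : ℂ) * Complex.I - ((s * x : ℝ) : ℂ) ^ 2 / 2) ∂ν := by
    rw [integral_sub j0 j2, integral_add (integrable_const _) j1, integral_mul_const,
      show ∫ a, ((s * a : ℝ) : ℂ) ∂ν = ((∫ a, s * a ∂ν : ℝ) : ℂ) from integral_ofReal,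
      integral_const_mul, h0]
    have : ∀ x : ℝ, ((s * x : ℝ) : ℂ) ^ 2 / 2 = ((s ^ 2 / 2 * x ^ 2 : ℝ) : ℂ) := by
      intro x; push_cast; ring
    simp_rw [this]
    rw [show ∫ a, ((s ^ 2 / 2 * a ^ 2 : ℝ) : ℂ) ∂ν = ((∫ a, s ^ 2 / 2 * a ^ 2 ∂ν : ℝ) : ℂ) from
      integral_ofReal, integral_const_mul]
    simp; ring
  have j3 : Integrable (fun x : ℝ => (1 : ℂ) + ((s * x : ℝ) : ℂ) * Complex.I -
    ((s * x : ℝ) : ℂ) ^ 2 / 2) ν := j0.sub j2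
  rw [hexp, charFun_apply_real, ← integral_sub ie j3]
  calc _ ≤ ∫ x, 4 * (|s| ^ 3 * |x| ^ 3) ∂ν := by
        refine norm_integral_le_of_norm_le ((i3.const_mul _).const_mul _) (ae_of_all _ fun x => ?_)
        have := Complex.norm_exp_mul_I_sub_two_terms_le (s * x)
        rw [abs_mul, mul_pow] at this
        simpa using this
    _ = _ := by rw [integral_const_mul, integral_const_mul]; ring

/-- A continuous characteristic function vanishing at infinity is bounded away from `1` in modulus
outside every neighbourhood of the origin. -/
theorem exists_norm_charFun_le {ν : Measure ℝ} [IsProbabilityMeasure ν]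
    (h0 : Tendsto (charFun ν) (cocompact ℝ) (𝓝 0)) {δ : ℝ} (hδ : 0 < δ) :
    ∃ η < 1, ∀ s, δ ≤ |s| → ‖charFun ν s‖ ≤ η := by
  have hlt : ∀ s, s ≠ 0 → ‖charFun ν s‖ < 1 := by
    intro s hs
    rcases ae_eq_const_or_norm_integral_lt_of_norm_le_const (μ := ν) (C := 1)
      (f := fun x : ℝ => Complex.exp (s * x * Complex.I)) (ae_of_all _ fun x => by
        rw [← Complex.ofReal_mul, Complex.norm_exp_ofReal_mul_I]) with h | h
    -- In the equality case `e^{isx}` is almost surely a constant `z` of modulus one. Then the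
    -- characteristic function at `ks` is `z^k` for every `k`, which contradicts decay at infinity.
    · exfalso
      set z := ⨍ x, Complex.exp (s * x * Complex.I) ∂ν with hz
      have hz1 : ‖z‖ = 1 := by
        obtain ⟨x, hx⟩ := h.exists
        have : Complex.exp (s * x * Complex.I) = z := hx
        rw [← this, ← Complex.ofReal_mul, Complex.norm_exp_ofReal_mul_I]
      have hk : ∀ k : ℕ, ‖charFun ν (k * s)‖ = 1 := by
        intro k
        have : charFun ν (k * s) = ∫ x, z ^ k ∂ν := by
          rw [charFun_apply_real]
          refine integral_congr_ae ?_
          filter_upwards [h] with x hx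
          have : Complex.exp (s * x * Complex.I) = z := hx
          rw [← this, ← Complex.exp_nat_mul]
          congr 1; push_cast; ring
        rw [this]; simp [hz1]
      have ht : Tendsto (fun k : ℕ => (k : ℝ) * s) atTop (cocompact ℝ) := by
        rw [← Metric.cobounded_eq_cocompact]
        rw [← tendsto_norm_atTop_iff_cobounded]
        simp only [norm_mul, Real.norm_natCast]
        exact (tendsto_natCast_atTop_atTop).atTop_mul_const (norm_pos_iff.2 hs)
      have h2 := (h0.comp ht).norm
      simp only [Function.comp_def, hk, norm_zero] at h2
      exact one_ne_zero (tendsto_nhds_unique tendsto_const_nhds h2)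
    · rw [charFun_apply_real]; simpa using h
  have hev : ∀ᶠ s in cocompact ℝ, ‖charFun ν s‖ < 1 / 2 := by
    have := h0.norm
    rw [norm_zero] at this
    exact this.eventually_lt_const (by norm_num)
  obtain ⟨T, hT, hTs⟩ := mem_cocompact.1 hev
  have hcT : IsCompact (T ∩ {s | δ ≤ |s|}) :=
    hT.inter_right (isClosed_le continuous_const continuous_abs)
  rcases (T ∩ {s | δ ≤ |s|}).eq_empty_or_nonempty with he | hne
  · refine ⟨1 / 2, by norm_num, fun s hs => (hTs fun hsT => ?_).le⟩
    exact (Set.eq_empty_iff_forall_notMem.1 he) s ⟨hsT, hs⟩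
  · obtain ⟨s₀, hs₀, hmax⟩ := hcT.exists_isMaxOn hne (continuous_charFun (μ := ν)).norm.continuousOn
    refine ⟨max (1 / 2) ‖charFun ν s₀‖, max_lt (by norm_num) (hlt _ ?_), fun s hs => ?_⟩
    · rintro rfl
      have := hs₀.2
      simp only [Set.mem_ofPred_eq, abs_zero] at this
      linarith
    · by_cases hsT : s ∈ T
      · exact (hmax ⟨hsT, hs⟩).trans (le_max_right _ _)
      · exact (hTs hsT).le.trans (le_max_left _ _)

/-! ### Smoothing of a power singularity by convolution -/

/-- A bound on the Beta integral. The exponents are nonpositive, so on each half of `(0, u)` one of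
the factors is at most its value at `u / 2`, and the other is integrated explicitly. -/
theorem setLIntegral_rpow_sub_mul_rpow_le {a b : ℝ} (ha : 0 < a) (ha1 : a ≤ 1) (hb : 0 < b)
    (hb1 : b ≤ 1) : ∃ C, 0 < C ∧ ∀ u : ℝ, 0 < u →
      ∫⁻ v in Set.Ioo 0 u, ENNReal.ofReal ((u - v) ^ (b - 1) * v ^ (a - 1)) ≤
        ENNReal.ofReal (C * u ^ (a + b - 1)) := by
  refine ⟨(1 / 2) ^ (b - 1) / a + (1 / 2) ^ (a - 1) / b, by positivity, fun u hu => ?_⟩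
  have hA : IntervalIntegrable (fun v : ℝ => v ^ (a - 1)) volume 0 u :=
    intervalIntegral.intervalIntegrable_rpow' (by linarith)
  have hB0 : IntervalIntegrable (fun v : ℝ => v ^ (b - 1)) volume 0 u :=
    intervalIntegral.intervalIntegrable_rpow' (by linarith)
  have hB : IntervalIntegrable (fun v : ℝ => (u - v) ^ (b - 1)) volume 0 u := by
    simpa using (hB0.comp_sub_left u).symm
  set F : ℝ → ℝ := fun v => (u / 2) ^ (b - 1) * v ^ (a - 1) + (u / 2) ^ (a - 1) * (u - v) ^ (b - 1)
    with hF
  have hFi : IntervalIntegrable F volume 0 u := (hA.const_mul _).add (hB.const_mul _)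
  have hFI : IntegrableOn F (Set.Ioo 0 u) := by
    rw [intervalIntegrable_iff_integrableOn_Ioo_of_le hu.le] at hFi; exact hFi
  have hFint : ∫ v in Set.Ioo 0 u, F v =
      ((1 / 2) ^ (b - 1) / a + (1 / 2) ^ (a - 1) / b) * u ^ (a + b - 1) := by
    rw [← integral_Ioc_eq_integral_Ioo, ← intervalIntegral.integral_of_le hu.le, hF,
      intervalIntegral.integral_add (hA.const_mul _) (hB.const_mul _),
      intervalIntegral.integral_const_mul, intervalIntegral.integral_const_mul,
      intervalIntegral.integral_comp_sub_left (fun v => v ^ (b - 1)), sub_self, sub_zero,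
      integral_rpow (Or.inl (by linarith)), integral_rpow (Or.inl (by linarith)),
      sub_add_cancel, sub_add_cancel, Real.zero_rpow ha.ne', Real.zero_rpow hb.ne', sub_zero,
      sub_zero, div_eq_mul_one_div u 2, Real.mul_rpow hu.le (by norm_num),
      Real.mul_rpow hu.le (by norm_num), show a + b - 1 = (b - 1) + a by ring,
      Real.rpow_add hu]
    have : u ^ (a - 1) * u ^ b = u ^ (b - 1) * u ^ a := by
      rw [← Real.rpow_add hu, ← Real.rpow_add hu]; congr 1; ring
    linear_combination (1 / 2) ^ (a - 1) / b * this
  rw [← hFint, ofReal_integral_eq_lintegral_ofReal hFI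
    ((ae_restrict_mem measurableSet_Ioo).mono fun v hv => by
      have := hv.1; have : 0 < u - v := sub_pos.2 hv.2
      simp only [hF, Pi.zero_apply]; positivity)]
  refine setLIntegral_mono' measurableSet_Ioo fun v hv => ENNReal.ofReal_le_ofReal ?_
  have hv0 := hv.1
  have huv : 0 < u - v := sub_pos.2 hv.2
  rcases le_total v (u / 2) with h | h
  · have h1 : (u - v) ^ (b - 1) ≤ (u / 2) ^ (b - 1) :=
      Real.rpow_le_rpow_of_nonpos (by positivity) (by linarith) (by linarith)
    calc (u - v) ^ (b - 1) * v ^ (a - 1) ≤ (u / 2) ^ (b - 1) * v ^ (a - 1) + 0 := by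
          rw [add_zero]; gcongr
      _ ≤ F v := add_le_add le_rfl (by positivity)
  · have h1 : v ^ (a - 1) ≤ (u / 2) ^ (a - 1) :=
      Real.rpow_le_rpow_of_nonpos (by positivity) (by linarith) (by linarith)
    calc (u - v) ^ (b - 1) * v ^ (a - 1) ≤ 0 + (u / 2) ^ (a - 1) * (u - v) ^ (b - 1) := by
          rw [zero_add, mul_comm]; gcongr
      _ ≤ F v := add_le_add (by positivity) le_rfl

theorem convPow_of_nonpos {ρ : ℝ → ℝ≥0∞} (hneg : ∀ u ≤ 0, ρ u = 0) (m : ℕ) {u : ℝ} (hu : u ≤ 0) :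
    convPow ρ m u = 0 := by
  induction m generalizing u with
  | zero => exact hneg u hu
  | succ m ih =>
    rw [convPow, ← lintegral_zero (α := ℝ) (μ := volume)]
    refine lintegral_congr fun v => ?_
    rcases le_or_gt v 0 with hv | hv
    · rw [hneg v hv, mul_zero]
    · rw [ih (by linarith), zero_mul]

/-- Each convolution raises the exponent at the origin by `a`, by the Beta integral bound. The
induction stops at `(m + 1) a ≤ 1`, where the exponents are still nonpositive. -/
theorem exists_convPow_le_rpow {ρ : ℝ → ℝ≥0∞} (hneg : ∀ u ≤ 0, ρ u = 0)
    {a K : ℝ} (ha : 0 < a) (hK : 0 < K) (hbd : ∀ u, 0 < u → ρ u ≤ ENNReal.ofReal (K * u ^ (a - 1)))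
    (m : ℕ) (hm : (m + 1) * a ≤ 1) :
    ∃ K', 0 < K' ∧ ∀ u, 0 < u → convPow ρ m u ≤ ENNReal.ofReal (K' * u ^ ((m + 1) * a - 1)) := by
  induction m with
  | zero => exact ⟨K, hK, by simpa [convPow] using hbd⟩
  | succ m ih =>
    push_cast at hm
    obtain ⟨K₁, hK₁, h₁⟩ := ih (by nlinarith)
    have hma : (0 : ℝ) ≤ m * a := by positivity
    obtain ⟨C, hC, hC'⟩ := setLIntegral_rpow_sub_mul_rpow_le ha (by nlinarith)
      (b := (m + 1) * a) (by positivity) (by nlinarith)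
    refine ⟨K₁ * K * C, by positivity, fun u hu => ?_⟩
    have hsupp : ∀ v, convPow ρ m (u - v) * ρ v ≤ (Set.Ioo 0 u).indicator (fun v =>
        ENNReal.ofReal (K₁ * K) *
          ENNReal.ofReal ((u - v) ^ ((m + 1) * a - 1) * v ^ (a - 1))) v := by
      intro v
      rcases le_or_gt v 0 with hv | hv
      · simp [hneg v hv]
      rcases le_or_gt u v with huv | huv
      · simp [convPow_of_nonpos hneg m (sub_nonpos.2 huv)]
      rw [Set.indicator_of_mem (show v ∈ Set.Ioo 0 u from ⟨hv, huv⟩),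
        ← ENNReal.ofReal_mul (by positivity)]
      have huv' : 0 < u - v := sub_pos.2 huv
      refine (mul_le_mul' (h₁ _ huv') (hbd v hv)).trans (le_of_eq ?_)
      rw [← ENNReal.ofReal_mul (by positivity)]
      congr 1; ring
    calc convPow ρ (m + 1) u
        ≤ ENNReal.ofReal (K₁ * K) * ENNReal.ofReal (C * u ^ (a + (m + 1) * a - 1)) := by
          rw [convPow]
          refine (lintegral_mono hsupp).trans ?_
          rw [lintegral_indicator measurableSet_Ioo,
            lintegral_const_mul' _ _ ENNReal.ofReal_ne_top]
          gcongr
          exact hC' u hu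
      _ = _ := by
          rw [← ENNReal.ofReal_mul (by positivity)]
          push_cast
          congr 1; ring_nf

/-- Sufficiently high convolution powers of a density with an integrable power singularity are
bounded. -/
theorem exists_convPow_le {ρ : ℝ → ℝ≥0∞} (hneg : ∀ u ≤ 0, ρ u = 0)
    {a b K : ℝ} (ha : 0 < a) (hb : 0 < b) (hK : 0 < K)
    (hbd : ∀ u, 0 < u → ρ u ≤ ENNReal.ofReal (K * u ^ (a - 1) * Real.exp (-b * u))) (ha1 : a < 1) :
    ∃ (m : ℕ) (B : ℝ≥0), ∀ u, convPow ρ m u ≤ B := by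
  -- Lowering `a` to the reciprocal `a' = 1 / (m + 1)` makes the exponent of the `(m + 1)`-fold
  -- convolution exactly `0`. The spare growth `u ^ (a - a')` is absorbed by the exponential.
  obtain ⟨m, hm⟩ := exists_nat_one_div_lt ha
  set a' : ℝ := 1 / ((m : ℝ) + 1) with ha'
  have ha'0 : 0 < a' := by positivity
  have hbd' : ∀ u, 0 < u → ρ u ≤ ENNReal.ofReal (K * (1 + 1 / b) * u ^ (a' - 1)) := by
    intro u hu
    refine (hbd u hu).trans (ENNReal.ofReal_le_ofReal ?_)
    have h1 : u ^ (a - 1) = u ^ (a - a') * u ^ (a' - 1) := by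
      rw [← Real.rpow_add hu]; congr 1; ring
    have h2 : u ^ (a - a') ≤ 1 + u := by
      rcases le_total u 1 with h | h
      · exact (Real.rpow_le_one hu.le h (by linarith)).trans (by linarith)
      · calc u ^ (a - a') ≤ u ^ (1 : ℝ) := Real.rpow_le_rpow_of_exponent_le h (by linarith)
          _ ≤ _ := by rw [Real.rpow_one]; linarith
    have h3 : (1 + u) * Real.exp (-b * u) ≤ 1 + 1 / b := by
      have e1 : Real.exp (-b * u) ≤ 1 := Real.exp_le_one_iff.2 (by nlinarith)
      have e2 : b * u * Real.exp (-b * u) ≤ 1 := by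
        have := Real.add_one_le_exp (b * u)
        rw [neg_mul, Real.exp_neg, ← div_eq_mul_inv, div_le_one (Real.exp_pos _)]
        linarith
      have e3 : u * Real.exp (-b * u) ≤ 1 / b := by
        rw [le_div_iff₀ hb]; linarith
      linarith
    have h4 := Real.exp_pos (-b * u)
    have h5 := Real.rpow_pos_of_pos hu (a' - 1)
    calc K * u ^ (a - 1) * Real.exp (-b * u)
        = K * (u ^ (a - a') * Real.exp (-b * u)) * u ^ (a' - 1) := by rw [h1]; ring
      _ ≤ K * ((1 + u) * Real.exp (-b * u)) * u ^ (a' - 1) := by gcongr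
      _ ≤ K * (1 + 1 / b) * u ^ (a' - 1) := by gcongr
  have hma : ((m : ℝ) + 1) * a' = 1 := by rw [ha']; field_simp
  obtain ⟨K', hK', h⟩ := exists_convPow_le_rpow hneg ha'0 (by positivity) hbd' m hma.le
  refine ⟨m, K'.toNNReal, fun u => ?_⟩
  rcases le_or_gt u 0 with hu | hu
  · rw [convPow_of_nonpos hneg m hu]; exact bot_le
  · have := h u hu
    rw [hma, sub_self, Real.rpow_zero, mul_one] at this
    exact this

/-! ### Fourier inversion and the local limit theorem -/

variable {ρ : ℝ → ℝ≥0∞}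

open scoped FourierTransform in
/-- Fourier inversion for convolution powers: the density of a sum of independent random variables
is the inverse Fourier integral of a power of a characteristic function. -/
theorem toReal_convPow_succ_eq_integral (hρ : Measurable ρ) (h1 : ∫⁻ u, ρ u = 1) {m : ℕ} {B : ℝ≥0}
    (hB : ∀ u, convPow ρ m u ≤ B)
    (hint : Integrable fun w : ℝ => charFun (volume.withDensity ρ) (-2 * Real.pi * w) ^ (m + 2))
    (u : ℝ) :
    ((convPow ρ (m + 1) u).toReal : ℂ) = ∫ w : ℝ, Complex.exp (2 * Real.pi * (w * u) * Complex.I) *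
      charFun (volume.withDensity ρ) (-2 * Real.pi * w) ^ (m + 2) := by
  have hm := measurable_convPow hρ (m + 1)
  have hfin : ∀ u, convPow ρ (m + 1) u < ∞ := fun u =>
    (convPow_le_add h1 hB hρ 1 u).trans_lt ENNReal.coe_lt_top
  have hF : 𝓕 (fun u => ((convPow ρ (m + 1) u).toReal : ℂ)) =
      fun w => charFun (volume.withDensity ρ) (-2 * Real.pi * w) ^ (m + 2) := by
    ext w
    rw [fourier_toReal_eq_charFun hm (ae_of_all _ hfin), charFun_withDensity_convPow hρ h1]
  have hr : Integrable fun u => ((convPow ρ (m + 1) u).toReal : ℂ) :=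
    (integrable_toReal_of_lintegral_ne_top hm.aemeasurable
      (by simp [lintegral_convPow hρ h1])).ofReal
  have hc : Continuous fun u => ((convPow ρ (m + 1) u).toReal : ℂ) :=
    Complex.continuous_ofReal.comp (continuous_toReal_convPow_succ hρ h1 hB)
  have := congrFun (hc.fourierInv_fourier_eq hr (by rw [hF]; exact hint)) u
  rw [← this, hF, Real.fourierInv_eq']
  refine integral_congr_ae (ae_of_all _ fun w => ?_)
  simp only [smul_eq_mul]
  congr 2
  simp; ring

/-- A bounded probability density is square integrable, hence so is its Fourier transform, which is
the `(m + 1)`-st power of the characteristic function. -/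
theorem integrable_norm_charFun_pow (hρ : Measurable ρ) (h1 : ∫⁻ u, ρ u = 1) {m : ℕ} {B : ℝ≥0}
    (hB : ∀ u, convPow ρ m u ≤ B) :
    Integrable fun w : ℝ => ‖charFun (volume.withDensity ρ) (-2 * Real.pi * w)‖ ^ (2 * (m + 1)) := by
  have hm := measurable_convPow hρ m
  have hr : Integrable fun u => ((convPow ρ m u).toReal : ℂ) :=
    (integrable_toReal_of_lintegral_ne_top hm.aemeasurable
      (by simp [lintegral_convPow hρ h1])).ofReal
  have hfin : ∀ u, convPow ρ m u < ∞ := fun u => (hB u).trans_lt ENNReal.coe_lt_top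
  have h2 : MemLp (fun u => ((convPow ρ m u).toReal : ℂ)) 2 := by
    refine (memLp_two_iff_integrable_sq_norm hr.aestronglyMeasurable).2 ?_
    refine (hr.norm.const_mul (B : ℝ)).mono
      (hr.aestronglyMeasurable.norm.pow 2) (ae_of_all _ fun u => ?_)
    have : (convPow ρ m u).toReal ≤ B := ENNReal.toReal_le_coe_of_le_coe (hB u)
    have h0 : 0 ≤ (convPow ρ m u).toReal := ENNReal.toReal_nonneg
    simp only [Complex.norm_real, norm_pow, norm_mul, Real.norm_eq_abs,
      abs_of_nonneg h0, NNReal.abs_eq]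
    nlinarith
  have h3 := (hr.memLp_two_fourier h2).integrable_norm_pow (by norm_num)
  refine h3.congr (ae_of_all _ fun w => ?_)
  dsimp only
  rw [fourier_toReal_eq_charFun hm (ae_of_all _ hfin), charFun_withDensity_convPow hρ h1, norm_pow,
    ← pow_mul, mul_comm 2]

/-- A local limit theorem with rate: convolution powers of a density with finite third moment, one
of which is bounded, are uniformly at most the Gaussian peak and at least the Gaussian peak at the
mean, up to an error of order `1 / m`. -/
theorem exists_convPow_local_limit (hρ : Measurable ρ) (h1 : ∫⁻ u, ρ u = 1) {m₀ : ℕ} {B : ℝ≥0}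
    (hB : ∀ u, convPow ρ m₀ u ≤ B) (h3 : MemLp id 3 (volume.withDensity ρ)) {t : ℝ}
    (ht : t = ∫ x, x ∂(volume.withDensity ρ)) :
    ∃ β E : ℝ, 0 < β ∧ 0 < E ∧ ∃ N : ℕ, ∀ m : ℕ, N ≤ m →
      (∀ u, convPow ρ m u ≤ ENNReal.ofReal (β / √((m : ℝ) + 1) + E / (m + 1))) ∧
      ENNReal.ofReal (β / √((m : ℝ) + 1) - E / (m + 1)) ≤ convPow ρ m ((m + 1) * t) := by
  set μ := volume.withDensity ρ with hμ
  have hμp : IsProbabilityMeasure μ := isProbabilityMeasure_withDensity_convPow hρ h1 0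
  set ν := μ.map (· + (-t)) with hν
  have hνp : IsProbabilityMeasure ν := Measure.isProbabilityMeasure_map (by fun_prop)
  have hac : μ ≪ volume := withDensity_absolutelyContinuous _ _
  have i1 : Integrable (fun x : ℝ => x) μ := h3.integrable (by norm_num)
  have h3' : MemLp id 3 ν := by
    rw [hν, memLp_map_measure_iff (by fun_prop) (by fun_prop)]
    exact h3.add (memLp_const (-t))
  have h0 : ∫ x, x ∂ν = 0 := by
    rw [hν, integral_map (by fun_prop) (by fun_prop), integral_add i1 (integrable_const _), ← ht]
    simp
  set σ := ∫ x, x ^ 2 ∂ν with hσ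
  -- With zero variance the law would be concentrated at `t`, which an absolutely continuous law
  -- cannot be.
  have hσ0 : 0 < σ := by
    have i2 : Integrable (fun x : ℝ => x ^ 2) ν := (h3'.mono_exponent (by norm_num)).integrable_sq
    refine lt_of_le_of_ne (integral_nonneg fun x => sq_nonneg x) fun h => ?_
    have h2 := (integral_eq_zero_iff_of_nonneg (fun x => sq_nonneg x) i2).1 h.symm
    have h4 : ∀ᵐ x ∂μ, x = t := by
      have := ae_of_ae_map (by fun_prop) h2
      filter_upwards [this] with x hx
      have : (x + -t) ^ 2 = 0 := hx
      linarith [pow_eq_zero_iff (two_ne_zero) |>.1 this]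
    have h5 : ∀ᵐ x ∂μ, x ≠ t := hac.ae_le (Measure.ae_ne volume t)
    obtain ⟨x, hx, hx'⟩ := (h4.and h5).exists
    exact hx' hx
  set φ : ℝ → ℂ := fun w => charFun μ (-2 * Real.pi * w) with hφ
  set θ : ℝ → ℂ := fun w => charFun ν (-2 * Real.pi * w) with hθ
  have hθφ : ∀ w, θ w = φ w * Complex.exp (2 * Real.pi * (w * t) * Complex.I) := by
    intro w
    simp only [hθ, hφ, hν, charFun_map_add_const]
    congr 2
    simp; ring
  have hnorm : ∀ w, ‖θ w‖ = ‖φ w‖ := by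
    intro w
    have : (2 * Real.pi * (w * t) * Complex.I : ℂ) = ((2 * Real.pi * (w * t) : ℝ) : ℂ) * Complex.I := by
      push_cast; ring
    rw [hθφ, norm_mul, this, Complex.norm_exp_ofReal_mul_I, mul_one]
  have hcont : Continuous θ := continuous_charFun.comp (by fun_prop)
  have hpi := Real.pi_pos
  have hzero : Tendsto (charFun ν) (cocompact ℝ) (𝓝 0) := by
    have hfin : ∀ᵐ u, ρ u < ∞ := ae_lt_top hρ (by simp [h1])
    have e1 : Tendsto φ (cocompact ℝ) (𝓝 0) := by
      have := Real.zero_at_infty_fourier fun u => ((ρ u).toReal : ℂ)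
      refine this.congr fun w => ?_
      rw [fourier_toReal_eq_charFun hρ hfin]
    have e2 : Tendsto θ (cocompact ℝ) (𝓝 0) := by
      rw [tendsto_zero_iff_norm_tendsto_zero] at e1 ⊢
      simpa only [hnorm] using e1
    have hne : (-2 * Real.pi)⁻¹ ≠ 0 := by
      simp [hpi.ne']
    have e3 := e2.comp (Homeomorph.mulLeft₀ _ hne).isClosedEmbedding.tendsto_cocompact
    refine e3.congr fun s => ?_
    simp only [hθ, Function.comp_apply, Homeomorph.coe_mulLeft₀]
    congr 1
    field_simp
  -- The quadratic coefficient in the Fourier variable `w`, where the argument of the characteristic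
  -- function is `s = -2πw`.
  set α := σ / 2 * (-2 * Real.pi) ^ 2 with hα
  have hα0 : 0 < α := by positivity
  set K := 4 * (∫ x, |x| ^ 3 ∂ν) * |-2 * Real.pi| ^ 3 + 1 with hK
  have hI3 : 0 ≤ ∫ x, |x| ^ 3 ∂ν := integral_nonneg fun x => by positivity
  have hK0 : 0 < K := by positivity
  have hT3 : ∀ w, ‖θ w - ((1 - α * w ^ 2 : ℝ) : ℂ)‖ ≤ K * |w| ^ 3 := by
    intro w
    have := norm_charFun_sub_le h3' h0 (-2 * Real.pi * w)
    rw [mul_pow (-2 * Real.pi) w, abs_mul (-2 * Real.pi) w, mul_pow _ |w|, ← mul_assoc,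
      ← mul_assoc] at this
    refine this.trans ?_
    gcongr
    rw [hK]; linarith
  have hη : ∀ δ, 0 < δ → ∃ η < 1, ∀ w, δ ≤ |w| → ‖θ w‖ ≤ η := by
    intro δ hδ
    obtain ⟨η, hη1, hη⟩ := exists_norm_charFun_le hzero (δ := 2 * Real.pi * δ) (by positivity)
    refine ⟨η, hη1, fun w hw => hη _ ?_⟩
    rw [abs_mul, abs_mul, abs_neg, abs_two, abs_of_pos hpi]
    gcongr
  have hN : Integrable fun w => ‖θ w‖ ^ (2 * (m₀ + 1)) := by
    simp_rw [hnorm]; exact integrable_norm_charFun_pow hρ h1 hB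
  obtain ⟨E, hE, hEm⟩ := exists_integral_norm_pow_sub_gaussian_le hcont
    (fun w => norm_charFun_le_one _) hα0 hK0 hT3 hη hN
  refine ⟨√(Real.pi / α), E, by positivity, hE, 2 * (m₀ + 1) + 2, fun m hm => ?_⟩
  obtain ⟨hint, hbd⟩ := hEm (m + 1) (by omega)
  have hm1 : (0 : ℝ) < (m : ℝ) + 1 := by positivity
  rw [Nat.cast_add_one] at hbd
  have hgi : Integrable fun w : ℝ => Real.exp (-(((m : ℝ) + 1) * α) * w ^ 2) :=
    integrable_exp_neg_mul_sq (by positivity)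
  have hgv : ∫ w : ℝ, Real.exp (-(((m : ℝ) + 1) * α) * w ^ 2) = √(Real.pi / α) / √((m : ℝ) + 1) := by
    rw [integral_gaussian, ← Real.sqrt_div (by positivity)]
    congr 1; field_simp
  have hφint : Integrable fun w => φ w ^ (m + 1) := by
    have hφc : Continuous φ := continuous_charFun.comp (by fun_prop)
    refine hint.mono (by fun_prop) (ae_of_all _ fun w => ?_)
    rw [norm_pow, norm_pow, hnorm]
  -- After centring, `u` enters only through a factor of modulus one. This gives the uniform upper
  -- bound at once; at `u = (m + 1) t` the factor is `1`, which gives the lower bound.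
  have hinv : ∀ u, ((convPow ρ m u).toReal : ℂ) =
      ∫ w : ℝ, Complex.exp (2 * Real.pi * (w * (u - (m + 1) * t)) * Complex.I) * θ w ^ (m + 1) := by
    intro u
    obtain ⟨m', rfl⟩ : ∃ m', m = m' + 1 := ⟨m - 1, by omega⟩
    have hB' : ∀ u, convPow ρ m' u ≤ B := fun u => by
      have := convPow_le_add h1 hB hρ (m' - m₀) u
      rwa [show m₀ + (m' - m₀) = m' by omega] at this
    rw [toReal_convPow_succ_eq_integral hρ h1 hB' hφint]
    refine integral_congr_ae (ae_of_all _ fun w => ?_)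
    simp only [hθφ, mul_pow]
    rw [← Complex.exp_nat_mul, mul_left_comm (Complex.exp _) (φ w ^ _), ← Complex.exp_add,
      mul_comm (Complex.exp _)]
    refine congrArg (φ w ^ (m' + 2) * Complex.exp ·) ?_
    push_cast; ring
  have hfin : ∀ u, convPow ρ m u ≠ ∞ := fun u => by
    have := convPow_le_add h1 hB hρ (m - m₀) u
    rw [show m₀ + (m - m₀) = m by omega] at this
    exact (this.trans_lt ENNReal.coe_lt_top).ne
  have hdi : Integrable fun w => ‖θ w ^ (m + 1) - (Real.exp (-(((m : ℝ) + 1) * α) * w ^ 2) : ℂ)‖ :=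
    (hint.sub hgi.ofReal).norm
  constructor
  · intro u
    rw [← ENNReal.ofReal_toReal (hfin u)]
    refine ENNReal.ofReal_le_ofReal ?_
    have e1 : (convPow ρ m u).toReal = ‖((convPow ρ m u).toReal : ℂ)‖ := by
      rw [Complex.norm_real, Real.norm_of_nonneg ENNReal.toReal_nonneg]
    rw [e1, hinv u, ← hgv]
    refine (norm_integral_le_of_norm_le (hgi.add hdi) (ae_of_all _ fun w => ?_)).trans
      ((integral_add hgi hdi).le.trans (by gcongr))
    have : (2 * Real.pi * (w * (u - (m + 1) * t)) * Complex.I : ℂ) =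
      ((2 * Real.pi * (w * (u - (m + 1) * t)) : ℝ) : ℂ) * Complex.I := by push_cast; ring
    rw [norm_mul, this, Complex.norm_exp_ofReal_mul_I, one_mul]
    have := norm_add_le (Real.exp (-(((m : ℝ) + 1) * α) * w ^ 2) : ℂ)
      (θ w ^ (m + 1) - (Real.exp (-(((m : ℝ) + 1) * α) * w ^ 2) : ℂ))
    rw [add_sub_cancel, Complex.norm_real, Real.norm_of_nonneg (Real.exp_pos _).le] at this
    exact this
  · rw [ENNReal.ofReal_le_iff_le_toReal (hfin _)]
    have e1 := hinv ((m + 1) * t)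
    have e2 : ((convPow ρ m ((m + 1) * t)).toReal : ℂ) = ∫ w, θ w ^ (m + 1) := by
      rw [e1]
      refine integral_congr_ae (ae_of_all _ fun w => ?_)
      simp
    have e3 : ((convPow ρ m ((m + 1) * t)).toReal : ℂ) -
        ((√(Real.pi / α) / √((m : ℝ) + 1) : ℝ) : ℂ) =
        ∫ w, (θ w ^ (m + 1) - (Real.exp (-(((m : ℝ) + 1) * α) * w ^ 2) : ℂ)) := by
      rw [e2, ← hgv, ← integral_complex_ofReal]
      exact (integral_sub hint hgi.ofReal).symm
    have e4 : |(convPow ρ m ((m + 1) * t)).toReal - √(Real.pi / α) / √((m : ℝ) + 1)| ≤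
        E / (m + 1) := by
      rw [← Real.norm_eq_abs, ← Complex.norm_real, Complex.ofReal_sub, e3]
      exact (norm_integral_le_integral_norm _).trans hbd
    linarith [(abs_le.1 e4).1]

/-! ### Bounds in `L^p` and moments of the energy density -/

theorem ENNReal.rpow_lintegral_le_lintegral_rpow {α : Type*} [MeasurableSpace α] {μ : Measure α}
    [IsProbabilityMeasure μ] {p : ℝ} (hp : 1 < p) {g : α → ℝ≥0∞} (hg : AEMeasurable g μ) :
    (∫⁻ x, g x ∂μ) ^ p ≤ ∫⁻ x, g x ^ p ∂μ := by
  have h := ENNReal.lintegral_mul_le_Lp_mul_Lq μ (Real.HolderConjugate.conjExponent hp) hg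
    (aemeasurable_const (b := (1 : ℝ≥0∞)))
  simp only [Pi.mul_apply, mul_one, ENNReal.one_rpow, lintegral_const, measure_univ] at h
  calc (∫⁻ x, g x ∂μ) ^ p ≤ ((∫⁻ x, g x ^ p ∂μ) ^ (1 / p)) ^ p := by gcongr
    _ = _ := by rw [← ENNReal.rpow_mul, one_div, inv_mul_cancel₀ (by positivity), ENNReal.rpow_one]

/-- Convolution with a probability density is an average of translates, so by Jensen's inequality it
does not increase the `L^p` norm. -/
theorem lintegral_rpow_convPow_le {ρ : ℝ → ℝ≥0∞} (hρ : Measurable ρ) (h1 : ∫⁻ u, ρ u = 1) {p : ℝ}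
    (hp : 1 < p) (m : ℕ) : ∫⁻ u, convPow ρ m u ^ p ≤ ∫⁻ u, ρ u ^ p := by
  induction m with
  | zero => exact le_rfl
  | succ m ih =>
    have hm := measurable_convPow hρ m
    have : IsProbabilityMeasure (volume.withDensity ρ) :=
      isProbabilityMeasure_withDensity_convPow hρ h1 0
    calc ∫⁻ u, convPow ρ (m + 1) u ^ p ≤ ∫⁻ u, ∫⁻ v, convPow ρ m (u - v) ^ p * ρ v := by
          refine lintegral_mono fun u => ?_
          have h := ENNReal.rpow_lintegral_le_lintegral_rpow (μ := volume.withDensity ρ) hp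
            (g := fun v => convPow ρ m (u - v)) (by fun_prop)
          rw [lintegral_withDensity_eq_lintegral_mul _ hρ (by fun_prop),
            lintegral_withDensity_eq_lintegral_mul _ hρ (by fun_prop)] at h
          simpa only [convPow, Pi.mul_apply, mul_comm (ρ _)] using h
      _ = ∫⁻ v, ∫⁻ u, convPow ρ m (u - v) ^ p * ρ v :=
          lintegral_lintegral_swap (Measurable.aemeasurable (by fun_prop))
      _ = ∫⁻ v, (∫⁻ u, convPow ρ m u ^ p) * ρ v := by
          refine lintegral_congr fun v => ?_
          rw [lintegral_mul_const _ (by fun_prop),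
            lintegral_sub_right_eq_self (fun u => convPow ρ m u ^ p) v]
      _ ≤ _ := by
          rw [lintegral_const_mul _ hρ, h1, mul_one]
          exact ih

theorem setLIntegral_Ioi_rpow_mul_exp_lt_top {K s b : ℝ} (hs : -1 < s) (hb : 0 < b) :
    ∫⁻ u in Set.Ioi (0 : ℝ), ENNReal.ofReal (K * (u ^ s * Real.exp (-b * u))) < ∞ := by
  have := integrableOn_rpow_mul_exp_neg_mul_rpow hs one_pos hb
  simp only [Real.rpow_one] at this
  exact (this.const_mul K).lintegral_lt_top

section Majorant

variable {ρ : ℝ → ℝ≥0∞} {a b K : ℝ}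

theorem exists_lintegral_rpow_lt_top (hneg : ∀ u ≤ 0, ρ u = 0) (ha : 0 < a) (hb : 0 < b)
    (hK : 0 < K)
    (hbd : ∀ u, 0 < u → ρ u ≤ ENNReal.ofReal (K * u ^ (a - 1) * Real.exp (-b * u))) :
    ∃ s : ℝ, 0 < s ∧ ∫⁻ u, ρ u ^ (1 + s) < ∞ := by
  -- This exponent works because `(a - 1)(1 + a/2) = -1 + a/2 + a²/2 > -1`, which makes the power
  -- integrable at the origin.
  refine ⟨a / 2, by positivity, ?_⟩
  set p := 1 + a / 2 with hp
  have hp0 : 0 < p := by positivity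
  refine lt_of_le_of_lt ?_ (setLIntegral_Ioi_rpow_mul_exp_lt_top (K := K ^ p)
    (s := (a - 1) * p) (b := b * p) (by rw [hp]; nlinarith) (by positivity))
  rw [← lintegral_indicator measurableSet_Ioi]
  refine lintegral_mono fun u => ?_
  rcases le_or_gt u 0 with hu | hu
  · simp [hneg u hu, hp0]
  · rw [Set.indicator_of_mem (show u ∈ Set.Ioi 0 from hu)]
    calc ρ u ^ p ≤ ENNReal.ofReal (K * u ^ (a - 1) * Real.exp (-b * u)) ^ p := by
          gcongr; exact hbd u hu
      _ = _ := by
          rw [ENNReal.ofReal_rpow_of_nonneg (by positivity) hp0.le,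
            Real.mul_rpow (by positivity) (by positivity), Real.mul_rpow hK.le (by positivity),
            ← Real.rpow_mul hu.le, ← Real.exp_mul, mul_assoc]
          ring_nf

theorem memLp_three_withDensity (hρ : Measurable ρ) (hneg : ∀ u ≤ 0, ρ u = 0) (ha : 0 < a)
    (hb : 0 < b)
    (hbd : ∀ u, 0 < u → ρ u ≤ ENNReal.ofReal (K * u ^ (a - 1) * Real.exp (-b * u))) :
    MemLp id 3 (volume.withDensity ρ) := by
  refine ⟨aestronglyMeasurable_id, ?_⟩
  rw [eLpNorm_lt_top_iff_lintegral_rpow_enorm_lt_top (by norm_num) (by norm_num),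
    lintegral_withDensity_eq_lintegral_mul _ hρ (by fun_prop)]
  refine lt_of_le_of_lt ?_ (setLIntegral_Ioi_rpow_mul_exp_lt_top (K := K)
    (s := a + 2) (b := b) (by linarith) hb)
  rw [← lintegral_indicator measurableSet_Ioi]
  refine lintegral_mono fun u => ?_
  rcases le_or_gt u 0 with hu | hu
  · simp [hneg u hu]
  · rw [Set.indicator_of_mem (show u ∈ Set.Ioi 0 from hu), Pi.mul_apply]
    have h3 : ‖id u‖ₑ ^ (3 : ℝ≥0∞).toReal = ENNReal.ofReal (u ^ (3 : ℝ)) := by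
      rw [id, Real.enorm_of_nonneg hu.le, ENNReal.ofReal_rpow_of_nonneg hu.le (by simp)]
      simp
    rw [h3]
    refine (mul_le_mul_left (hbd u hu) _).trans (le_of_eq ?_)
    rw [← ENNReal.ofReal_mul' (by positivity)]
    congr 1
    rw [show a + 2 = (a - 1) + 3 by ring, Real.rpow_add hu]
    ring

end Majorant

namespace EnsembleProjection.MemF

variable {f : ℝ → WithTop ℝ} (hf : MemF f)
include hf

theorem lintegral_energy {c : ℝ} (hc : 0 < c) : energy f (gibbs f 1 c) =
    (∫⁻ u, ENNReal.ofReal u * ENNReal.ofReal (dens f c u)).toReal := by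
  have hR := hf.measurable_Rr (n := 1)
  -- Where the Hamiltonian is infinite the Gibbs density vanishes, so the default value `0` has no
  -- effect.
  have hRr : ∀ x : EuclideanSpace ℝ (Fin 1), gibbs f 1 c x * (R f x).untopD 0 =
      Rr f x * gibbs f 1 c x := by
    intro x
    by_cases h : ∀ i, f (x i) ≠ ⊤
    · rw [R_eq_coe h, WithTop.untopD_coe, mul_comm]
    · have : R f x = ⊤ := by
        by_contra h'
        exact h (R_ne_top_iff.1 h')
      simp [gibbs, this, expNeg]
  have h0 : ∀ x : EuclideanSpace ℝ (Fin 1), 0 ≤ Rr f x := fun x =>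
    Finset.sum_nonneg fun i _ => hf.fin_nonneg _
  unfold energy
  simp_rw [hRr]
  rw [integral_eq_lintegral_of_nonneg_ae (ae_of_all _ fun x => mul_nonneg (h0 x) (hf.gibbs_nonneg hc x))
    (hR.mul hf.measurable_gibbs).aestronglyMeasurable]
  congr 1
  have := hf.lintegral_gibbsLaw_comp_Rr hc 0 (ψ := ENNReal.ofReal) ENNReal.measurable_ofReal
  rw [hf.lintegral_gibbsLaw _ hR.ennreal_ofReal] at this
  simp only [convPow] at this
  rw [← this]
  exact lintegral_congr fun x => ENNReal.ofReal_mul (h0 x)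

theorem memLp_three_dens {c : ℝ} (hc : 0 < c) :
    MemLp id 3 (volume.withDensity fun u => ENNReal.ofReal (dens f c u)) := by
  obtain ⟨a, b, K, ha, ha1, hb, hK, h⟩ := hf.exists_dens_le hc
  exact memLp_three_withDensity (hf.measurable_dens hc).ennreal_ofReal
    (fun u hu => by rw [dens_of_nonpos hu, ENNReal.ofReal_zero]) ha hb (fun u hu => ENNReal.ofReal_le_ofReal (h u hu))

theorem ae_withDensity_dens_pos {c : ℝ} (hc : 0 < c) :
    ∀ᵐ x ∂(volume.withDensity fun u => ENNReal.ofReal (dens f c u)), 0 < x := by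
  rw [ae_withDensity_iff (hf.measurable_dens hc).ennreal_ofReal]
  refine ae_of_all _ fun x hx => ?_
  by_contra h
  rw [dens_of_nonpos (not_lt.1 h)] at hx
  simp at hx

/-- This makes `t` the mean of the energy density, so that `nt` is the point where the local limit
theorem gives a lower bound. -/
theorem energy_gibbs_one {c : ℝ} (hc : 0 < c) : energy f (gibbs f 1 c) =
    ∫ x, x ∂(volume.withDensity fun u => ENNReal.ofReal (dens f c u)) := by
  have hd := (hf.measurable_dens hc).ennreal_ofReal
  have h0 := hf.ae_withDensity_dens_pos hc
  rw [hf.lintegral_energy hc, integral_eq_lintegral_of_nonneg_ae (h0.mono fun x hx => hx.le)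
    aestronglyMeasurable_id, lintegral_withDensity_eq_lintegral_mul _ hd (by fun_prop)]
  simp only [Pi.mul_apply, mul_comm]

theorem energy_gibbs_one_pos {c : ℝ} (hc : 0 < c) : 0 < energy f (gibbs f 1 c) := by
  have hd := (hf.measurable_dens hc).ennreal_ofReal
  have hp : IsProbabilityMeasure (volume.withDensity fun u => ENNReal.ofReal (dens f c u)) :=
    isProbabilityMeasure_withDensity_convPow hd (hf.lintegral_dens hc) 0
  have h0 := hf.ae_withDensity_dens_pos hc
  have i1 : Integrable (fun x : ℝ => x) (volume.withDensity fun u => ENNReal.ofReal (dens f c u)) :=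
    (hf.memLp_three_dens hc).integrable (by norm_num)
  rw [hf.energy_gibbs_one hc]
  refine lt_of_le_of_ne (integral_nonneg_of_ae (h0.mono fun x hx => hx.le)) fun h => ?_
  have h2 := (integral_eq_zero_iff_of_nonneg_ae (h0.mono fun x hx => hx.le) i1).1 h.symm
  obtain ⟨x, hx, hx'⟩ := (h0.and h2).exists
  exact hx.ne' hx'

/-- The local limit theorem for the energy of independent Gibbs particles. -/
theorem exists_local_limit {c t : ℝ} (hc : 0 < c) (ht : t = energy f (gibbs f 1 c)) :
    ∃ β E : ℝ, 0 < β ∧ 0 < E ∧ ∃ N : ℕ, ∀ m : ℕ, N ≤ m →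
      (∀ u, convPow (fun u => ENNReal.ofReal (dens f c u)) m u ≤
        ENNReal.ofReal (β / √((m : ℝ) + 1) + E / (m + 1))) ∧
      ENNReal.ofReal (β / √((m : ℝ) + 1) - E / (m + 1)) ≤
        convPow (fun u => ENNReal.ofReal (dens f c u)) m ((m + 1) * t) := by
  obtain ⟨a, b, K, ha, ha1, hb, hK, h⟩ := hf.exists_dens_le hc
  obtain ⟨m₀, B, hB⟩ := exists_convPow_le (ρ := fun u => ENNReal.ofReal (dens f c u))
    (fun u hu => by rw [dens_of_nonpos hu, ENNReal.ofReal_zero]) ha hb hK (fun u hu => ENNReal.ofReal_le_ofReal (h u hu)) ha1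
  exact exists_convPow_local_limit (hf.measurable_dens hc).ennreal_ofReal (hf.lintegral_dens hc) hB
    (hf.memLp_three_dens hc) (ht.trans (hf.energy_gibbs_one hc))

theorem exists_lintegral_rpow_convPow_le {c : ℝ} (hc : 0 < c) : ∃ s : ℝ, 0 < s ∧ ∃ L : ℝ, 0 < L ∧
    ∀ m, ∫⁻ u, convPow (fun u => ENNReal.ofReal (dens f c u)) m u ^ (1 + s) ≤ ENNReal.ofReal L := by
  obtain ⟨a, b, K, ha, ha1, hb, hK, h⟩ := hf.exists_dens_le hc
  obtain ⟨s, hs, hlt⟩ := exists_lintegral_rpow_lt_top (ρ := fun u => ENNReal.ofReal (dens f c u))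
    (fun u hu => by rw [dens_of_nonpos hu, ENNReal.ofReal_zero]) ha hb hK (fun u hu => ENNReal.ofReal_le_ofReal (h u hu))
  refine ⟨s, hs, (∫⁻ u, ENNReal.ofReal (dens f c u) ^ (1 + s)).toReal + 1,
    by positivity, fun m => ?_⟩
  refine (lintegral_rpow_convPow_le (hf.measurable_dens hc).ennreal_ofReal (hf.lintegral_dens hc)
    (by linarith) m).trans ?_
  rw [ENNReal.le_ofReal_iff_toReal_le hlt.ne (by positivity)]
  linarith

end EnsembleProjection.MemF

/-! ### Upper bounds for the Kullback–Leibler divergence -/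

namespace InformationTheory

variable {X : Type*} [MeasurableSpace X] {γ : Measure X} [IsProbabilityMeasure γ]

/-- A pointwise upper bound on `r log r` bounds the divergence of the law with density `r`. -/
theorem klDiv_withDensity_le {r : X → ℝ≥0∞} (hr : Measurable r) (h1 : ∫⁻ y, r y ∂γ = 1) {w : X → ℝ}
    (hw : Integrable w γ) (hrw : ∀ᵐ y ∂γ, (r y).toReal * Real.log (r y).toReal ≤ w y) :
    klDiv (γ.withDensity r) γ ≤ ENNReal.ofReal (∫ y, w y ∂γ) := by
  have hP : IsProbabilityMeasure (γ.withDensity r) :=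
    ⟨by rw [withDensity_apply _ .univ, setLIntegral_univ, h1]⟩
  have hri : Integrable (fun y => (r y).toReal) γ :=
    integrable_toReal_of_lintegral_ne_top hr.aemeasurable (by simp [h1])
  have hrI : ∫ y, (r y).toReal ∂γ = 1 := by
    rw [integral_toReal hr.aemeasurable (ae_lt_top hr (by simp [h1])), h1, ENNReal.toReal_one]
  have hw1 : Integrable (fun y => w y + 1) γ := hw.add (integrable_const 1)
  have hi : Integrable (fun y => w y + 1 - (r y).toReal) γ := hw1.sub hri
  -- Here `klFun r = r log r + 1 - r`, and the part `1 - r` integrates to zero under `γ`.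
  have hle : ∀ᵐ y ∂γ, klFun (r y).toReal ≤ w y + 1 - (r y).toReal := by
    filter_upwards [hrw] with y hy
    unfold klFun
    linarith
  calc klDiv (γ.withDensity r) γ = ∫⁻ y, ENNReal.ofReal (klFun (r y).toReal) ∂γ := by
        rw [klDiv_eq_lintegral_klFun_of_ac (withDensity_absolutelyContinuous _ _)]
        refine lintegral_congr_ae ?_
        filter_upwards [Measure.rnDeriv_withDensity γ hr] with y hy
        rw [hy]
    _ ≤ ∫⁻ y, ENNReal.ofReal (w y + 1 - (r y).toReal) ∂γ :=
        lintegral_mono_ae (hle.mono fun y hy => ENNReal.ofReal_le_ofReal hy)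
    _ = ENNReal.ofReal (∫ y, (w y + 1 - (r y).toReal) ∂γ) :=
        (ofReal_integral_eq_lintegral_ofReal hi
          (hle.mono fun y hy => (klFun_nonneg ENNReal.toReal_nonneg).trans hy)).symm
    _ = ENNReal.ofReal (∫ y, w y ∂γ) := by
        rw [integral_sub hw1 hri, integral_add hw (integrable_const 1), hrI]
        simp

theorem klDiv_withDensity_le_log {r : X → ℝ≥0∞} (hr : Measurable r) (h1 : ∫⁻ y, r y ∂γ = 1) {Λ : ℝ}
    (hΛ0 : 0 ≤ Λ) (hΛ : ∀ y, r y ≤ ENNReal.ofReal Λ) :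
    klDiv (γ.withDensity r) γ ≤ ENNReal.ofReal (Real.log Λ) := by
  have hri : Integrable (fun y => (r y).toReal) γ :=
    integrable_toReal_of_lintegral_ne_top hr.aemeasurable (by simp [h1])
  have hrI : ∫ y, (r y).toReal ∂γ = 1 := by
    rw [integral_toReal hr.aemeasurable (ae_lt_top hr (by simp [h1])), h1, ENNReal.toReal_one]
  refine (klDiv_withDensity_le hr h1 (hri.mul_const (Real.log Λ)) (ae_of_all _ fun y => ?_)).trans
    (le_of_eq ?_)
  · rcases (ENNReal.toReal_nonneg (a := r y)).eq_or_lt with h | h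
    · simp [← h]
    · gcongr
      exact ENNReal.toReal_le_of_le_ofReal hΛ0 (hΛ y)
  · rw [integral_mul_const, hrI, one_mul]

end InformationTheory

/-! ### The surface law and its projections relative to the Gibbs law -/

namespace EnsembleProjection.MemF

variable {f : ℝ → WithTop ℝ} (hf : MemF f)
include hf

section Laws

variable {c t : ℝ} (hc : 0 < c) (ht : 0 < t) {d : ℕ}
  (hp0 : convPow (fun u => ENNReal.ofReal (dens f c u)) d ((d + 1 : ℕ) * t) ≠ 0)
  (hp1 : convPow (fun u => ENNReal.ofReal (dens f c u)) d ((d + 1 : ℕ) * t) ≠ ∞)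
include hc ht hp0 hp1

/-- The conditions on the convolution power say that the total Jacobian mass is neither zero nor
infinite. Only then is the real-valued integral in `surfaceDensity` the true normalisation and not a
default value. -/
theorem lintegral_surfaceLaw {φ : EuclideanSpace ℝ (Fin (d + 1)) → ℝ≥0∞} (hφ : Measurable φ) :
    ∫⁻ v, φ v ∂surfaceLaw f (d + 1) t =
      (∫⁻ v, φ v * ENNReal.ofReal (jacobian f (d + 1) t v) ∂surfaceVolume f (d + 1) t) /
      ∫⁻ v, ENNReal.ofReal (jacobian f (d + 1) t v) ∂surfaceVolume f (d + 1) t := by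
  have hZ := hf.Z_pos hc
  have hjm : AEMeasurable (jacobian f (d + 1) t) (surfaceVolume f (d + 1) t) :=
    (measurable_grad.norm.inv).aemeasurable.congr (hf.jacobian_ae_eq ht).symm
  have hj0 : ∀ v, 0 ≤ jacobian f (d + 1) t v := fun v => inv_nonneg.2 (Real.sqrt_nonneg _)
  set J := ∫⁻ v, ENNReal.ofReal (jacobian f (d + 1) t v) ∂surfaceVolume f (d + 1) t with hJ
  have hJe := hf.lintegral_jacobian hc ht d
  have hJ0 : J ≠ 0 := by
    rw [hJ, hJe]
    exact mul_ne_zero (by rw [ne_eq, ENNReal.ofReal_eq_zero, not_le]; positivity) hp0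
  have hJ1 : J ≠ ∞ := by
    rw [hJ, hJe]
    exact ENNReal.mul_ne_top ENNReal.ofReal_ne_top hp1
  have hI : ∫ s, jacobian f (d + 1) t s ∂(surfaceVolume f (d + 1) t) = J.toReal :=
    integral_eq_lintegral_of_nonneg_ae (ae_of_all _ hj0) hjm.aestronglyMeasurable
  have hdens : ∀ v, ENNReal.ofReal (surfaceDensity f (d + 1) t v) =
      ENNReal.ofReal (jacobian f (d + 1) t v) / J := by
    intro v
    rw [surfaceDensity, hI, ENNReal.ofReal_div_of_pos (ENNReal.toReal_pos hJ0 hJ1),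
      ENNReal.ofReal_toReal hJ1]
  unfold surfaceLaw
  simp_rw [hdens]
  rw [lintegral_withDensity_eq_lintegral_mul₀ (hjm.ennreal_ofReal.div_const J) hφ.aemeasurable,
    div_eq_mul_inv, ← lintegral_mul_const' _ _ (ENNReal.inv_ne_top.2 hJ0)]
  refine lintegral_congr fun v => ?_
  simp only [Pi.mul_apply, div_eq_mul_inv]
  ring

theorem isProbabilityMeasure_surfaceLaw : IsProbabilityMeasure (surfaceLaw f (d + 1) t) := by
  have h := hf.lintegral_surfaceLaw hc ht hp0 hp1 (φ := fun _ => 1) measurable_const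
  simp only [one_mul, lintegral_one] at h
  refine ⟨h.trans (ENNReal.div_self ?_ ?_)⟩
  · rw [hf.lintegral_jacobian hc ht d]
    have hZ := hf.Z_pos hc
    exact mul_ne_zero (by rw [ne_eq, ENNReal.ofReal_eq_zero, not_le]; positivity) hp0
  · rw [hf.lintegral_jacobian hc ht d]
    exact ENNReal.mul_ne_top ENNReal.ofReal_ne_top hp1

end Laws

section Projection

variable {c t : ℝ} (hc : 0 < c) (ht : 0 < t) (k m : ℕ)
  (hp0 : convPow (fun u => ENNReal.ofReal (dens f c u)) (k + m) ((k + m + 1 : ℕ) * t) ≠ 0)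
  (hp1 : convPow (fun u => ENNReal.ofReal (dens f c u)) (k + m) ((k + m + 1 : ℕ) * t) ≠ ∞)
include hc

theorem measurable_convPow_sub_Rr (x : ℝ) (p : ℝ≥0∞) :
    Measurable fun y : EuclideanSpace ℝ (Fin k) =>
      convPow (fun u => ENNReal.ofReal (dens f c u)) m (x - Rr f y) / p :=
  ((measurable_convPow (hf.measurable_dens hc).ennreal_ofReal m).comp
    (measurable_const.sub hf.measurable_Rr)).div_const _

include ht hp0 hp1

/-- The law of the first coordinates of a random point of the surface, as a density with respect
to the Gibbs measure. -/
theorem projLaw_eq_withDensity : projLaw f (k + m + 1) k t = (gibbsLaw f k c).withDensity fun y =>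
    convPow (fun u => ENNReal.ofReal (dens f c u)) m ((k + m + 1 : ℕ) * t - Rr f y) /
      convPow (fun u => ENNReal.ofReal (dens f c u)) (k + m) ((k + m + 1 : ℕ) * t) := by
  have hZ := hf.Z_pos hc
  have hr := hf.measurable_convPow_sub_Rr hc k m ((k + m + 1 : ℕ) * t)
    (convPow (fun u => ENNReal.ofReal (dens f c u)) (k + m) ((k + m + 1 : ℕ) * t))
  refine Measure.ext_of_lintegral _ fun φ hφ => ?_
  unfold projLaw
  rw [lintegral_map hφ (measurable_proj _ _),
    hf.lintegral_surfaceLaw hc ht hp0 hp1 (φ := fun v => φ (proj (k + m + 1) k v))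
      (hφ.comp (measurable_proj _ _)),
    hf.lintegral_surface_proj hc ht k m hφ, hf.lintegral_jacobian hc ht (k + m),
    ENNReal.mul_div_mul_left _ _ (by rw [ne_eq, ENNReal.ofReal_eq_zero, not_le]; positivity)
      ENNReal.ofReal_ne_top,
    lintegral_withDensity_eq_lintegral_mul _ hr hφ, div_eq_mul_inv,
    ← lintegral_mul_const' _ _ (ENNReal.inv_ne_top.2 hp0)]
  refine lintegral_congr fun v => ?_
  simp only [Pi.mul_apply, div_eq_mul_inv]
  ring

theorem isProbabilityMeasure_projLaw : IsProbabilityMeasure (projLaw f (k + m + 1) k t) := by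
  have := hf.isProbabilityMeasure_surfaceLaw hc ht hp0 hp1
  exact Measure.isProbabilityMeasure_map (measurable_proj _ _).aemeasurable

theorem lintegral_ratio : ∫⁻ y, convPow (fun u => ENNReal.ofReal (dens f c u)) m
    ((k + m + 1 : ℕ) * t - Rr f y) / convPow (fun u => ENNReal.ofReal (dens f c u)) (k + m)
      ((k + m + 1 : ℕ) * t) ∂gibbsLaw f k c = 1 := by
  have := hf.isProbabilityMeasure_projLaw hc ht k m hp0 hp1
  rw [hf.projLaw_eq_withDensity hc ht k m hp0 hp1] at this
  have h := this.measure_univ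
  rwa [withDensity_apply _ .univ, setLIntegral_univ] at h

theorem projLaw_absolutelyContinuous : projLaw f (k + m + 1) k t ≪ volume := by
  rw [hf.projLaw_eq_withDensity hc ht k m hp0 hp1]
  exact (withDensity_absolutelyContinuous _ _).trans (withDensity_absolutelyContinuous _ _)

theorem klDiv_projLaw_le_log {Λ : ℝ} (hΛ0 : 0 ≤ Λ)
    (hΛ : ∀ x, convPow (fun u => ENNReal.ofReal (dens f c u)) m x ≤ ENNReal.ofReal Λ *
      convPow (fun u => ENNReal.ofReal (dens f c u)) (k + m) ((k + m + 1 : ℕ) * t)) :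
    InformationTheory.klDiv (projLaw f (k + m + 1) k t) (gibbsLaw f k c) ≤
      ENNReal.ofReal (Real.log Λ) := by
  have := hf.isProbabilityMeasure_gibbsLaw hc k
  rw [hf.projLaw_eq_withDensity hc ht k m hp0 hp1]
  refine InformationTheory.klDiv_withDensity_le_log (hf.measurable_convPow_sub_Rr hc k m _ _)
    (hf.lintegral_ratio hc ht k m hp0 hp1) hΛ0 fun y => ?_
  exact ENNReal.div_le_of_le_mul (hΛ _)

/-- From `p ≤ Λ g` and `Λ ≥ 1` follows the pointwise bound `|p - g| ≤ (2Λ - 1) g - p`, whose right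
side integrates to `2(Λ - 1)` because `p` and `g` both have mass one. -/
theorem integral_abs_projDensity_sub_le {Λ : ℝ} (hΛ1 : 1 ≤ Λ)
    (hΛ : ∀ x, convPow (fun u => ENNReal.ofReal (dens f c u)) m x ≤ ENNReal.ofReal Λ *
      convPow (fun u => ENNReal.ofReal (dens f c u)) (k + m) ((k + m + 1 : ℕ) * t)) :
    ∫ y, |projDensity f (k + m + 1) k t y - gibbs f k c y| ≤ 2 * (Λ - 1) := by
  have hγ := hf.isProbabilityMeasure_gibbsLaw hc k
  have hP := hf.isProbabilityMeasure_projLaw hc ht k m hp0 hp1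
  have hac := hf.projLaw_absolutelyContinuous hc ht k m hp0 hp1
  have hr := hf.measurable_convPow_sub_Rr hc k m ((k + m + 1 : ℕ) * t)
    (convPow (fun u => ENNReal.ofReal (dens f c u)) (k + m) ((k + m + 1 : ℕ) * t))
  set r : EuclideanSpace ℝ (Fin k) → ℝ≥0∞ := fun y =>
    convPow (fun u => ENNReal.ofReal (dens f c u)) m ((k + m + 1 : ℕ) * t - Rr f y) /
      convPow (fun u => ENNReal.ofReal (dens f c u)) (k + m) ((k + m + 1 : ℕ) * t) with hrdef
  have hg0 := hf.gibbs_nonneg hc (n := k)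
  have hgm := hf.measurable_gibbs (c := c) (n := k)
  have hp : ∀ᵐ y, projDensity f (k + m + 1) k t y ≤ Λ * gibbs f k c y := by
    have h1 : projLaw f (k + m + 1) k t =
        volume.withDensity fun y => ENNReal.ofReal (gibbs f k c y) * r y := by
      rw [hf.projLaw_eq_withDensity hc ht k m hp0 hp1, gibbsLaw,
        ← withDensity_mul _ hgm.ennreal_ofReal hr]
      rfl
    have h2 := Measure.rnDeriv_withDensity (volume : Measure (EuclideanSpace ℝ (Fin k)))
      (hgm.ennreal_ofReal.mul hr)
    filter_upwards [h2] with y hy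
    have hy' : (projLaw f (k + m + 1) k t).rnDeriv volume y =
      ENNReal.ofReal (gibbs f k c y) * r y := by rw [h1]; exact hy
    rw [projDensity, hy', ENNReal.toReal_mul, ENNReal.toReal_ofReal (hg0 y), mul_comm]
    refine mul_le_mul_of_nonneg_right ?_ (hg0 y)
    exact ENNReal.toReal_le_of_le_ofReal (by linarith) (ENNReal.div_le_of_le_mul (hΛ _))
  have hpi : Integrable (projDensity f (k + m + 1) k t) := Measure.integrable_toReal_rnDeriv
  have hpI : ∫ y, projDensity f (k + m + 1) k t y = 1 := by
    have := Measure.integral_toReal_rnDeriv hac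
    simpa [projDensity] using this
  have hgl : ∫⁻ y, ENNReal.ofReal (gibbs f k c y) = 1 := by
    have := hγ.measure_univ
    rwa [gibbsLaw, withDensity_apply _ .univ, setLIntegral_univ] at this
  have hgi : Integrable (gibbs f k c) :=
    (lintegral_ofReal_ne_top_iff_integrable hgm.aestronglyMeasurable (ae_of_all _ hg0)).1
      (by simp [hgl])
  have hgI : ∫ y, gibbs f k c y = 1 := by
    rw [integral_eq_lintegral_of_nonneg_ae (ae_of_all _ hg0) hgm.aestronglyMeasurable, hgl,
      ENNReal.toReal_one]
  have hbi : Integrable fun y => (2 * (Λ - 1) + 1) * gibbs f k c y - projDensity f (k + m + 1) k t y :=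
    (hgi.const_mul _).sub hpi
  calc ∫ y, |projDensity f (k + m + 1) k t y - gibbs f k c y|
      ≤ ∫ y, ((2 * (Λ - 1) + 1) * gibbs f k c y - projDensity f (k + m + 1) k t y) := by
        refine integral_mono_of_nonneg (ae_of_all _ fun y => abs_nonneg _) hbi ?_
        filter_upwards [hp] with y hy
        have := hg0 y
        rw [abs_le']
        constructor <;> nlinarith
    _ = 2 * (Λ - 1) := by
        rw [integral_sub (hgi.const_mul _) hpi, integral_const_mul, hgI, hpI]; ring

end Projection

/-- A bound on the divergence that needs only an integrability exponent for the law of the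
remaining energy. -/
theorem klDiv_projLaw_le_of_rpow {c t : ℝ} (hc : 0 < c) (ht : 0 < t) (k m : ℕ) {p S s L : ℝ}
    (hp : 0 < p) (hs : 0 < s) (hS : 0 ≤ S) (hL : 0 ≤ L)
    (hpp : ENNReal.ofReal p ≤
      convPow (fun u => ENNReal.ofReal (dens f c u)) (k + 1 + m) ((k + 1 + m + 1 : ℕ) * t))
    (hp1 : convPow (fun u => ENNReal.ofReal (dens f c u)) (k + 1 + m) ((k + 1 + m + 1 : ℕ) * t) ≠ ∞)
    (hkS : ∀ u, convPow (fun u => ENNReal.ofReal (dens f c u)) k u ≤ ENNReal.ofReal S)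
    (hmL : ∫⁻ u, convPow (fun u => ENNReal.ofReal (dens f c u)) m u ^ (1 + s) ≤ ENNReal.ofReal L) :
    InformationTheory.klDiv (projLaw f (k + 1 + m + 1) (k + 1) t) (gibbsLaw f (k + 1) c) ≤
      ENNReal.ofReal (S * L / (s * p) - Real.log p) := by
  have hp0 : convPow (fun u => ENNReal.ofReal (dens f c u)) (k + 1 + m)
      ((k + 1 + m + 1 : ℕ) * t) ≠ 0 := by
    intro h
    rw [h] at hpp
    simp only [nonpos_iff_eq_zero, ENNReal.ofReal_eq_zero] at hpp
    linarith
  have hγ := hf.isProbabilityMeasure_gibbsLaw hc (k + 1)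
  have hd := (hf.measurable_dens hc).ennreal_ofReal
  have hm := measurable_convPow hd m
  have hr := hf.measurable_convPow_sub_Rr hc (k + 1) m ((k + 1 + m + 1 : ℕ) * t)
    (convPow (fun u => ENNReal.ofReal (dens f c u)) (k + 1 + m) ((k + 1 + m + 1 : ℕ) * t))
  have hr1 := hf.lintegral_ratio hc ht (k + 1) m hp0 hp1
  rw [hf.projLaw_eq_withDensity hc ht (k + 1) m hp0 hp1]
  set x : ℝ := ((k + 1 + m + 1 : ℕ) * t) with hx
  set P := convPow (fun u => ENNReal.ofReal (dens f c u)) (k + 1 + m) x with hP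
  have hPr : p ≤ P.toReal := (ENNReal.ofReal_le_iff_le_toReal hp1).1 hpp
  have hP0 : 0 < P.toReal := hp.trans_le hPr
  set q : EuclideanSpace ℝ (Fin (k + 1)) → ℝ≥0∞ := fun y =>
    convPow (fun u => ENNReal.ofReal (dens f c u)) m (x - Rr f y) with hq
  have hqm : Measurable q := hm.comp (measurable_const.sub hf.measurable_Rr)
  -- Under the Gibbs law the energy of the `k + 1` retained particles has density at most `S`, so
  -- the integral is at most `S` times the integral over the line.
  have hqL : ∫⁻ y, q y ^ (1 + s) ∂gibbsLaw f (k + 1) c ≤ ENNReal.ofReal (S * L) := by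
    have h1 := hf.lintegral_gibbsLaw_comp_Rr hc k
      (ψ := fun u => convPow (fun u => ENNReal.ofReal (dens f c u)) m (x - u) ^ (1 + s))
      (by fun_prop)
    rw [h1]
    calc _ ≤ ∫⁻ u, convPow (fun u => ENNReal.ofReal (dens f c u)) m (x - u) ^ (1 + s) *
          ENNReal.ofReal S := lintegral_mono fun u => mul_le_mul_right (hkS u) _
      _ = (∫⁻ u, convPow (fun u => ENNReal.ofReal (dens f c u)) m u ^ (1 + s)) *
          ENNReal.ofReal S := by
          rw [lintegral_mul_const _ (by fun_prop), lintegral_sub_left_eq_self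
            (fun u => convPow (fun u => ENNReal.ofReal (dens f c u)) m u ^ (1 + s)) x]
      _ ≤ ENNReal.ofReal L * ENNReal.ofReal S := mul_le_mul_left hmL _
      _ = _ := by rw [← ENNReal.ofReal_mul hL, mul_comm]
  have hqm' : Measurable fun y => q y ^ (1 + s) := by fun_prop
  have hqi : Integrable (fun y => (q y ^ (1 + s)).toReal) (gibbsLaw f (k + 1) c) :=
    integrable_toReal_of_lintegral_ne_top hqm'.aemeasurable
      (hqL.trans_lt ENNReal.ofReal_lt_top).ne
  have hqI : ∫ y, (q y ^ (1 + s)).toReal ∂gibbsLaw f (k + 1) c ≤ S * L := by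
    rw [integral_toReal hqm'.aemeasurable (ae_lt_top hqm' (hqL.trans_lt ENNReal.ofReal_lt_top).ne)]
    exact ENNReal.toReal_le_of_le_ofReal (by positivity) hqL
  have hri : Integrable (fun y => (q y / P).toReal) (gibbsLaw f (k + 1) c) :=
    integrable_toReal_of_lintegral_ne_top hr.aemeasurable (hr1.trans_ne ENNReal.one_ne_top)
  have hrI : ∫ y, (q y / P).toReal ∂gibbsLaw f (k + 1) c = 1 := by
    rw [integral_toReal hr.aemeasurable (ae_lt_top hr (by simp [hr1])), hr1, ENNReal.toReal_one]
  -- The majorant of `r log r` for `r = q / P` comes from `log q ≤ q^s / s`.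
  have hwi : Integrable (fun y => (s * P.toReal)⁻¹ * (q y ^ (1 + s)).toReal +
      -Real.log P.toReal * (q y / P).toReal) (gibbsLaw f (k + 1) c) :=
    (hqi.const_mul _).add (hri.const_mul _)
  refine (InformationTheory.klDiv_withDensity_le hr hr1 hwi (ae_of_all _ fun y => ?_)).trans
    (ENNReal.ofReal_le_ofReal ?_)
  · change (q y / P).toReal * Real.log (q y / P).toReal ≤ _
    rw [ENNReal.toReal_div, ← ENNReal.toReal_rpow]
    rcases (ENNReal.toReal_nonneg (a := q y)).eq_or_lt with h | h
    · rw [← h, Real.zero_rpow (by positivity)]; simp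
    · rw [Real.log_div h.ne' hP0.ne']
      have h1 := Real.log_le_rpow_div h.le hs
      have h2 : (s * P.toReal)⁻¹ * (q y).toReal ^ (1 + s) =
          (q y).toReal / P.toReal * ((q y).toReal ^ s / s) := by
        rw [Real.rpow_add h, Real.rpow_one]; field_simp
      rw [h2]
      have h3 : 0 ≤ (q y).toReal / P.toReal := by positivity
      nlinarith [mul_le_mul_of_nonneg_left h1 h3]
  · rw [integral_add (hqi.const_mul _) (hri.const_mul _), integral_const_mul, integral_const_mul,
      hrI, mul_one, ← sub_eq_add_neg]
    have h1 : Real.log p ≤ Real.log P.toReal := Real.log_le_log hp hPr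
    have h2 : (s * P.toReal)⁻¹ * ∫ y, (q y ^ (1 + s)).toReal ∂gibbsLaw f (k + 1) c ≤
        S * L / (s * p) := by
      rw [inv_mul_eq_div]
      gcongr
    linarith

end EnsembleProjection.MemF

/-! ### Comparison of Gaussian peaks and conclusion -/

/-- The peaks alone have ratio `√(n/M)`, but the relative error at `M` has order `1/√M`, not `1/√n`.
Writing the left side as `(β√M + E)/M` and enlarging `√M` to `√n` makes the error relative to `√n`;
this is what turns `√(n/M)` into `n/M`. -/
theorem gaussian_peak_ratio_le {β E C n M : ℝ} (hβ : 0 < β) (hE : 0 < E) (hC : E / β ≤ C)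
    (hM : 0 < M) (hMn : M ≤ n) (hn : C < √n) :
    β / √M + E / M ≤ n / M * ((1 + C / √n) / (1 - C / √n)) * (β / √n - E / n) := by
  have hC0 : 0 < C := (div_pos hE hβ).trans_le hC
  have hn0 : 0 < n := hM.trans_le hMn
  set a := √n with ha
  set b := √M with hb
  have hb0 : 0 < b := Real.sqrt_pos.2 hM
  have ha0 : 0 < a := Real.sqrt_pos.2 hn0
  have hba : b ≤ a := Real.sqrt_le_sqrt hMn
  have hna : n = a ^ 2 := (Real.sq_sqrt hn0.le).symm
  have hMb : M = b ^ 2 := (Real.sq_sqrt hM.le).symm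
  have hx : 0 < 1 - C / a := by rw [sub_pos, div_lt_one ha0]; exact hn
  rw [hna, hMb]
  have h1 : β / a * (1 - C / a) ≤ β / a - E / a ^ 2 := by
    have hE' : E ≤ C * β := (div_le_iff₀ hβ).1 hC
    have : β / a * (1 - C / a) = β / a - C * β / a ^ 2 := by field_simp
    rw [this]
    gcongr
  calc β / b + E / b ^ 2 = (β * b + E) / b ^ 2 := by field_simp
    _ ≤ (β * a + C * β) / b ^ 2 := by
        have hE' : E ≤ C * β := (div_le_iff₀ hβ).1 hC
        gcongr
    _ = a ^ 2 / b ^ 2 * ((1 + C / a) / (1 - C / a)) * (β / a * (1 - C / a)) := by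
        have : a - C ≠ 0 := by linarith
        field_simp
    _ ≤ _ := by gcongr

theorem log_one_add_div_one_sub_le {x : ℝ} (hx : 0 ≤ x) (hx1 : x < 1) :
    Real.log ((1 + x) / (1 - x)) ≤ 2 * x / (1 - x) := by
  have h : 0 < 1 - x := by linarith
  refine (Real.log_le_sub_one_of_pos (by positivity)).trans (le_of_eq ?_)
  field_simp
  ring

theorem one_add_div_one_sub_mul_le {x y : ℝ} (hx : 0 ≤ x) (hx1 : x ≤ 1 / 2) (hy : 1 ≤ y) :
    y * ((1 + x) / (1 - x)) - 1 ≤ (y - 1) * 3 + 4 * x := by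
  have h : 0 < 1 - x := by linarith
  have h1 : (1 + x) / (1 - x) ≤ 1 + 4 * x := by
    rw [div_le_iff₀ h]; nlinarith
  nlinarith [mul_le_mul_of_nonneg_left h1 (by linarith : (0 : ℝ) ≤ y)]

namespace EnsembleProjection.MemF

variable {f : ℝ → WithTop ℝ} (hf : MemF f)
include hf

/-- Two-sided control of the density of the total energy: a uniform upper bound, and a lower bound
at the mean. -/
theorem exists_ratio_bound {c t : ℝ} (hc : 0 < c) (ht : t = energy f (gibbs f 1 c)) :
    ∃ β C₀ : ℝ, 0 < β ∧ 0 < C₀ ∧ ∃ N : ℕ,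
      (∀ m, N ≤ m → ∀ u, convPow (fun u => ENNReal.ofReal (dens f c u)) m u ≤
        ENNReal.ofReal (β * (1 + C₀) / √((m + 1 : ℕ) : ℝ))) ∧
      (∀ m, N ≤ m → 2 * C₀ ≤ √((m + 1 : ℕ) : ℝ) → ENNReal.ofReal (β / (2 * √((m + 1 : ℕ) : ℝ))) ≤
        convPow (fun u => ENNReal.ofReal (dens f c u)) m ((m + 1 : ℕ) * t)) ∧
      ∀ C, C₀ ≤ C → ∀ k m, N ≤ m → C < √((k + m + 1 : ℕ) : ℝ) → ∀ x,
        convPow (fun u => ENNReal.ofReal (dens f c u)) m x ≤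
          ENNReal.ofReal (((k + m + 1 : ℕ) : ℝ) / ((m + 1 : ℕ) : ℝ) *
            ((1 + C / √((k + m + 1 : ℕ) : ℝ)) / (1 - C / √((k + m + 1 : ℕ) : ℝ)))) *
          convPow (fun u => ENNReal.ofReal (dens f c u)) (k + m) ((k + m + 1 : ℕ) * t) := by
  obtain ⟨β, E, hβ, hE, N, h⟩ := hf.exists_local_limit hc ht
  simp only [← Nat.cast_succ, Nat.succ_eq_add_one] at h
  have hsq : ∀ m : ℕ, 1 ≤ √((m + 1 : ℕ) : ℝ) := fun m =>
    Real.one_le_sqrt.2 (by push_cast; linarith [Nat.cast_nonneg (α := ℝ) m])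
  have hss : ∀ m : ℕ, ((m + 1 : ℕ) : ℝ) = √((m + 1 : ℕ) : ℝ) ^ 2 := fun m =>
    (Real.sq_sqrt (by positivity)).symm
  refine ⟨β, E / β, hβ, by positivity, N, fun m hm u => ?_, fun m hm hC => ?_,
    fun C hC k m hm hn x => ?_⟩
  · refine ((h m hm).1 u).trans (ENNReal.ofReal_le_ofReal ?_)
    have h1 := hsq m
    have h2 : E / ((m + 1 : ℕ) : ℝ) ≤ E / √((m + 1 : ℕ) : ℝ) := by
      gcongr
      conv_rhs => rw [hss m]
      nlinarith
    calc _ ≤ β / √((m + 1 : ℕ) : ℝ) + E / √((m + 1 : ℕ) : ℝ) := by gcongr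
      _ = _ := by field_simp
  · refine (ENNReal.ofReal_le_ofReal ?_).trans (h m hm).2
    have h1 := hsq m
    have h2 : E / ((m + 1 : ℕ) : ℝ) ≤ β / (2 * √((m + 1 : ℕ) : ℝ)) := by
      conv_lhs => rw [hss m]
      rw [div_le_div_iff₀ (by positivity) (by positivity)]
      have : 2 * E ≤ √((m + 1 : ℕ) : ℝ) * β := by
        rw [← div_le_iff₀ hβ, mul_div_assoc]; exact hC
      nlinarith
    have h3 : β / √((m + 1 : ℕ) : ℝ) = β / (2 * √((m + 1 : ℕ) : ℝ)) + β / (2 * √((m + 1 : ℕ) : ℝ)) := by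
      field_simp; norm_num
    linarith
  · have hC0 : 0 < C := (div_pos hE hβ).trans_le hC
    have hn0 : 0 < √((k + m + 1 : ℕ) : ℝ) := hC0.trans hn
    have hx : 0 < 1 - C / √((k + m + 1 : ℕ) : ℝ) := by
      rw [sub_pos, div_lt_one hn0]; exact hn
    calc convPow (fun u => ENNReal.ofReal (dens f c u)) m x
        ≤ ENNReal.ofReal (β / √((m + 1 : ℕ) : ℝ) + E / ((m + 1 : ℕ) : ℝ)) := (h m hm).1 x
      _ ≤ _ := ENNReal.ofReal_le_ofReal (gaussian_peak_ratio_le hβ hE hC (by positivity)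
          (by exact_mod_cast (by omega : m + 1 ≤ k + m + 1)) hn)
      _ = _ := ENNReal.ofReal_mul (by positivity)
      _ ≤ _ := mul_le_mul_right (h (k + m) (by omega)).2 _

end EnsembleProjection.MemF

end

namespace EnsembleProjection.MemF

variable {f : ℝ → WithTop ℝ} (hf : MemF f)
include hf

/-- The divergence bound when only boundedly many coordinates are integrated out. -/
theorem exists_klDiv_projLaw_le_log {c t : ℝ} (hc : 0 < c) (ht : t = energy f (gibbs f 1 c))
    (N : ℕ) : ∃ n₀ : ℕ, ∀ k m, m < N → n₀ ≤ k + m + 1 →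
      InformationTheory.klDiv (projLaw f (k + m + 1) k t) (gibbsLaw f k c) ≤
        ENNReal.ofReal (Real.log (((k + m + 1 : ℕ) : ℝ) / ((m + 1 : ℕ) : ℝ))) := by
  have ht0 : 0 < t := ht ▸ hf.energy_gibbs_one_pos hc
  obtain ⟨β, C₀, hβ, hC₀, N₀, hup, hlow, -⟩ := hf.exists_ratio_bound hc ht
  obtain ⟨s, hs, L, hL, hsL⟩ := hf.exists_lintegral_rpow_convPow_le hc
  -- With `S` and `p` both of order `1/√n` the divergence is at most a constant plus `½ log n`. It
  -- stays below `log n - log (m + 1)` once `A ≤ ½ log n`.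
  set A : ℝ := 4 * (1 + C₀) * L / s - Real.log (β / 2) + Real.log (N + 1) with hA
  have hlog : ∀ᶠ n : ℕ in atTop, 2 * A ≤ Real.log n :=
    (Real.tendsto_log_atTop.comp tendsto_natCast_atTop_atTop).eventually_ge_atTop _
  have hsqrt : ∀ᶠ n : ℕ in atTop, 2 * C₀ ≤ √(n : ℝ) :=
    (Real.tendsto_sqrt_atTop.comp tendsto_natCast_atTop_atTop).eventually_ge_atTop _
  obtain ⟨n₁, hn₁⟩ := eventually_atTop.1 (hlog.and hsqrt)
  refine ⟨n₁ + 2 * N + 2 * N₀ + 4, fun k m hm hn => ?_⟩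
  obtain ⟨k, rfl⟩ : ∃ k', k = k' + 1 := ⟨k - 1, by omega⟩
  obtain ⟨hlog, hsqrt⟩ := hn₁ (k + 1 + m + 1) (by omega)
  set n : ℝ := ((k + 1 + m + 1 : ℕ) : ℝ) with hndef
  have hn0 : 0 < n := by positivity
  have hsn : 0 < √n := Real.sqrt_pos.2 hn0
  -- Only a bounded number of coordinates is missing, so `k + 1 ≥ n / 4` for large `n`.
  have hk4 : √n / 2 ≤ √((k + 1 : ℕ) : ℝ) := by
    refine Real.le_sqrt_of_sq_le ?_
    rw [div_pow, Real.sq_sqrt hn0.le, hndef, div_le_iff₀ (by norm_num)]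
    exact_mod_cast (by omega : k + 1 + m + 1 ≤ (k + 1) * 2 ^ 2)
  have hS : ∀ u, convPow (fun u => ENNReal.ofReal (dens f c u)) k u ≤
      ENNReal.ofReal (β * (1 + C₀) / (√n / 2)) := fun u =>
    (hup k (by omega) u).trans (ENNReal.ofReal_le_ofReal (by gcongr))
  refine (hf.klDiv_projLaw_le_of_rpow hc ht0 k m (p := β / (2 * √n)) (by positivity) hs
    (by positivity) hL.le (hlow (k + 1 + m) (by omega) hsqrt)
    ((hup (k + 1 + m) (by omega) _).trans_lt ENNReal.ofReal_lt_top).ne hS (hsL m)).trans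
    (ENNReal.ofReal_le_ofReal ?_)
  have e1 : β * (1 + C₀) / (√n / 2) * L / (s * (β / (2 * √n))) = 4 * (1 + C₀) * L / s := by
    field_simp; ring
  have e2 : Real.log (β / (2 * √n)) = Real.log (β / 2) - Real.log n / 2 := by
    rw [← div_div, Real.log_div (by positivity) hsn.ne', Real.log_sqrt hn0.le]
  have e3 : Real.log ((m + 1 : ℕ) : ℝ) ≤ Real.log (N + 1) := by
    refine Real.log_le_log (by positivity) ?_
    exact_mod_cast (by omega : m + 1 ≤ N + 1)
  rw [e1, e2, Real.log_div hn0.ne' (by positivity)]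
  linarith

end EnsembleProjection.MemF

theorem corollary3p7 (f : ℝ → WithTop ℝ) (hf : EnsembleProjection.MemF f) (c t : ℝ) (hc : 0 < c)
    (ht : t = EnsembleProjection.energy f (EnsembleProjection.gibbs f 1 c)) :
    (∃ C : ℝ, 0 < C ∧ ∀ n k : ℕ, k < n → C < Real.sqrt n →
      IsProbabilityMeasure (EnsembleProjection.surfaceLaw f n t) ∧
      EnsembleProjection.projLaw f n k t ≪ volume ∧
      InformationTheory.klDiv (EnsembleProjection.projLaw f n k t)
          (EnsembleProjection.gibbsLaw f k c) ≤
        ENNReal.ofReal (Real.log ((n : ℝ) / ((n : ℝ) - (k : ℝ))) + 2 / (Real.sqrt n / C - 1))) ∧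
    (∀ k : ℕ,
      (fun n : ℕ => ∫ y, |EnsembleProjection.projDensity f n k t y -
          EnsembleProjection.gibbs f k c y|)
        =O[atTop] (fun n : ℕ => 1 / Real.sqrt n)) := by
  have ht0 : 0 < t := ht ▸ hf.energy_gibbs_one_pos hc
  obtain ⟨β, C₀, hβ, hC₀, N, hup, hlow, hratio⟩ := hf.exists_ratio_bound hc ht
  obtain ⟨n₀, hn₀⟩ := hf.exists_klDiv_projLaw_le_log hc ht N
  -- The summands make `√n > C` force `2 C₀ ≤ √n`, `N + 1 ≤ n` and `n₀ ≤ n`. Enlarging `C₀` is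
  -- harmless because the ratio bound holds for every `C ≥ C₀`.
  set C : ℝ := 2 * C₀ + √(N + 1) + √n₀ with hCdef
  have hC0 : 0 < C := by positivity
  have hfacts : ∀ n : ℕ, C < √(n : ℝ) → N + 1 ≤ n ∧ n₀ ≤ n ∧ 2 * C₀ ≤ √(n : ℝ) := by
    intro n hn
    have hs1 := Real.sqrt_nonneg ((N : ℝ) + 1)
    have hs2 := Real.sqrt_nonneg (n₀ : ℝ)
    refine ⟨?_, ?_, by linarith⟩
    · have : (N : ℝ) + 1 ≤ n := (Real.sqrt_lt_sqrt_iff (by positivity)).1 (by linarith) |>.le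
      exact_mod_cast this
    · have : (n₀ : ℝ) ≤ n := (Real.sqrt_lt_sqrt_iff (by positivity)).1 (by linarith) |>.le
      exact_mod_cast this
  have hp0 : ∀ d : ℕ, C < √((d + 1 : ℕ) : ℝ) →
      convPow (fun u => ENNReal.ofReal (EnsembleProjection.dens f c u)) d ((d + 1 : ℕ) * t) ≠ 0 := by
    intro d hd
    obtain ⟨h1, -, h3⟩ := hfacts _ hd
    have hsd : 0 < √((d + 1 : ℕ) : ℝ) := hC0.trans hd
    refine ((ENNReal.ofReal_pos.2 ?_).trans_le (hlow d (by omega) h3)).ne'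
    positivity
  have hp1 : ∀ d : ℕ, C < √((d + 1 : ℕ) : ℝ) →
      convPow (fun u => ENNReal.ofReal (EnsembleProjection.dens f c u)) d ((d + 1 : ℕ) * t) ≠ ∞ := by
    intro d hd
    obtain ⟨h1, -, -⟩ := hfacts _ hd
    exact ((hup d (by omega) _).trans_lt ENNReal.ofReal_lt_top).ne
  have hCC₀ : C₀ ≤ C := by
    have hs1 := Real.sqrt_nonneg ((N : ℝ) + 1)
    have hs2 := Real.sqrt_nonneg (n₀ : ℝ)
    linarith
  refine ⟨⟨C, hC0, fun n k hkn hn => ?_⟩, fun k => ?_⟩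
  · obtain ⟨m, rfl⟩ : ∃ m, n = k + m + 1 := ⟨n - k - 1, by omega⟩
    refine ⟨hf.isProbabilityMeasure_surfaceLaw hc ht0 (hp0 _ hn) (hp1 _ hn),
      hf.projLaw_absolutelyContinuous hc ht0 k m (hp0 _ hn) (hp1 _ hn), ?_⟩
    have hsub : ((k + m + 1 : ℕ) : ℝ) - k = ((m + 1 : ℕ) : ℝ) := by push_cast; ring
    rw [hsub]
    set x := C / √((k + m + 1 : ℕ) : ℝ) with hx
    have hsn : 0 < √((k + m + 1 : ℕ) : ℝ) := hC0.trans hn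
    have hx0 : 0 < x := by positivity
    have hx1 : x < 1 := (div_lt_one hsn).2 hn
    have hx1' : 0 < 1 - x := by linarith
    have hlast : 2 / (√((k + m + 1 : ℕ) : ℝ) / C - 1) = 2 * x / (1 - x) := by
      have : √((k + m + 1 : ℕ) : ℝ) / C = x⁻¹ := by rw [hx, inv_div]
      rw [this]
      field_simp
    rw [hlast]
    -- With fewer than `N + 1` coordinates integrated out, the logarithm alone suffices, by the
    -- `L^{1+s}` bound. Otherwise the uniform bound on the ratio applies.
    rcases lt_or_ge m N with hmN | hmN
    · refine (hn₀ k m hmN (hfacts _ hn).2.1).trans (ENNReal.ofReal_le_ofReal ?_)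
      have : 0 ≤ 2 * x / (1 - x) := by positivity
      linarith
    · refine (hf.klDiv_projLaw_le_log hc ht0 k m (hp0 _ hn) (hp1 _ hn) (by positivity)
        (hratio C hCC₀ k m hmN hn)).trans (ENNReal.ofReal_le_ofReal ?_)
      rw [← hx, Real.log_mul (by positivity) (by positivity)]
      gcongr
      exact log_one_add_div_one_sub_le hx0.le hx1
  -- The constant is `2 (3 · 2k + 4C)`: with `y = n/(n-k)` and `x = C/√n`, one has `2(Λ - 1) ≤ 6(y -
  -- 1) + 8x`, and `y - 1 ≤ 2k/√n` once `n ≥ 2k`.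
  · refine Asymptotics.IsBigO.of_bound (12 * k + 8 * C) ?_
    have hsqrt : ∀ᶠ n : ℕ in atTop, 2 * C ≤ √(n : ℝ) :=
      (Real.tendsto_sqrt_atTop.comp tendsto_natCast_atTop_atTop).eventually_ge_atTop _
    filter_upwards [hsqrt, eventually_ge_atTop (2 * k + N + 1)] with n hn hkn
    obtain ⟨m, rfl⟩ : ∃ m, n = k + m + 1 := ⟨n - k - 1, by omega⟩
    have hn' : C < √((k + m + 1 : ℕ) : ℝ) := by linarith
    have hsn : 0 < √((k + m + 1 : ℕ) : ℝ) := hC0.trans hn'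
    set x := C / √((k + m + 1 : ℕ) : ℝ) with hx
    have hx0 : 0 < x := by positivity
    have hx2 : x ≤ 1 / 2 := by rw [hx, div_le_div_iff₀ hsn (by norm_num)]; linarith
    have hx1' : 0 < 1 - x := by linarith
    set y := ((k + m + 1 : ℕ) : ℝ) / ((m + 1 : ℕ) : ℝ) with hy
    have hm0 : (0 : ℝ) < ((m + 1 : ℕ) : ℝ) := by positivity
    have hy1 : 1 ≤ y := by
      rw [hy, one_le_div hm0]
      exact_mod_cast (by omega : m + 1 ≤ k + m + 1)
    have hyk : y - 1 ≤ 2 * k / √((k + m + 1 : ℕ) : ℝ) := by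
      have h1 : y - 1 = k / ((m + 1 : ℕ) : ℝ) := by
        rw [hy]; field_simp; push_cast; ring
      have h2 : √((k + m + 1 : ℕ) : ℝ) ≤ ((k + m + 1 : ℕ) : ℝ) := by
        have h1 : (1 : ℝ) ≤ ((k + m + 1 : ℕ) : ℝ) := by
          exact_mod_cast (by omega : 1 ≤ k + m + 1)
        exact Real.sqrt_le_iff.2 ⟨by positivity, by nlinarith⟩
      have h3 : ((k + m + 1 : ℕ) : ℝ) ≤ 2 * ((m + 1 : ℕ) : ℝ) := by
        exact_mod_cast (by omega : k + m + 1 ≤ 2 * (m + 1))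
      rw [h1, div_le_div_iff₀ hm0 hsn]
      nlinarith [Nat.cast_nonneg (α := ℝ) k]
    have hΛ1 : 1 ≤ y * ((1 + x) / (1 - x)) :=
      one_le_mul_of_one_le_of_one_le hy1 ((one_le_div hx1').2 (by linarith))
    have hmain := hf.integral_abs_projDensity_sub_le hc ht0 k m (hp0 _ hn') (hp1 _ hn') hΛ1
      (hratio C hCC₀ k m (by omega) hn')
    have hnum := one_add_div_one_sub_mul_le hx0.le hx2 hy1
    rw [Real.norm_of_nonneg (integral_nonneg fun y => abs_nonneg _),
      Real.norm_of_nonneg (by positivity)]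
    have hfin : (12 * (k : ℝ) + 8 * C) * (1 / √((k + m + 1 : ℕ) : ℝ)) =
        6 * (2 * k / √((k + m + 1 : ℕ) : ℝ)) + 8 * x := by
      rw [hx]; field_simp; ring
    rw [hfin]
    linarith
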